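/- Let $d\in\{1,2\}$, let $L_1,\dots,L_d>0$, and let $\Lambda=L_1\mathbb Z\times L_2\mathbb Z$ if $d=2$, $\Lambda=L_1\mathbb Z\times\{0\}$ if $d=1$. Let $\Omega\subseteq\mathbb R^2$ be a nonempty connected open set of class $C^3$ such that $\Omega+k=\Omega$ for all $k\in\Lambda$ and, if $d=1$, the second coordinate is bounded on $\Omega$. Let $C=\{z\in\Omega : 0<z_i<L_i \text{ for } 1\le i\le d\}$ be the periodicity cell. Let $q\in C^{1,\delta}(\overline\Omega;\mathbb R^2)$, for some $\delta>0$, be $\Lambda$-periodic with $$\nabla\cdot q=0 \text{ in } \overline\Omega,\qquad q\cdot\nu=0\text{ on }\partial\Omega,\qquad \int_C q_i=0\quad\text{for } 1\le i\le d,$$ where $\nu$ is the unit outward normal on $\partial\Omega$ (if $\partial\Omega\neq\emptyset$). A first integral of $q$ is a $\Lambda$-periodic function $w\in H^1_{loc}(\overline\Omega)$, $w\ne0$, with $q\cdot\nabla w=0$ almost everywhere in $\Omega$. A trajectory of $q$ in $\Omega$ is a set $T=\{X(t):t\in\mathbb R\}\subseteq\Omega$ with $X'(t)=q(X(t))$ for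 all $t\in\mathbb R$; an unbounded trajectory $T$ is called periodic, and more precisely $\mathbf a$-periodic, if $\mathbf a\in\Lambda\setminus\{0\}$ and $T=T+\mathbf a$. Then the following two statements are equivalent: (i) there is a first integral $w$ of $q$ with $\int_C q\,w^2\ne0$; (ii) there is a periodic unbounded trajectory of $q$ in $\Omega$. Moreover, if $T$ is an unbounded $\mathbf a$-periodic trajectory of $q$ in $\Omega$, then $\int_C q\,w^2\in\mathbb R\mathbf a$ for every first integral $w$ of $q$. -/

import Mathlib

open MeasureTheory Topology
open scoped NNReal ContDiff InnerProductSpace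

/-- The Euclidean plane. -/
abbrev Plane : Type := EuclideanSpace ℝ (Fin 2)

/-- The `i`-th vector of the canonical basis of the plane. -/
noncomputable def stdVec (i : Fin 2) : Plane := EuclideanSpace.single i (1 : ℝ)

/-- The group of periods: `L₁ℤ × L₂ℤ` when `d = 2`, and `L₁ℤ × {0}` when `d = 1`.
Only the values `L i` with `i < d` are used. -/
def periodLattice (d : ℕ) (L : Fin 2 → ℝ) : Set Plane :=
  {k | ∀ i : Fin 2, (i.val < d → ∃ m : ℤ, k i = m * L i) ∧ (d ≤ i.val → k i = 0)}

/-- `ρ` is a `C³` defining function of `Ω` in the neighbourhood `U` of the point `p`. -/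
structure IsLocalDefiningFunction (Ω : Set Plane) (p : Plane) (U : Set Plane)
    (ρ : Plane → ℝ) : Prop where
  isOpen : IsOpen U
  mem : p ∈ U
  contDiffOn : ContDiffOn ℝ 3 ρ U
  gradient_ne_zero : ∀ z ∈ U, gradient ρ z ≠ 0
  inter_eq : Ω ∩ U = {z ∈ U | ρ z < 0}

/-- Near each of its boundary points, `Ω` lies on one side of a regular curve of class `C³`. -/
def HasC3Boundary (Ω : Set Plane) : Prop :=
  ∀ p ∈ frontier Ω, ∃ U ρ, IsLocalDefiningFunction Ω p U ρ

/-- `ν` is the unit outward normal to `∂Ω` at `p`. -/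
def IsOuterUnitNormal (Ω : Set Plane) (p ν : Plane) : Prop :=
  p ∈ frontier Ω ∧ ∃ U ρ, IsLocalDefiningFunction Ω p U ρ ∧ ν = ‖gradient ρ p‖⁻¹ • gradient ρ p

/-- `Ω` is a nonempty connected open set of class `C³`, bounded in the directions `i ≥ d` and
`L i`-periodic in the directions `i < d`. -/
structure IsPeriodicDomain (d : ℕ) (L : Fin 2 → ℝ) (Ω : Set Plane) : Prop where
  isOpen : IsOpen Ω
  isConnected : IsConnected Ω
  hasC3Boundary : HasC3Boundary Ω
  bounded : ∃ R : ℝ, 0 ≤ R ∧ ∀ z ∈ Ω, ∀ i : Fin 2, d ≤ i.val → |z i| ≤ R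
  periodic : ∀ k ∈ periodLattice d L, (fun z => z + k) '' Ω = Ω

/-- The periodicity cell of `Ω`. -/
def periodCell (d : ℕ) (L : Fin 2 → ℝ) (Ω : Set Plane) : Set Plane :=
  {z ∈ Ω | ∀ i : Fin 2, i.val < d → 0 < z i ∧ z i < L i}

/-- `q` is of class `C^{1,δ}` on the closure of `Ω`: it is `C¹` in `Ω`, it is continuous up to
the boundary, and the usual `C^{1,δ}` norm over `Ω` is finite. In particular the differential of
`q` is uniformly continuous in `Ω`, so that it extends continuously to the closure. -/
structure IsC1Holder (δ : ℝ≥0) (Ω : Set Plane) (q : Plane → Plane) : Prop where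
  contDiffOn : ContDiffOn ℝ 1 q Ω
  continuousOn : ContinuousOn q (closure Ω)
  bounded : ∃ M : ℝ, ∀ z ∈ Ω, ‖q z‖ ≤ M ∧ ‖fderiv ℝ q z‖ ≤ M
  holder : ∃ K : ℝ≥0, HolderOnWith K δ (fderiv ℝ q) Ω

/-- The divergence of a vector field. -/
noncomputable def divergence (q : Plane → Plane) (z : Plane) : ℝ :=
  ∑ i : Fin 2, fderiv ℝ q z (stdVec i) i

/-- `q` is a periodic incompressible field of class `C^{1,δ}` on the closure of `Ω` for some
`δ > 0`, tangent to `∂Ω`, whose components `i < d` have zero mean. (By continuity of the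
first derivatives up to the boundary it suffices to ask for zero divergence in `Ω`.) -/
structure IsAdmissibleAdvection (d : ℕ) (L : Fin 2 → ℝ) (Ω : Set Plane)
    (q : Plane → Plane) : Prop where
  regular : ∃ δ : ℝ≥0, 0 < δ ∧ IsC1Holder δ Ω q
  periodic : ∀ k ∈ periodLattice d L, ∀ z ∈ closure Ω, q (z + k) = q z
  divergence_eq_zero : ∀ z ∈ Ω, divergence q z = 0
  tangent : ∀ p ν, IsOuterUnitNormal Ω p ν → ⟪q p, ν⟫_ℝ = 0
  mean_zero : ∀ i : Fin 2, i.val < d → ∫ z in periodCell d L Ω, q z i = 0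

/-- `G` is the weak gradient of `w` in `Ω` (meant for locally integrable `w` and `G`). -/
def HasWeakGradient (Ω : Set Plane) (w : Plane → ℝ) (G : Plane → Plane) : Prop :=
  ∀ ψ : Plane → ℝ, ContDiff ℝ ∞ ψ → HasCompactSupport ψ → tsupport ψ ⊆ Ω →
    ∀ i : Fin 2, ∫ z in Ω, w z * fderiv ℝ ψ z (stdVec i) = - ∫ z in Ω, G z i * ψ z

/-- `w` is in `H¹_loc` of the closure of `Ω`, with weak gradient `G`: both are square integrable
on the bounded parts of `Ω`, up to the boundary. -/
structure IsH1LocWithGradient (Ω : Set Plane) (w : Plane → ℝ) (G : Plane → Plane) : Prop where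
  memLp : ∀ K : Set Plane, IsCompact K → MemLp w 2 (volume.restrict (Ω ∩ K))
  memLp_gradient : ∀ K : Set Plane, IsCompact K → MemLp G 2 (volume.restrict (Ω ∩ K))
  hasWeakGradient : HasWeakGradient Ω w G

/-- `w` represents a first integral of `q`: a nonzero periodic element of `H¹_loc` of the closure
of `Ω` with `q · ∇w = 0` almost everywhere in `Ω`. -/
structure IsFirstIntegral (d : ℕ) (L : Fin 2 → ℝ) (Ω : Set Plane) (q : Plane → Plane)
    (w : Plane → ℝ) : Prop where
  ne_zero : ¬ (w =ᵐ[volume.restrict Ω] 0)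
  periodic : ∀ k ∈ periodLattice d L, ∀ᵐ z ∂(volume.restrict Ω), w (z + k) = w z
  exists_gradient : ∃ G : Plane → Plane, IsH1LocWithGradient Ω w G ∧
    ∀ᵐ z ∂(volume.restrict Ω), ⟪q z, G z⟫_ℝ = 0

/-- The vector `∫_C q w²`, where `C` is the periodicity cell. -/
noncomputable def weightedFlux (d : ℕ) (L : Fin 2 → ℝ) (Ω : Set Plane) (q : Plane → Plane)
    (w : Plane → ℝ) : Plane :=
  ∫ z in periodCell d L Ω, (w z) ^ 2 • q z

/-- `T` is a trajectory of `q` in `Ω`: the set of all points `X t`, `t ∈ ℝ`, of a solution of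
`X' = q(X)` in `Ω`. -/
def IsTrajectory (Ω : Set Plane) (q : Plane → Plane) (T : Set Plane) : Prop :=
  ∃ X : ℝ → Plane, (∀ t, X t ∈ Ω) ∧ (∀ t, HasDerivAt X (q (X t)) t) ∧ T = Set.range X

/-- `T` is an unbounded trajectory of `q` in `Ω` that is invariant under the translation by the
nonzero period `a`. -/
structure IsUnboundedPeriodicTrajectory (d : ℕ) (L : Fin 2 → ℝ) (Ω : Set Plane)
    (q : Plane → Plane) (T : Set Plane) (a : Plane) : Prop where
  isTrajectory : IsTrajectory Ω q T
  unbounded : ¬ Bornology.IsBounded T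
  period_mem : a ∈ periodLattice d L
  period_ne_zero : a ≠ 0
  add_period : (fun z => z + a) '' T = T

/-!
# Fluxes of first integrals and periodic trajectories

The proof is dynamical.

*The flow.* Since `q` is tangent to `∂Ω`, the distance to the boundary decreases at most
exponentially along a trajectory, so `q` has a complete flow `φ` in `Ω`
(`IsTangentField.exists_isFlow`). The flow commutes with the periods. As `q` is divergence free it
preserves the area (`IsFlow.measurePreserving`), and first integrals are invariant under it
(`IsFlow.ae_comp_eq`). Both facts come from transporting test functions, which become merely
Lipschitz, so weak gradients are first tested against Lipschitz functions.

*The stream function.* A field `g q` with a bounded invariant periodic density `g`, extended by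
zero, is divergence free in the whole plane, hence has a Lipschitz stream function
(`IsPeriodicFlow.exists_streamFunction`). Its increment over a period `k` is zero if `d = 1`, since
the field vanishes outside a strip, and is proportional to the cross product of `∫_C g q` and `k` if
`d = 2`. In particular, by the zero mean conditions, the stream function `H` of `q` itself is
periodic.

*Almost all trajectories close up.* Modulo the periods `Ω` has finite area, so almost every point
returns close to itself by Poincaré recurrence. Since `H` is constant along trajectories and
periodic, the return takes place on the same level of `H`, which near a point with `q ≠ 0` is a
single arc of trajectory. Hence almost every `z` with `q z ≠ 0` satisfies `φ τ z = z + k` for some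
`τ > 0` and some period `k` (`IsPeriodicFlow.ae_exists_apply_eq_add`).

*The rotation formula.* For an invariant density `g` the mean displacement `∫_C g (φ t z - z)` is
additive in `t`. Comparing `t → 0` with `t → ∞` gives `∫_C g q = ∫_C g v`, where `v = k / τ` is the
rotation vector (`IsPeriodicFlow.setIntegral_smul_field_eq`). With `g = w²`, a nonzero flux forces
`k ≠ 0` somewhere, and the trajectory through that point is unbounded and `k`-periodic.

*Tubes.* Conversely, the trajectories near an `a`-periodic one are all `a`-periodic, and they fill a
closed tube. A bump function of `H`, cut off to the tube, is a first integral whose flux is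
`∫_C w² a / τ`, a nonzero multiple of `a` (`IsPeriodicFlow.exists_tube_firstIntegral`).

*The direction of the flux.* Let `d = 2`. Given such a `w`, the stream function of `w² q` is constant along every
trajectory, while its increment over `k` is proportional to the cross product of `a` and `k`. So all
the periods `k` that occur above are parallel to `a`, and by the rotation formula so are the fluxes
of all first integrals (`IsPeriodicFlow.crossForm_eq_zero`). If `d = 1` all periods are parallel.
-/

namespace PlanarFlow

open Set Filter Metric

/-! ### Global solutions of Lipschitz differential equations -/

section

/-- Solutions on the intervals `(-(n + 1), n + 1)` that extend each other define a solution on the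
whole line. -/
lemma exists_glued_solution {F : Plane → Plane} {X : ℕ → ℝ → Plane}
    (hX : ∀ n : ℕ, ∀ t ∈ Ioo (-(n + 1 : ℝ)) (n + 1), HasDerivAt (X n) (F (X n t)) t)
    (heq : ∀ m n : ℕ, m ≤ n → EqOn (X n) (X m) (Ioo (-(m + 1 : ℝ)) (m + 1))) :
    ∃ Y : ℝ → Plane, (∀ t, HasDerivAt Y (F (Y t)) t) ∧
      ∀ t, ∃ n : ℕ, t ∈ Ioo (-(n + 1 : ℝ)) (n + 1) ∧ Y t = X n t := by
  have hmem : ∀ t : ℝ, t ∈ Ioo (-((⌈|t|⌉₊ : ℕ) + 1 : ℝ)) ((⌈|t|⌉₊ : ℕ) + 1) := fun t =>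
    abs_lt.1 ((Nat.le_ceil _).trans_lt (by simp))
  refine ⟨fun t => X ⌈|t|⌉₊ t, fun t => ?_, fun t => ⟨_, hmem t, rfl⟩⟩
  refine (hX _ t (hmem t)).congr_of_eventuallyEq ?_
  filter_upwards [Ioo_mem_nhds (hmem t).1 (hmem t).2] with s hs
  rcases le_total ⌈|s|⌉₊ ⌈|t|⌉₊ with h | h
  · exact (heq _ _ h (hmem s)).symm
  · exact heq _ _ h hs

/-- A bounded Lipschitz vector field has solutions that are defined for all times. -/
lemma exists_global_solution {Q : Plane → Plane} {K : ℝ≥0} (hK : LipschitzWith K Q) {M : ℝ≥0}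
    (hM : ∀ z, ‖Q z‖ ≤ M) (z : Plane) :
    ∃ X : ℝ → Plane, X 0 = z ∧ ∀ t, HasDerivAt X (Q (X t)) t := by
  have h1 : ∀ n : ℕ, ∃ X : ℝ → Plane, X 0 = z ∧
      ∀ t ∈ Ioo (-(n + 1 : ℝ)) (n + 1), HasDerivAt X (Q (X t)) t := by
    intro n
    have h0 : (0 : ℝ) ∈ Icc (-(n + 1 : ℝ)) (n + 1) := ⟨by linarith [n.cast_nonneg (α := ℝ)],
      by positivity⟩
    have hpl : IsPicardLindelof (fun _ => Q) (tmin := -(n + 1 : ℝ)) (tmax := n + 1) ⟨0, h0⟩ z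
        (M * (n + 1)) 0 M K := by
      refine .of_time_independent (fun x _ => hM x) hK.lipschitzOnWith ?_
      simp
    obtain ⟨X, hX0, hX⟩ := hpl.exists_eq_forall_mem_Icc_hasDerivWithinAt₀
    exact ⟨X, hX0, fun t ht => (hX t (Ioo_subset_Icc_self ht)).hasDerivAt
      (Icc_mem_nhds ht.1 ht.2)⟩
  choose X hX0 hX using h1
  have heq : ∀ m n : ℕ, m ≤ n → EqOn (X n) (X m) (Ioo (-(m + 1 : ℝ)) (m + 1)) := by
    intro m n hmn
    have hmn' : (m : ℝ) ≤ n := by exact_mod_cast hmn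
    refine ODE_solution_unique_of_mem_Ioo (v := fun _ => Q) (s := fun _ => univ) (K := K)
      (t₀ := 0) (fun _ _ => hK.lipschitzOnWith) ⟨by linarith [m.cast_nonneg (α := ℝ)],
      by positivity⟩ (fun t ht => ⟨hX n t ⟨by linarith [ht.1], by linarith [ht.2]⟩, trivial⟩)
      (fun t ht => ⟨hX m t ht, trivial⟩) (by rw [hX0, hX0])
  obtain ⟨Y, hY, hYX⟩ := exists_glued_solution (F := Q) hX heq
  obtain ⟨n, -, hn⟩ := hYX 0
  exact ⟨Y, hn.trans (hX0 n), hY⟩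

/-- Grönwall's inequality, in both directions of time. -/
lemma dist_solution_le {Q : Plane → Plane} {K : ℝ≥0} (hK : LipschitzWith K Q) {X Y : ℝ → Plane}
    (hX : ∀ t, HasDerivAt X (Q (X t)) t) (hY : ∀ t, HasDerivAt Y (Q (Y t)) t) (t : ℝ) :
    dist (X t) (Y t) ≤ dist (X 0) (Y 0) * Real.exp (K * |t|) := by
  have key : ∀ {Q : Plane → Plane} (_ : LipschitzWith K Q) {X Y : ℝ → Plane}
      (_ : ∀ t, HasDerivAt X (Q (X t)) t) (_ : ∀ t, HasDerivAt Y (Q (Y t)) t) (t : ℝ), 0 ≤ t →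
      dist (X t) (Y t) ≤ dist (X 0) (Y 0) * Real.exp (K * t) := by
    intro Q hK X Y hX hY t ht
    have := dist_le_of_trajectories_ODE (v := fun _ => Q) (a := 0) (b := t) (fun _ => hK)
      (fun s _ => (hX s).continuousAt.continuousWithinAt) (fun s _ => (hX s).hasDerivWithinAt)
      (fun s _ => (hY s).continuousAt.continuousWithinAt) (fun s _ => (hY s).hasDerivWithinAt)
      le_rfl t ⟨ht, le_rfl⟩
    simpa using this
  rcases le_total 0 t with h | h
  · rw [abs_of_nonneg h]; exact key hK hX hY t h
  · have hK' : LipschitzWith K (fun z => -Q z) := hK.neg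
    have hX' : ∀ s, HasDerivAt (fun s => X (-s)) (-Q (X (-s))) s := fun s => by
      exact ((hX (-s)).scomp s (hasDerivAt_neg s)).congr_deriv (by simp)
    have hY' : ∀ s, HasDerivAt (fun s => Y (-s)) (-Q (Y (-s))) s := fun s => by
      exact ((hY (-s)).scomp s (hasDerivAt_neg s)).congr_deriv (by simp)
    have := key hK' hX' hY' (-t) (by linarith)
    simpa [abs_of_nonpos h] using this

/-! ### The distance to the boundary as a barrier -/

open Classical in
/-- The distance from `z` to the complement of `Ω`, replaced by the constant `1` when `Ω` is the
whole plane. -/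
noncomputable def boundaryDist (Ω : Set Plane) (z : Plane) : ℝ :=
  if Ωᶜ.Nonempty then infDist z Ωᶜ else 1

variable {Ω : Set Plane} {q : Plane → Plane}

lemma lipschitzWith_boundaryDist (Ω : Set Plane) : LipschitzWith 1 (boundaryDist Ω) := by
  unfold boundaryDist
  split_ifs
  · exact lipschitz_infDist_pt _
  · exact LipschitzWith.const' 1

lemma boundaryDist_nonneg (Ω : Set Plane) (z : Plane) : 0 ≤ boundaryDist Ω z := by
  unfold boundaryDist
  split_ifs
  · exact infDist_nonneg
  · exact zero_le_one

lemma boundaryDist_eq_zero {z : Plane} (hz : z ∉ Ω) : boundaryDist Ω z = 0 := by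
  rw [boundaryDist, if_pos ⟨z, hz⟩]
  exact infDist_zero_of_mem hz

lemma boundaryDist_pos (hΩ : IsOpen Ω) {z : Plane} (hz : z ∈ Ω) : 0 < boundaryDist Ω z := by
  unfold boundaryDist
  split_ifs with h
  · exact (hΩ.isClosed_compl.notMem_iff_infDist_pos h).1 (by simpa using hz)
  · exact zero_lt_one

lemma mem_of_boundaryDist_pos {z : Plane} (hz : 0 < boundaryDist Ω z) : z ∈ Ω := by
  by_contra h
  exact hz.ne' (boundaryDist_eq_zero h)

lemma ball_boundaryDist_subset (z : Plane) : ball z (boundaryDist Ω z) ⊆ Ω := by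
  unfold boundaryDist
  split_ifs with h
  · intro y hy
    by_contra hy'
    exact (infDist_le_dist_of_mem (x := z) hy').not_gt (by rwa [dist_comm, ← mem_ball])
  · intro y _
    by_contra hy'
    exact h ⟨y, hy'⟩

lemma abs_boundaryDist_sub_le (Ω : Set Plane) (x y : Plane) :
    |boundaryDist Ω x - boundaryDist Ω y| ≤ dist x y := by
  simpa [Real.dist_eq] using (lipschitzWith_boundaryDist Ω).dist_le_mul x y

/-- The gradient of a local defining function at a boundary point touched by a disc contained in
the domain points along the radius of the disc. -/
lemma gradient_of_interior_ball {z p : Plane} (hp : p ∉ Ω) (hzp : z ≠ p)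
    (hball : ball z (dist z p) ⊆ Ω) {U : Set Plane} {ρ : Plane → ℝ}
    (h : IsLocalDefiningFunction Ω p U ρ) : ∃ c : ℝ, gradient ρ p = c • (p - z) := by
  set n := p - z with hn
  have hn0 : n ≠ 0 := sub_ne_zero.2 hzp.symm
  have hdiff : DifferentiableAt ℝ ρ p :=
    (h.contDiffOn.contDiffAt (h.isOpen.mem_nhds h.mem)).differentiableAt (by norm_num)
  have hg : HasGradientAt ρ (gradient ρ p) p := hdiff.hasGradientAt
  set g := gradient ρ p with hgdef
  have hρp : 0 ≤ ρ p := by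
    by_contra hlt
    have : p ∈ Ω ∩ U := by rw [h.inter_eq]; exact ⟨h.mem, not_le.1 hlt⟩
    exact hp this.1
  have h1 : ∀ u : Plane, ⟪u, n⟫_ℝ < 0 → ⟪g, u⟫_ℝ ≤ 0 := by
    intro u hu
    have hd : HasDerivAt (fun s : ℝ => ρ (p + s • u)) ⟪g, u⟫_ℝ 0 := by
      have h2 : HasDerivAt (fun s : ℝ => p + s • u) u 0 := by
        simpa using ((hasDerivAt_id (0 : ℝ)).smul_const u).const_add p
      have h3 : HasFDerivAt ρ (InnerProductSpace.toDual ℝ Plane g) (p + (0 : ℝ) • u) := by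
        simpa using hg.hasFDerivAt
      exact (h3.comp_hasDerivAt (0 : ℝ) h2).congr_deriv (by simp)
    have hslope := hd.tendsto_slope_zero_right
    refine le_of_tendsto hslope ?_
    have hU : ∀ᶠ s : ℝ in 𝓝[>] 0, p + s • u ∈ U := by
      have : ContinuousAt (fun s : ℝ => p + s • u) 0 := by fun_prop
      exact (this.eventually_mem (by simpa using h.isOpen.mem_nhds h.mem)).filter_mono
        nhdsWithin_le_nhds
    have hsmall : ∀ᶠ s : ℝ in 𝓝[>] 0, 2 * ⟪u, n⟫_ℝ + s * ‖u‖ ^ 2 < 0 := by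
      have : ContinuousAt (fun s : ℝ => 2 * ⟪u, n⟫_ℝ + s * ‖u‖ ^ 2) 0 := by fun_prop
      exact (this.eventually (gt_mem_nhds (by simp; linarith))).filter_mono nhdsWithin_le_nhds
    filter_upwards [hU, hsmall, self_mem_nhdsWithin] with s hsU hs (hs0 : 0 < s)
    have hin : p + s • u ∈ Ω := by
      apply hball
      rw [mem_ball, dist_eq_norm, dist_comm, dist_eq_norm]
      have : p + s • u - z = n + s • u := by rw [hn]; abel
      rw [this, ← hn]
      refine lt_of_pow_lt_pow_left₀ 2 (norm_nonneg _) ?_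
      rw [norm_add_sq_real, norm_smul, inner_smul_right, real_inner_comm, Real.norm_eq_abs,
        mul_pow, sq_abs]
      nlinarith [mul_neg_of_pos_of_neg hs0 hs]
    have hneg : ρ (p + s • u) < 0 := by
      have : p + s • u ∈ Ω ∩ U := ⟨hin, hsU⟩
      rw [h.inter_eq] at this
      exact this.2
    have : ρ (p + (0 + s) • u) - ρ (p + (0 : ℝ) • u) ≤ 0 := by
      simp only [zero_add, zero_smul, add_zero]; linarith
    simpa [smul_eq_mul] using mul_nonpos_of_nonneg_of_nonpos (inv_nonneg.2 hs0.le) this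
  have h2 : ∀ u : Plane, ⟪u, n⟫_ℝ = 0 → ⟪g, u⟫_ℝ ≤ 0 := by
    intro u hu
    have hc : Tendsto (fun s : ℝ => ⟪g, u - s • n⟫_ℝ) (𝓝[>] 0) (𝓝 ⟪g, u⟫_ℝ) := by
      have : ContinuousAt (fun s : ℝ => ⟪g, u - s • n⟫_ℝ) 0 := by fun_prop
      simpa using this.tendsto.mono_left nhdsWithin_le_nhds
    refine le_of_tendsto hc ?_
    filter_upwards [self_mem_nhdsWithin] with s (hs : 0 < s)
    apply h1
    rw [inner_sub_left, hu, inner_smul_left, zero_sub, neg_lt_zero]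
    have : 0 < ⟪n, n⟫_ℝ := real_inner_self_pos.2 hn0
    simpa using mul_pos hs this
  have hnn : ⟪n, n⟫_ℝ ≠ 0 := inner_self_ne_zero.2 hn0
  refine ⟨⟪g, n⟫_ℝ / ⟪n, n⟫_ℝ, ?_⟩
  set u := g - (⟪g, n⟫_ℝ / ⟪n, n⟫_ℝ) • n with hu
  have hun : ⟪u, n⟫_ℝ = 0 := by
    rw [hu, inner_sub_left, real_inner_smul_left, div_mul_cancel₀ _ hnn, sub_self]
  have huu : ⟪u, u⟫_ℝ ≤ 0 := by
    have : ⟪g, u⟫_ℝ = ⟪u, u⟫_ℝ := by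
      have : g = u + (⟪g, n⟫_ℝ / ⟪n, n⟫_ℝ) • n := by rw [hu]; abel
      conv_lhs => rw [this]
      rw [inner_add_left, real_inner_smul_left, real_inner_comm u n, hun]; simp
    rw [← this]; exact h2 u hun
  have : u = 0 := inner_self_eq_zero.1 (le_antisymm huu real_inner_self_nonneg)
  exact sub_eq_zero.1 this

end

section

variable {Ω : Set Plane} {q : Plane → Plane}

/-- The properties of the domain and of the field which make the flow complete: `q` is `C¹` in
`Ω`, continuous up to the boundary and tangent to it, and `M` bounds `q` and its differential. -/
structure IsTangentField (Ω : Set Plane) (q : Plane → Plane) (M : ℝ≥0) : Prop where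
  isOpen : IsOpen Ω
  hasC3Boundary : HasC3Boundary Ω
  contDiffOn : ContDiffOn ℝ 1 q Ω
  continuousOn : ContinuousOn q (closure Ω)
  norm_le : ∀ z ∈ Ω, ‖q z‖ ≤ M
  norm_fderiv_le : ∀ z ∈ Ω, ‖fderiv ℝ q z‖ ≤ M
  tangent : ∀ p ν, IsOuterUnitNormal Ω p ν → ⟪q p, ν⟫_ℝ = 0

namespace IsTangentField

variable {M : ℝ≥0}

lemma norm_image_sub_le (h : IsTangentField Ω q M) {x y : Plane} (hxy : dist x y < boundaryDist Ω x) :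
    ‖q y - q x‖ ≤ M * ‖y - x‖ := by
  have hsub := ball_boundaryDist_subset (Ω := Ω) x
  refine (convex_ball x (boundaryDist Ω x)).norm_image_sub_le_of_norm_fderiv_le (𝕜 := ℝ)
    (fun z hz => (h.contDiffOn.contDiffAt (h.isOpen.mem_nhds (hsub hz))).differentiableAt
      one_ne_zero) (fun z hz => h.norm_fderiv_le z (hsub hz))
    (mem_ball_self (dist_nonneg.trans_lt hxy)) (by rwa [mem_ball, dist_comm])

/-- At distance `r` from the boundary, the component of `q` towards the nearest boundary point is
at most `M r`. -/
lemma abs_inner_le (h : IsTangentField Ω q M) {z p : Plane} (hz : z ∈ Ω) (hp : p ∉ Ω)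
    (hd : dist z p = boundaryDist Ω z) : |⟪p - z, q z⟫_ℝ| ≤ M * boundaryDist Ω z ^ 2 := by
  have hzp : z ≠ p := fun e => hp (e ▸ hz)
  have hball : ball z (dist z p) ⊆ Ω := hd ▸ ball_boundaryDist_subset z
  have hseg : ∀ s ∈ Ico (0 : ℝ) 1, dist z (z + s • (p - z)) < boundaryDist Ω z := by
    intro s hs
    rw [← hd, dist_self_add_right, norm_smul, dist_comm, dist_eq_norm, Real.norm_eq_abs,
      abs_of_nonneg hs.1]
    have : 0 < ‖p - z‖ := norm_pos_iff.2 (sub_ne_zero.2 hzp.symm)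
    nlinarith [hs.2]
  have hlim : Tendsto (fun s : ℝ => z + s • (p - z)) (𝓝[<] 1) (𝓝 p) := by
    have : ContinuousAt (fun s : ℝ => z + s • (p - z)) 1 := by fun_prop
    simpa using this.tendsto.mono_left nhdsWithin_le_nhds
  have hmem : ∀ᶠ s : ℝ in 𝓝[<] 1, s ∈ Ico (0 : ℝ) 1 := Ico_mem_nhdsLT zero_lt_one
  have hlim' : Tendsto (fun s : ℝ => z + s • (p - z)) (𝓝[<] 1) (𝓝[closure Ω] p) :=
    tendsto_nhdsWithin_iff.2 ⟨hlim, hmem.mono fun s hs => subset_closure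
      (ball_boundaryDist_subset z (by rw [mem_ball, dist_comm]; exact hseg s hs))⟩
  have hpcl : p ∈ closure Ω := mem_closure_of_tendsto hlim (hmem.mono fun s hs =>
      (ball_boundaryDist_subset z (by rw [mem_ball, dist_comm]; exact hseg s hs)))
  have hpf : p ∈ frontier Ω := by
    rw [h.isOpen.frontier_eq]; exact ⟨hpcl, hp⟩
  obtain ⟨U, ρ, hρ⟩ := h.hasC3Boundary p hpf
  obtain ⟨c, hc⟩ := gradient_of_interior_ball hp hzp hball hρ
  have hg0 := hρ.gradient_ne_zero p hρ.mem
  have hqp : ⟪q p, p - z⟫_ℝ = 0 := by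
    have := h.tangent p _ ⟨hpf, U, ρ, hρ, rfl⟩
    rw [real_inner_smul_right, hc, real_inner_smul_right] at this
    rcases mul_eq_zero.1 this with h1 | h1
    · exact absurd (norm_eq_zero.1 (inv_eq_zero.1 h1)) (by rw [← hc]; exact hg0)
    · rcases mul_eq_zero.1 h1 with h2 | h2
      · rw [h2, zero_smul] at hc; exact absurd hc hg0
      · exact h2
  have hq : ‖q p - q z‖ ≤ M * ‖p - z‖ := by
    have h1 : Tendsto (fun s : ℝ => ‖q (z + s • (p - z)) - q z‖) (𝓝[<] 1) (𝓝 ‖q p - q z‖) :=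
      (((h.continuousOn p hpcl).tendsto.comp hlim').sub_const _).norm
    refine le_of_tendsto h1 (hmem.mono fun s hs => ?_)
    refine (h.norm_image_sub_le (hseg s hs)).trans ?_
    gcongr
    rw [add_sub_cancel_left, norm_smul, Real.norm_eq_abs, abs_of_nonneg hs.1]
    nlinarith [norm_nonneg (p - z), hs.2]
  have hnorm : ‖p - z‖ = boundaryDist Ω z := by rw [← hd, dist_comm, dist_eq_norm]
  have : ⟪p - z, q z⟫_ℝ = -⟪p - z, q p - q z⟫_ℝ := by
    rw [inner_sub_right, real_inner_comm (q p), hqp]; ring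
  rw [this, abs_neg]
  calc |⟪p - z, q p - q z⟫_ℝ| ≤ ‖p - z‖ * ‖q p - q z‖ := abs_real_inner_le_norm _ _
    _ ≤ ‖p - z‖ * (M * ‖p - z‖) := by gcongr
    _ = M * boundaryDist Ω z ^ 2 := by rw [hnorm]; ring

/-- Along a curve with velocity `c q`, `|c| ≤ 1`, the distance to the boundary grows at most
exponentially. -/
lemma boundaryDist_le_of_nonneg (h : IsTangentField Ω q M) {X : ℝ → Plane} {c : ℝ → ℝ}
    (hX : ∀ t, HasDerivAt X (c t • q (X t)) t) (hc : ∀ t, |c t| ≤ 1) {t : ℝ} (ht : 0 ≤ t) :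
    boundaryDist Ω (X t) ≤ boundaryDist Ω (X 0) * Real.exp (M * t) := by
  have hXc : Continuous X := continuous_iff_continuousAt.2 fun t => (hX t).continuousAt
  have hbc : Continuous fun t => boundaryDist Ω (X t) :=
    (lipschitzWith_boundaryDist Ω).continuous.comp hXc
  -- the square of the distance is compared with the smooth function `‖X - p‖ ^ 2`
  have key : ∀ s, ∀ r, 2 * M * boundaryDist Ω (X s) ^ 2 < r → ∃ᶠ u in 𝓝[>] s,
      (u - s)⁻¹ * (boundaryDist Ω (X u) ^ 2 - boundaryDist Ω (X s) ^ 2) < r := by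
    intro s r hr
    by_cases hne : Ωᶜ.Nonempty
    · obtain ⟨p, hp, hdp, hder⟩ : ∃ p ∈ Ωᶜ, dist (X s) p = boundaryDist Ω (X s) ∧
          2 * ⟪X s - p, c s • q (X s)⟫_ℝ ≤ 2 * M * boundaryDist Ω (X s) ^ 2 := by
        by_cases hs : X s ∈ Ω
        · obtain ⟨p, hp, hdp⟩ := h.isOpen.isClosed_compl.exists_infDist_eq_dist hne (X s)
          have hdp' : dist (X s) p = boundaryDist Ω (X s) := by
            rw [boundaryDist, if_pos hne, hdp]
          refine ⟨p, hp, hdp', ?_⟩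
          have h1 := h.abs_inner_le hs hp hdp'
          rw [real_inner_smul_right, ← neg_sub, inner_neg_left]
          have h2 : |c s * -⟪p - X s, q (X s)⟫_ℝ| ≤ 1 * (M * boundaryDist Ω (X s) ^ 2) := by
            rw [abs_mul, abs_neg]
            exact mul_le_mul (hc s) h1 (abs_nonneg _) zero_le_one
          nlinarith [le_abs_self (c s * -⟪p - X s, q (X s)⟫_ℝ)]
        · refine ⟨X s, hs, by rw [dist_self, boundaryDist_eq_zero hs], ?_⟩
          rw [sub_self, inner_zero_left, mul_zero]
          positivity
      have hd : HasDerivAt (fun u => ‖X u - p‖ ^ 2) (2 * ⟪X s - p, c s • q (X s)⟫_ℝ) s :=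
        ((hX s).sub_const p).norm_sq
      have hev := hd.hasDerivWithinAt.limsup_slope_le' (s := Ioi s) (by simp)
        (hder.trans_lt hr)
      refine Eventually.frequently ?_
      filter_upwards [hev, self_mem_nhdsWithin] with u hu (hus : s < u)
      refine lt_of_le_of_lt ?_ hu
      rw [slope_def_field, div_eq_inv_mul]
      have h2 : boundaryDist Ω (X u) ≤ ‖X u - p‖ := by
        rw [← dist_eq_norm, boundaryDist, if_pos hne]
        exact infDist_le_dist_of_mem hp
      have h3 : boundaryDist Ω (X s) = ‖X s - p‖ := by rw [← hdp, dist_eq_norm]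
      have h4 := boundaryDist_nonneg Ω (X u)
      have h5 : 0 ≤ (u - s)⁻¹ := inv_nonneg.2 (sub_nonneg.2 hus.le)
      rw [h3]
      gcongr
    · refine Eventually.frequently (Eventually.of_forall fun u => ?_)
      simp only [boundaryDist, if_neg hne] at hr ⊢
      have : (0 : ℝ) ≤ M := M.2
      simp at hr ⊢
      linarith
  have := le_gronwallBound_of_liminf_deriv_right_le (f := fun t => boundaryDist Ω (X t) ^ 2)
    (f' := fun s => 2 * M * boundaryDist Ω (X s) ^ 2) (δ := boundaryDist Ω (X 0) ^ 2)
    (K := 2 * M) (ε := 0) (a := 0) (b := t) (hbc.pow 2).continuousOn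
    (fun s _ r hr => key s r hr) le_rfl (fun s _ => by simp) t ⟨ht, le_rfl⟩
  rw [gronwallBound_ε0] at this
  refine (pow_le_pow_iff_left₀ (boundaryDist_nonneg _ _)
    (mul_nonneg (boundaryDist_nonneg _ _) (Real.exp_nonneg _)) two_ne_zero).1 (this.trans_eq ?_)
  rw [mul_pow, ← Real.exp_nat_mul]
  congr 2
  push_cast
  ring

/-- The curves of velocity `c q`, `|c| ≤ 1`, do not reach the boundary in finite time. -/
lemma boundaryDist_ge (h : IsTangentField Ω q M) {X : ℝ → Plane} {c : ℝ → ℝ}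
    (hX : ∀ t, HasDerivAt X (c t • q (X t)) t) (hc : ∀ t, |c t| ≤ 1) (t : ℝ) :
    boundaryDist Ω (X 0) * Real.exp (-(M * |t|)) ≤ boundaryDist Ω (X t) := by
  have : boundaryDist Ω (X 0) ≤ boundaryDist Ω (X t) * Real.exp (M * |t|) := by
    rcases le_total 0 t with ht | ht
    · have := h.boundaryDist_le_of_nonneg (X := fun s => X (t - s)) (c := fun s => -c (t - s))
        (fun s => ((hX (t - s)).scomp s ((hasDerivAt_id s).const_sub t)).congr_deriv
          (by simp)) (fun s => by simpa using hc _) ht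
      simpa [abs_of_nonneg ht] using this
    · have := h.boundaryDist_le_of_nonneg (X := fun s => X (t + s)) (c := fun s => c (t + s))
        (fun s => ((hX (t + s)).scomp s ((hasDerivAt_id s).const_add t)).congr_deriv
          (by simp)) (fun s => hc _) (t := -t) (by linarith)
      simpa [abs_of_nonpos ht] using this
  rw [Real.exp_neg, ← div_eq_mul_inv, div_le_iff₀ (Real.exp_pos _)]
  exact this

/-- The field `q` multiplied by a factor that is `1` at distance at least `κ` from the boundary and
decreases linearly to `0` at the boundary. Unlike `q` extended by zero, it is Lipschitz in the whole
plane. -/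
noncomputable def truncate (Ω : Set Plane) (q : Plane → Plane) (κ : ℝ) (z : Plane) : Plane :=
  min 1 (boundaryDist Ω z / κ) • q z

lemma truncate_eq {κ : ℝ} (hκ : 0 < κ) {z : Plane} (hz : κ ≤ boundaryDist Ω z) :
    truncate Ω q κ z = q z := by
  rw [truncate, min_eq_left ((one_le_div hκ).2 hz), one_smul]

lemma norm_truncate_le (h : IsTangentField Ω q M) {κ : ℝ} (hκ : 0 < κ) (z : Plane) :
    ‖truncate Ω q κ z‖ ≤ M * min 1 (boundaryDist Ω z / κ) := by
  have h0 : 0 ≤ min 1 (boundaryDist Ω z / κ) :=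
    le_min zero_le_one (div_nonneg (boundaryDist_nonneg _ _) hκ.le)
  rw [truncate, norm_smul, Real.norm_eq_abs, abs_of_nonneg h0, mul_comm]
  by_cases hz : z ∈ Ω
  · gcongr
    exact h.norm_le z hz
  · simp [boundaryDist_eq_zero hz]

lemma lipschitzWith_truncate (h : IsTangentField Ω q M) {κ : ℝ≥0} (hκ : 0 < κ) :
    LipschitzWith (M + 2 * M / κ) (truncate Ω q κ) := by
  have hκ' : (0 : ℝ) < κ := hκ
  refine LipschitzWith.of_dist_le_mul fun x y => ?_
  push_cast
  have key : ∀ x y : Plane, dist x y < boundaryDist Ω x →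
      dist (truncate Ω q κ x) (truncate Ω q κ y) ≤ (M + 2 * M / κ) * dist x y := by
    intro x y hxy
    have hx : x ∈ Ω := mem_of_boundaryDist_pos (dist_nonneg.trans_lt hxy)
    have e : truncate Ω q κ x - truncate Ω q κ y =
        (min 1 (boundaryDist Ω x / κ) - min 1 (boundaryDist Ω y / κ)) • q x -
          min 1 (boundaryDist Ω y / κ) • (q y - q x) := by
      simp only [truncate, sub_smul, smul_sub]; abel
    have h1 : |min 1 (boundaryDist Ω x / κ) - min 1 (boundaryDist Ω y / κ)| ≤ dist x y / κ := by
      refine (abs_min_sub_min_le_max _ _ _ _).trans ?_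
      rw [sub_self, abs_zero, max_eq_right (abs_nonneg _), ← sub_div, abs_div, abs_of_pos hκ']
      gcongr
      exact abs_boundaryDist_sub_le Ω x y
    have h2 : |min 1 (boundaryDist Ω y / κ)| ≤ 1 := by
      rw [abs_of_nonneg (le_min zero_le_one (div_nonneg (boundaryDist_nonneg _ _) hκ'.le))]
      exact min_le_left _ _
    have h3 : ‖q y - q x‖ ≤ M * dist x y := by
      rw [dist_comm, dist_eq_norm y x]
      exact h.norm_image_sub_le hxy
    have h4 := h.norm_le x hx
    rw [dist_eq_norm, e]
    refine (norm_sub_le _ _).trans ?_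
    rw [norm_smul, norm_smul, Real.norm_eq_abs, Real.norm_eq_abs]
    calc _ ≤ dist x y / κ * M + 1 * (M * dist x y) :=
          add_le_add (mul_le_mul h1 h4 (norm_nonneg _) (by positivity))
            (mul_le_mul h2 h3 (norm_nonneg _) zero_le_one)
      _ ≤ (M + 2 * M / κ) * dist x y := by
          have : 0 ≤ M / κ * dist x y := by positivity
          calc _ = M * dist x y + M / κ * dist x y := by ring
            _ ≤ M * dist x y + M / κ * dist x y + M / κ * dist x y := by linarith
            _ = _ := by ring
  by_cases hx : dist x y < boundaryDist Ω x
  · exact key x y hx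
  by_cases hy : dist x y < boundaryDist Ω y
  · rw [dist_comm, dist_comm x]
    exact key y x (by rwa [dist_comm])
  -- both points are within `dist x y` of the boundary, where the truncated field is small
  have hb : ∀ z, ¬ dist x y < boundaryDist Ω z → ‖truncate Ω q κ z‖ ≤ M / κ * dist x y := by
    intro z hz
    refine (h.norm_truncate_le hκ' z).trans ?_
    calc M * min 1 (boundaryDist Ω z / κ) ≤ M * (dist x y / κ) := by
          gcongr
          exact (min_le_right _ _).trans (by gcongr; exact not_lt.1 hz)
      _ = _ := by ring
  rw [dist_eq_norm]
  refine (norm_sub_le _ _).trans ((add_le_add (hb x hx) (hb y hy)).trans ?_)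
  have : 0 ≤ M * dist x y := by positivity
  calc _ ≤ M / κ * dist x y + M / κ * dist x y + M * dist x y := by linarith
    _ = _ := by ring

lemma truncate_smul (κ : ℝ) (hκ : 0 < κ) (z : Plane) :
    ∃ c : ℝ, truncate Ω q κ z = c • q z ∧ |c| ≤ 1 := by
  refine ⟨min 1 (boundaryDist Ω z / κ), rfl, ?_⟩
  rw [abs_of_nonneg (le_min zero_le_one (div_nonneg (boundaryDist_nonneg _ _) hκ.le))]
  exact min_le_left _ _

/-- A solution in `Ω` is, for a bounded time, a solution for a truncated field. -/
lemma eqOn_truncate (h : IsTangentField Ω q M) {κ : ℝ≥0} (hκ : 0 < κ) {X Y : ℝ → Plane}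
    (hX : ∀ t, HasDerivAt X (q (X t)) t)
    (hY : ∀ t, HasDerivAt Y (truncate Ω q κ (Y t)) t) (h0 : X 0 = Y 0) {T : ℝ} (hT : 0 < T)
    (hκT : κ ≤ boundaryDist Ω (X 0) * Real.exp (-(M * T))) : EqOn X Y (Icc (-T) T) := by
  have hb : ∀ t ∈ Ioo (-T) T, κ ≤ boundaryDist Ω (X t) := by
    intro t ht
    refine hκT.trans ((mul_le_mul_of_nonneg_left ?_ (boundaryDist_nonneg _ _)).trans
      (h.boundaryDist_ge (c := fun _ => 1) (fun t => by simpa using hX t) (by simp) t))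
    rw [Real.exp_le_exp, neg_le_neg_iff]
    gcongr
    exact (abs_lt.2 ht).le
  refine ODE_solution_unique_of_mem_Icc (v := fun _ => truncate Ω q κ) (s := fun _ => univ)
    (t₀ := 0) (fun _ _ => (h.lipschitzWith_truncate hκ).lipschitzOnWith) ⟨by linarith, hT⟩
    (fun t _ => (hX t).continuousAt.continuousWithinAt)
    (fun t ht => (hX t).congr_deriv (truncate_eq hκ (hb t ht)).symm) (fun _ _ => trivial)
    (fun t _ => (hY t).continuousAt.continuousWithinAt) (fun t _ => hY t)
    (fun _ _ => trivial) h0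

end IsTangentField

end

/-! ### The flow of a tangent field -/

section

variable {Ω : Set Plane} {q : Plane → Plane} {M : ℝ≥0}

/-- `φ` is the complete flow of the field `q` in `Ω`, extended by the identity outside `Ω`;
`M` bounds `q`. The last two fields record that the flow approaches the boundary at most
exponentially fast, and that it is Lipschitz at a positive distance from the boundary, uniformly
for bounded times. -/
structure IsFlow (Ω : Set Plane) (q : Plane → Plane) (M : ℝ≥0) (φ : ℝ → Plane → Plane) :
    Prop where
  isOpen : IsOpen Ω
  contDiffOn : ContDiffOn ℝ 1 q Ω
  norm_le : ∀ z ∈ Ω, ‖q z‖ ≤ M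
  mem : ∀ {z}, z ∈ Ω → ∀ t, φ t z ∈ Ω
  eq_self : ∀ {z}, z ∉ Ω → ∀ t, φ t z = z
  zero : ∀ z, φ 0 z = z
  hasDerivAt : ∀ {z}, z ∈ Ω → ∀ t, HasDerivAt (fun t => φ t z) (q (φ t z)) t
  unique : ∀ X : ℝ → Plane, (∀ t, HasDerivAt X (q (X t)) t) → (∀ t, X t ∈ Ω) →
    ∀ t, X t = φ t (X 0)
  boundaryDist_ge : ∀ {z}, z ∈ Ω → ∀ t,
    boundaryDist Ω z * Real.exp (-(M * |t|)) ≤ boundaryDist Ω (φ t z)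
  lipschitzOn : ∀ δ T : ℝ, 0 < δ → ∃ K : ℝ≥0, ∀ t, |t| ≤ T →
    LipschitzOnWith K (φ t) {z | δ ≤ boundaryDist Ω z}

namespace IsTangentField

lemma exists_solution (h : IsTangentField Ω q M) {z : Plane} (hz : z ∈ Ω) :
    ∃ X : ℝ → Plane, X 0 = z ∧ (∀ t, HasDerivAt X (q (X t)) t) ∧ ∀ t, X t ∈ Ω := by
  have hb := boundaryDist_pos h.isOpen hz
  let κ : ℕ → ℝ≥0 := fun n =>
    ⟨boundaryDist Ω z * Real.exp (-(M * (n + 1))), by positivity⟩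
  have hκ : ∀ n, 0 < κ n := fun n => mul_pos hb (Real.exp_pos _)
  have hκmono : ∀ m n : ℕ, m ≤ n → κ n ≤ κ m := by
    intro m n hmn
    refine mul_le_mul_of_nonneg_left (Real.exp_le_exp.2 (neg_le_neg ?_)) hb.le
    have : (m : ℝ) ≤ n := by exact_mod_cast hmn
    gcongr
  have hbd : ∀ n x, ‖truncate Ω q (κ n) x‖ ≤ M := fun n x =>
    (h.norm_truncate_le (hκ n) x).trans (mul_le_of_le_one_right M.2 (min_le_left _ _))
  choose X hX0 hX using fun n =>
    exists_global_solution (h.lipschitzWith_truncate (hκ n)) (hbd n) z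
  have hXb : ∀ n : ℕ, ∀ t ∈ Ioo (-(n + 1 : ℝ)) (n + 1), κ n ≤ boundaryDist Ω (X n t) := by
    intro n t ht
    choose c hc hc1 using fun t => truncate_smul (Ω := Ω) (q := q) (κ n) (hκ n) (X n t)
    have := h.boundaryDist_ge (X := X n) (c := c) (fun t => hc t ▸ hX n t) hc1 t
    rw [hX0] at this
    refine le_trans ?_ this
    refine mul_le_mul_of_nonneg_left (Real.exp_le_exp.2 (neg_le_neg ?_)) hb.le
    gcongr
    exact (abs_lt.2 ht).le
  have heq : ∀ m n : ℕ, m ≤ n → EqOn (X n) (X m) (Ioo (-(m + 1 : ℝ)) (m + 1)) := by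
    intro m n hmn
    refine ODE_solution_unique_of_mem_Ioo (v := fun _ => truncate Ω q (κ n)) (s := fun _ => univ)
      (t₀ := 0) (fun _ _ => (h.lipschitzWith_truncate (hκ n)).lipschitzOnWith)
      ⟨by linarith [m.cast_nonneg (α := ℝ)], by positivity⟩ (fun t _ => ⟨hX n t, trivial⟩)
      (fun t ht => ⟨?_, trivial⟩) (by rw [hX0, hX0])
    refine (hX m t).congr_deriv ?_
    have := hXb m t ht
    exact (truncate_eq (hκ m) this).trans
      (truncate_eq (hκ n) (le_trans (hκmono m n hmn) this)).symm
  obtain ⟨Y, hY, hYX⟩ := exists_glued_solution (F := q)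
    (fun n t ht => (hX n t).congr_deriv (truncate_eq (hκ n) (hXb n t ht))) heq
  refine ⟨Y, ?_, hY, fun t => ?_⟩
  · obtain ⟨n, -, hn⟩ := hYX 0
    rw [hn, hX0]
  · obtain ⟨n, hn, hn'⟩ := hYX t
    rw [hn']
    exact mem_of_boundaryDist_pos (lt_of_lt_of_le (hκ n) (hXb n t hn))

lemma solution_dist_le (h : IsTangentField Ω q M) {δ T : ℝ} (hδ : 0 < δ) :
    ∃ K : ℝ≥0, ∀ X Y : ℝ → Plane, (∀ t, HasDerivAt X (q (X t)) t) →
      (∀ t, HasDerivAt Y (q (Y t)) t) → δ ≤ boundaryDist Ω (X 0) → δ ≤ boundaryDist Ω (Y 0) →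
      ∀ t, |t| ≤ T → dist (X t) (Y t) ≤ K * dist (X 0) (Y 0) := by
  rcases lt_or_ge T 0 with hT | hT
  · exact ⟨0, fun X Y _ _ _ _ t ht => absurd ((abs_nonneg t).trans ht) (not_le.2 hT)⟩
  let κ : ℝ≥0 := ⟨δ * Real.exp (-(M * (T + 1))), by positivity⟩
  have hκ : 0 < κ := mul_pos hδ (Real.exp_pos _)
  have hL := h.lipschitzWith_truncate hκ
  have hbd : ∀ x, ‖truncate Ω q κ x‖ ≤ M := fun x =>
    (h.norm_truncate_le hκ x).trans (mul_le_of_le_one_right M.2 (min_le_left _ _))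
  refine ⟨⟨Real.exp ((M + 2 * M / κ : ℝ≥0) * T), (Real.exp_pos _).le⟩,
    fun X Y hX hY hXδ hYδ t ht => ?_⟩
  obtain ⟨X', hX'0, hX'⟩ := exists_global_solution hL hbd (X 0)
  obtain ⟨Y', hY'0, hY'⟩ := exists_global_solution hL hbd (Y 0)
  have hκX : ∀ x, δ ≤ boundaryDist Ω x →
      (κ : ℝ) ≤ boundaryDist Ω x * Real.exp (-(M * (T + 1))) := fun x hx =>
    mul_le_mul_of_nonneg_right hx (Real.exp_pos _).le
  have ht' : t ∈ Icc (-(T + 1)) (T + 1) := abs_le.1 (by linarith)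
  rw [h.eqOn_truncate hκ hX hX' hX'0.symm (by linarith) (hκX _ hXδ) ht',
    h.eqOn_truncate hκ hY hY' hY'0.symm (by linarith) (hκX _ hYδ) ht']
  refine (dist_solution_le hL hX' hY' t).trans ?_
  rw [hX'0, hY'0, mul_comm]
  refine mul_le_mul_of_nonneg_right ?_ dist_nonneg
  refine Real.exp_le_exp.2 (mul_le_mul_of_nonneg_left ht (NNReal.coe_nonneg _))

lemma solution_unique (h : IsTangentField Ω q M) {X Y : ℝ → Plane}
    (hX : ∀ t, HasDerivAt X (q (X t)) t) (hY : ∀ t, HasDerivAt Y (q (Y t)) t) (h0 : X 0 = Y 0)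
    (h0' : X 0 ∈ Ω) (t : ℝ) : X t = Y t := by
  obtain ⟨K, hK⟩ := h.solution_dist_le (T := |t|) (boundaryDist_pos h.isOpen h0')
  have := hK X Y hX hY le_rfl (by rw [h0]) t le_rfl
  rw [h0, dist_self, mul_zero] at this
  exact dist_le_zero.1 this

/-- The solutions of `X' = q(X)` in `Ω` exist for all times and form a flow. -/
theorem exists_isFlow (h : IsTangentField Ω q M) : ∃ φ, IsFlow Ω q M φ := by
  classical
  choose! X hX0 hX hXΩ using fun z (hz : z ∈ Ω) => h.exists_solution hz
  have hφ : ∀ {z}, z ∈ Ω → ∀ t, (if z ∈ Ω then X z t else z) = X z t := fun hz t => if_pos hz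
  refine ⟨fun t z => if z ∈ Ω then X z t else z, h.isOpen, h.contDiffOn, h.norm_le, ?_, ?_, ?_,
    ?_, ?_, ?_, ?_⟩
  · intro z hz t
    simpa only [hφ hz] using hXΩ z hz t
  · intro z hz t
    simp only [if_neg hz]
  · intro z
    by_cases hz : z ∈ Ω
    · simpa only [hφ hz] using hX0 z hz
    · simp only [if_neg hz]
  · intro z hz t
    simpa only [hφ hz] using hX z hz t
  · intro Y hY hYΩ t
    simp only [hφ (hYΩ 0)]
    exact h.solution_unique hY (hX _ (hYΩ 0)) (hX0 _ (hYΩ 0)).symm (hYΩ 0) t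
  · intro z hz t
    have := h.boundaryDist_ge (X := X z) (c := fun _ => 1)
      (fun t => (hX z hz t).congr_deriv (one_smul _ _).symm) (fun _ => by rw [abs_one]) t
    rw [hX0 z hz] at this
    simpa only [hφ hz] using this
  · intro δ T hδ
    obtain ⟨K, hK⟩ := h.solution_dist_le (T := T) hδ
    refine ⟨K, fun t ht => LipschitzOnWith.of_dist_le_mul fun x hx y hy => ?_⟩
    have hxΩ : x ∈ Ω := mem_of_boundaryDist_pos (hδ.trans_le hx)
    have hyΩ : y ∈ Ω := mem_of_boundaryDist_pos (hδ.trans_le hy)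
    simp only [hφ hxΩ, hφ hyΩ]
    have := hK (X x) (X y) (hX x hxΩ) (hX y hyΩ) (by rw [hX0 x hxΩ]; exact hx)
      (by rw [hX0 y hyΩ]; exact hy) t ht
    rwa [hX0 x hxΩ, hX0 y hyΩ] at this

end IsTangentField

namespace IsFlow

variable {φ : ℝ → Plane → Plane}

lemma add (h : IsFlow Ω q M φ) (s t : ℝ) (z : Plane) : φ (s + t) z = φ s (φ t z) := by
  by_cases hz : z ∈ Ω
  · have := h.unique (fun s => φ (s + t) z) (fun s =>
      (h.hasDerivAt hz (s + t)).comp_add_const s t)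
      (fun s => h.mem hz _) s
    simpa using this
  · simp only [h.eq_self hz]

lemma neg_apply (h : IsFlow Ω q M φ) (t : ℝ) (z : Plane) : φ (-t) (φ t z) = z := by
  rw [← h.add, neg_add_cancel, h.zero]

lemma apply_neg (h : IsFlow Ω q M φ) (t : ℝ) (z : Plane) : φ t (φ (-t) z) = z := by
  rw [← h.add, add_neg_cancel, h.zero]

lemma mem_iff (h : IsFlow Ω q M φ) (t : ℝ) (z : Plane) : φ t z ∈ Ω ↔ z ∈ Ω := by
  refine ⟨fun hz => ?_, fun hz => h.mem hz t⟩
  by_contra hz'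
  rw [h.eq_self hz'] at hz
  exact hz' hz

lemma dist_le (h : IsFlow Ω q M φ) (s t : ℝ) (z : Plane) :
    dist (φ s z) (φ t z) ≤ M * |s - t| := by
  by_cases hz : z ∈ Ω
  · have := (convex_univ (𝕜 := ℝ) (E := ℝ)).norm_image_sub_le_of_norm_hasDerivWithin_le
      (f := fun t => φ t z) (C := M) (x := t) (y := s)
      (fun u _ => (h.hasDerivAt hz u).hasDerivWithinAt)
      (fun u _ => h.norm_le _ (h.mem hz u)) trivial trivial
    simpa [dist_eq_norm] using this
  · simp only [h.eq_self hz, dist_self]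
    positivity

lemma norm_sub_le (h : IsFlow Ω q M φ) (t : ℝ) (z : Plane) : ‖φ t z - z‖ ≤ M * |t| := by
  simpa [h.zero, dist_eq_norm] using h.dist_le t 0 z

lemma continuousAt (h : IsFlow Ω q M φ) (t : ℝ) {z : Plane} (hz : z ∈ Ω) :
    ContinuousAt (φ t) z := by
  have hb := boundaryDist_pos h.isOpen hz
  obtain ⟨K, hK⟩ := h.lipschitzOn (boundaryDist Ω z / 2) |t| (half_pos hb)
  refine (hK t le_rfl).continuousOn.continuousAt ?_
  have : ∀ᶠ y in 𝓝 z, boundaryDist Ω z / 2 < boundaryDist Ω y :=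
    (lipschitzWith_boundaryDist Ω).continuous.continuousAt.eventually (lt_mem_nhds (half_lt_self hb))
  exact this.mono fun y hy => le_of_lt hy

lemma continuousAt_uncurry (h : IsFlow Ω q M φ) (t : ℝ) {z : Plane} (hz : z ∈ Ω) :
    ContinuousAt (fun p : ℝ × Plane => φ p.1 p.2) (t, z) := by
  have h1 : Tendsto (fun p : ℝ × Plane => φ t p.2) (𝓝 (t, z)) (𝓝 (φ t z)) :=
    (h.continuousAt t hz).tendsto.comp continuous_snd.continuousAt
  have h2 : Tendsto (fun p : ℝ × Plane => M * |p.1 - t|) (𝓝 (t, z)) (𝓝 0) := by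
    have : Continuous fun p : ℝ × Plane => M * |p.1 - t| := by fun_prop
    simpa using this.tendsto (t, z)
  refine h1.congr_dist ?_
  exact squeeze_zero (fun _ => dist_nonneg) (fun p => by
    rw [dist_comm]; exact h.dist_le p.1 t p.2) h2

lemma measurable (h : IsFlow Ω q M φ) (t : ℝ) : Measurable (φ t) := by
  refine measurable_of_restrict_of_restrict_compl h.isOpen.measurableSet ?_ ?_
  · exact (continuousOn_iff_continuous_domRestrict.1
      fun z hz => (h.continuousAt t hz).continuousWithinAt).measurable
  · have : Ωᶜ.domRestrict (φ t) = Subtype.val := by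
      ext1 z; exact h.eq_self z.2 t
    rw [this]
    exact measurable_subtype_coe

/-- The flow commutes with the translations that preserve the domain and the field. -/
lemma apply_add (h : IsFlow Ω q M φ) {k : Plane} (hΩ : ∀ z, z + k ∈ Ω ↔ z ∈ Ω)
    (hq : ∀ z ∈ Ω, q (z + k) = q z) (t : ℝ) (z : Plane) : φ t (z + k) = φ t z + k := by
  by_cases hz : z ∈ Ω
  · have := h.unique (fun s => φ s z + k) (fun s => by
      rw [hq _ (h.mem hz s)]; exact (h.hasDerivAt hz s).add_const k)
      (fun s => (hΩ _).2 (h.mem hz s)) t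
    rw [this, h.zero]
  · rw [h.eq_self hz, h.eq_self (by rwa [hΩ])]

lemma apply_of_eq_zero (h : IsFlow Ω q M φ) {z : Plane} (hz : z ∈ Ω) (hq : q z = 0) (t : ℝ) :
    φ t z = z := by
  have := h.unique (fun _ => z) (fun s => by rw [hq]; exact hasDerivAt_const s z) (fun _ => hz) t
  exact this.symm

end IsFlow

end

section

open scoped Convolution

/-! ### Mollification -/

/-- A sequence of bump functions shrinking to the origin, with a bounded ratio of radii. -/
noncomputable def mollifier (n : ℕ) : ContDiffBump (0 : Plane) where
  rIn := 1 / (2 * (n + 1))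
  rOut := 1 / (n + 1)
  rIn_pos := by positivity
  rIn_lt_rOut := by
    apply one_div_lt_one_div_of_lt (by positivity)
    linarith [n.cast_nonneg (α := ℝ)]

/-- The `n`-th mollification of a function. -/
noncomputable def mollify {F : Type*} [NormedAddCommGroup F] [NormedSpace ℝ F] (n : ℕ)
    (g : Plane → F) : Plane → F :=
  (mollifier n).normed volume ⋆[ContinuousLinearMap.lsmul ℝ ℝ, volume] g

lemma tendsto_mollifier_rOut : Tendsto (fun n => (mollifier n).rOut) atTop (𝓝 0) :=
  tendsto_one_div_add_atTop_nhds_zero_nat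

section mollify

variable {F : Type*} [NormedAddCommGroup F] [NormedSpace ℝ F]

lemma mollify_apply (n : ℕ) (g : Plane → F) (x : Plane) :
    mollify n g x = ∫ t, (mollifier n).normed volume t • g (x - t) := rfl

lemma ae_tendsto_mollify [CompleteSpace F] {g : Plane → F} (hg : LocallyIntegrable g) :
    ∀ᵐ x, Tendsto (fun n => mollify n g x) atTop (𝓝 (g x)) :=
  ContDiffBump.ae_convolution_tendsto_right_of_locallyIntegrable (K := 2) tendsto_mollifier_rOut
    (Eventually.of_forall fun n => by
      simp only [mollifier]
      have : (0 : ℝ) < n + 1 := by positivity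
      apply le_of_eq
      field_simp) hg

lemma tendsto_mollify [CompleteSpace F] {g : Plane → F} (hg : Continuous g) (x : Plane) :
    Tendsto (fun n => mollify n g x) atTop (𝓝 (g x)) :=
  ContDiffBump.convolution_tendsto_right_of_continuous tendsto_mollifier_rOut hg x

lemma norm_mollify_le {g : Plane → F} {C : ℝ} (hC : ∀ x, ‖g x‖ ≤ C) (n : ℕ) (x : Plane) :
    ‖mollify n g x‖ ≤ C := by
  rw [mollify_apply]
  calc _ ≤ ∫ t, (mollifier n).normed volume t * C := by
        refine norm_integral_le_of_norm_le ((mollifier n).integrable_normed.mul_const C)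
          (Eventually.of_forall fun t => ?_)
        rw [norm_smul, Real.norm_eq_abs, abs_of_nonneg ((mollifier n).nonneg_normed t)]
        exact mul_le_mul_of_nonneg_left (hC _) ((mollifier n).nonneg_normed t)
    _ = C := by rw [integral_mul_const, (mollifier n).integral_normed, one_mul]

lemma contDiff_mollify [CompleteSpace F] {g : Plane → F} (hg : LocallyIntegrable g) (n : ℕ) :
    ContDiff ℝ ∞ (mollify n g) :=
  (mollifier n).hasCompactSupport_normed.contDiff_convolution_left _
    (mollifier n).contDiff_normed hg

lemma support_mollify_subset (n : ℕ) (g : Plane → F) :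
    Function.support (mollify n g) ⊆ cthickening (mollifier n).rOut (tsupport g) := by
  refine (support_convolution_subset _).trans ?_
  rintro _ ⟨a, ha, b, hb, rfl⟩
  rw [ContDiffBump.support_normed_eq, mem_ball_zero_iff] at ha
  refine mem_cthickening_of_dist_le _ b _ _ (subset_tsupport _ hb) ?_
  simpa [dist_eq_norm] using ha.le

lemma tsupport_mollify_subset (n : ℕ) (g : Plane → F) :
    tsupport (mollify n g) ⊆ cthickening (mollifier n).rOut (tsupport g) :=
  closure_minimal (support_mollify_subset n g) isClosed_cthickening

end mollify

/-- For a Lipschitz function, mollification commutes with differentiation. -/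
lemma fderiv_mollify {θ : Plane → ℝ} {C : ℝ≥0} (hθ : LipschitzWith C θ) (n : ℕ) (x v : Plane) :
    fderiv ℝ (mollify n θ) x v = mollify n (fun y => lineDeriv ℝ θ y v) x := by
  have hdiff : DifferentiableAt ℝ (mollify n θ) x :=
    (contDiff_mollify hθ.continuous.locallyIntegrable n).differentiable (by norm_num) x
  rw [← hdiff.lineDeriv_eq_fderiv]
  have hη := (mollifier n).continuous_normed (μ := volume)
  have hint := (mollifier n).integrable_normed (μ := volume)
  have key := hasDerivAt_integral_of_dominated_loc_of_lip (𝕜 := ℝ) (μ := (volume : Measure Plane))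
    (x₀ := 0) (s := univ)
    (F := fun s t => (mollifier n).normed volume t • θ (x + s • v - t))
    (F' := fun t => (mollifier n).normed volume t • lineDeriv ℝ θ (x - t) v)
    (bound := fun t => (mollifier n).normed volume t * (C * ‖v‖)) univ_mem
    (Eventually.of_forall fun s => by
      have := hθ.continuous
      fun_prop)
    (Continuous.integrable_of_hasCompactSupport (by have := hθ.continuous; fun_prop)
      ((mollifier n).hasCompactSupport_normed.smul_right))
    (hη.aestronglyMeasurable.smul
      ((measurable_lineDeriv hθ.continuous).comp (by fun_prop)).aestronglyMeasurable)
    (Eventually.of_forall fun t => by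
      refine LipschitzOnWith.of_dist_le_mul fun a _ b _ => ?_
      have h0 := (mollifier n).nonneg_normed (μ := volume) t
      rw [Real.coe_nnabs, abs_of_nonneg (by positivity), dist_smul₀, Real.norm_eq_abs,
        abs_of_nonneg h0, mul_assoc]
      refine mul_le_mul_of_nonneg_left ((hθ.dist_le_mul _ _).trans_eq ?_) h0
      rw [dist_sub_right, dist_add_left, dist_eq_norm, ← sub_smul, norm_smul, Real.dist_eq,
        Real.norm_eq_abs]
      ring) (hint.mul_const _) ?_
  · have h2 := key.2
    exact h2.deriv
  · have h1 : ∀ᵐ y, LineDifferentiableAt ℝ θ y v := hθ.ae_lineDifferentiableAt v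
    have h2 : ∀ᵐ t, LineDifferentiableAt ℝ θ (x - t) v :=
      (Measure.measurePreserving_sub_left volume x).quasiMeasurePreserving.ae h1
    filter_upwards [h2] with t ht
    have : HasDerivAt (fun s : ℝ => θ (x - t + s • v)) (lineDeriv ℝ θ (x - t) v) 0 :=
      ht.hasLineDerivAt
    refine (this.const_smul ((mollifier n).normed volume t)).congr_of_eventuallyEq
      (Eventually.of_forall fun s => ?_)
    simp only [Pi.smul_apply]
    congr 2
    abel

/-! ### Weak gradients and Lipschitz test functions -/

variable {Ω : Set Plane} {q : Plane → Plane} {M : ℝ≥0}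

lemma norm_lineDeriv_le {θ : Plane → ℝ} {C : ℝ≥0} (hθ : LipschitzWith C θ) (x v : Plane) :
    ‖lineDeriv ℝ θ x v‖ ≤ C * ‖v‖ := norm_lineDeriv_le_of_lipschitz ℝ hθ

lemma norm_stdVec (i : Fin 2) : ‖stdVec i‖ = 1 := by
  simp [stdVec]

lemma lineDeriv_eq_zero {θ : Plane → ℝ} {x v : Plane} (hx : x ∉ tsupport θ) :
    lineDeriv ℝ θ x v = 0 := by
  have : θ =ᶠ[𝓝 x] fun _ => 0 := notMem_tsupport_iff_eventuallyEq.1 hx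
  rw [this.lineDeriv_eq]
  simp [lineDeriv]

/-- The definition of the weak gradient extends to Lipschitz test functions. -/
lemma integral_lineDeriv_of_hasWeakGradient {w : Plane → ℝ} {G : Plane → Plane} (hΩ : IsOpen Ω)
    (hwG : HasWeakGradient Ω w G) (hw : ∀ K, IsCompact K → IntegrableOn w (Ω ∩ K))
    (hG : ∀ K, IsCompact K → IntegrableOn G (Ω ∩ K)) {θ : Plane → ℝ} {C : ℝ≥0}
    (hθ : LipschitzWith C θ) (hc : HasCompactSupport θ) (hs : tsupport θ ⊆ Ω) (i : Fin 2) :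
    ∫ z in Ω, w z * lineDeriv ℝ θ z (stdVec i) = -∫ z in Ω, G z i * θ z := by
  obtain ⟨δ, hδ, hδΩ⟩ := hc.exists_cthickening_subset_open hΩ hs
  set K := cthickening δ (tsupport θ) with hK
  have hKc : IsCompact K := hc.cthickening
  have hKm : MeasurableSet K := hKc.isClosed.measurableSet
  obtain ⟨B, hB⟩ := hc.exists_bound_of_continuous hθ.continuous
  have hB0 : 0 ≤ B := (norm_nonneg _).trans (hB 0)
  have hsub : ∀ᶠ n in atTop, tsupport (mollify n θ) ⊆ K := by
    filter_upwards [tendsto_mollifier_rOut.eventually (ge_mem_nhds hδ)] with n hn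
    exact (tsupport_mollify_subset n θ).trans (cthickening_mono hn _)
  have hwK : Integrable (K.indicator w) (volume.restrict Ω) := by
    rw [integrable_indicator_iff hKm, IntegrableOn, Measure.restrict_restrict hKm, inter_comm]
    exact hw K hKc
  have hGK : Integrable (K.indicator fun z => G z i) (volume.restrict Ω) := by
    rw [integrable_indicator_iff hKm, IntegrableOn, Measure.restrict_restrict hKm, inter_comm]
    exact (EuclideanSpace.proj (𝕜 := ℝ) i : Plane →L[ℝ] ℝ).integrable_comp (hG K hKc)
  have hind : ∀ (g h : Plane → ℝ), (∀ z ∉ K, h z = 0) → ∀ z, g z * h z = K.indicator g z * h z := by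
    intro g h hh z
    by_cases hz : z ∈ K
    · rw [indicator_of_mem hz]
    · rw [hh z hz, mul_zero, mul_zero]
  have hθK : ∀ z ∉ K, z ∉ tsupport θ := fun z hz h => hz (self_subset_cthickening _ h)
  have l1 : Tendsto (fun n => ∫ z in Ω, w z * fderiv ℝ (mollify n θ) z (stdVec i)) atTop
      (𝓝 (∫ z in Ω, w z * lineDeriv ℝ θ z (stdVec i))) := by
    have hm : ∀ n, AEStronglyMeasurable (fun z => fderiv ℝ (mollify n θ) z (stdVec i))
        (volume.restrict Ω) := fun n =>
      (((contDiff_mollify hθ.continuous.locallyIntegrable n).continuous_fderiv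
        (by norm_num)).clm_apply continuous_const).aestronglyMeasurable
    rw [integral_congr_ae (Eventually.of_forall (hind w _ fun z hz => lineDeriv_eq_zero (hθK z hz)))]
    have : ∀ᶠ n in atTop, ∫ z in Ω, K.indicator w z * fderiv ℝ (mollify n θ) z (stdVec i) =
        ∫ z in Ω, w z * fderiv ℝ (mollify n θ) z (stdVec i) := by
      filter_upwards [hsub] with n hn
      refine integral_congr_ae (Eventually.of_forall fun z =>
        (hind w (fun z => fderiv ℝ (mollify n θ) z (stdVec i)) (fun z hz => ?_) z).symm)
      rw [fderiv_of_notMem_tsupport ℝ (fun h => hz (hn h))]; rfl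
    refine Tendsto.congr' this ?_
    refine tendsto_integral_of_dominated_convergence (fun z => ‖K.indicator w z‖ * C)
      (fun n => hwK.aestronglyMeasurable.mul (hm n)) (hwK.norm.mul_const _)
      (fun n => Eventually.of_forall fun z => ?_) ?_
    · rw [norm_mul, fderiv_mollify hθ]
      gcongr
      refine norm_mollify_le (fun x => ?_) n z
      simpa [norm_stdVec] using norm_lineDeriv_le hθ x (stdVec i)
    · have := ae_tendsto_mollify (hθ.locallyIntegrable_lineDeriv (μ := volume) (stdVec i))
      filter_upwards [ae_restrict_of_ae this] with z hz
      simp only [fderiv_mollify hθ]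
      exact hz.const_mul _
  have l2 : Tendsto (fun n => ∫ z in Ω, G z i * mollify n θ z) atTop
      (𝓝 (∫ z in Ω, G z i * θ z)) := by
    rw [integral_congr_ae (Eventually.of_forall (hind (fun z => G z i) θ
      fun z hz => image_eq_zero_of_notMem_tsupport (hθK z hz)))]
    have : ∀ᶠ n in atTop, ∫ z in Ω, K.indicator (fun z => G z i) z * mollify n θ z =
        ∫ z in Ω, G z i * mollify n θ z := by
      filter_upwards [hsub] with n hn
      refine integral_congr_ae (Eventually.of_forall fun z =>
        (hind (fun z => G z i) _ (fun z hz => ?_) z).symm)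
      exact image_eq_zero_of_notMem_tsupport fun h => hz (hn h)
    refine Tendsto.congr' this ?_
    refine tendsto_integral_of_dominated_convergence
      (fun z => ‖K.indicator (fun z => G z i) z‖ * B)
      (fun n => hGK.aestronglyMeasurable.mul
        (contDiff_mollify hθ.continuous.locallyIntegrable n).continuous.aestronglyMeasurable)
      (hGK.norm.mul_const _) (fun n => Eventually.of_forall fun z => ?_)
      (Eventually.of_forall fun z => (tendsto_mollify hθ.continuous z).const_mul _)
    rw [norm_mul]
    gcongr
    exact norm_mollify_le hB n z
  refine tendsto_nhds_unique l1 (l2.neg.congr' ?_)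
  filter_upwards [hsub] with n hn
  exact (hwG _ (contDiff_mollify hθ.continuous.locallyIntegrable n)
    (hKc.of_isClosed_subset (isClosed_tsupport _) hn) (hn.trans hδΩ) i).symm

end

section

variable {Ω : Set Plane} {q : Plane → Plane} {M : ℝ≥0}

lemma exists_le_boundaryDist (hΩ : IsOpen Ω) {K : Set Plane} (hK : IsCompact K) (hKΩ : K ⊆ Ω) :
    ∃ δ > 0, ∀ z ∈ K, δ ≤ boundaryDist Ω z := by
  rcases K.eq_empty_or_nonempty with rfl | hne
  · exact ⟨1, one_pos, by simp⟩
  · obtain ⟨x, hx, hmin⟩ := hK.exists_isMinOn hne (lipschitzWith_boundaryDist Ω).continuous.continuousOn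
    exact ⟨_, boundaryDist_pos hΩ (hKΩ hx), fun z hz => hmin hz⟩

/-- A bounded function that vanishes off `S` and is Lipschitz in the discs of radius `δ` about the
points of `S` is Lipschitz. -/
lemma exists_lipschitzWith_of_local {g : Plane → ℝ} {S : Set Plane} {A B δ : ℝ} (hA : 0 ≤ A)
    (hδ : 0 < δ) (hB : ∀ x, |g x| ≤ B) (h0 : ∀ x ∉ S, g x = 0)
    (hloc : ∀ x ∈ S, ∀ y, dist x y < δ → |g x - g y| ≤ A * dist x y) :
    ∃ C : ℝ≥0, LipschitzWith C g := by
  have hB0 : 0 ≤ B := (abs_nonneg _).trans (hB 0)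
  have key : ∀ x ∈ S, ∀ y, |g x - g y| ≤ (A + 2 * B / δ) * dist x y := by
    intro x hx y
    rcases lt_or_ge (dist x y) δ with h | h
    · refine (hloc x hx y h).trans ?_
      gcongr
      have : 0 ≤ 2 * B / δ := by positivity
      linarith
    · calc |g x - g y| ≤ |g x| + |g y| := abs_sub _ _
        _ ≤ 2 * B := by linarith [hB x, hB y]
        _ = 2 * B / δ * δ := by field_simp
        _ ≤ 2 * B / δ * dist x y := by gcongr
        _ ≤ _ := by
          gcongr
          linarith
  refine ⟨⟨A + 2 * B / δ, by positivity⟩, LipschitzWith.of_dist_le_mul fun x y => ?_⟩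
  rw [Real.dist_eq]
  by_cases hx : x ∈ S
  · exact key x hx y
  · by_cases hy : y ∈ S
    · rw [abs_sub_comm, dist_comm]; exact key y hy x
    · rw [h0 x hx, h0 y hy, sub_self, abs_zero]
      exact mul_nonneg (NNReal.coe_nonneg _) dist_nonneg

lemma abs_apply_le_norm (z : Plane) (i : Fin 2) : |z i| ≤ ‖z‖ := by
  simpa using PiLp.norm_apply_le z i

lemma clm_apply_eq_sum (A : Plane →L[ℝ] ℝ) (v : Plane) : A v = ∑ i, v i * A (stdVec i) := by
  have : v = ∑ i : Fin 2, v i • stdVec i := by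
    ext j
    fin_cases j <;> simp [stdVec]
  conv_lhs => rw [this]
  simp

namespace IsTangentField

lemma exists_lipschitzWith_mul (h : IsTangentField Ω q M) {u : Plane → ℝ} {C : ℝ≥0}
    (hu : LipschitzWith C u) (hc : HasCompactSupport u) (hs : tsupport u ⊆ Ω) (i : Fin 2) :
    ∃ C' : ℝ≥0, LipschitzWith C' fun z => u z * q z i := by
  obtain ⟨δ, hδ, hδb⟩ := exists_le_boundaryDist h.isOpen hc hs
  obtain ⟨B, hB⟩ := hc.exists_bound_of_continuous hu.continuous
  have hB0 : 0 ≤ B := (norm_nonneg _).trans (hB 0)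
  have hq : ∀ z ∈ Ω, |q z i| ≤ M := fun z hz => (abs_apply_le_norm _ _).trans (h.norm_le z hz)
  refine exists_lipschitzWith_of_local (S := tsupport u) (A := C * M + B * M) (B := B * M)
    (by positivity) hδ (fun z => ?_) (fun z hz => ?_) (fun x hx y hxy => ?_)
  · by_cases hz : z ∈ Ω
    · rw [abs_mul]
      exact mul_le_mul (hB z) (hq z hz) (abs_nonneg _) hB0
    · rw [image_eq_zero_of_notMem_tsupport fun h => hz (hs h), zero_mul, abs_zero]
      positivity
  · rw [image_eq_zero_of_notMem_tsupport hz, zero_mul]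
  · have hxy' : dist x y < boundaryDist Ω x := hxy.trans_le (hδb x hx)
    have hy : y ∈ Ω := ball_boundaryDist_subset x (by rwa [mem_ball, dist_comm])
    have h1 : |q y i - q x i| ≤ M * dist x y := by
      rw [dist_comm, dist_eq_norm]
      exact (abs_apply_le_norm (q y - q x) i).trans (h.norm_image_sub_le hxy')
    have h2 : |u x - u y| ≤ C * dist x y := by simpa [Real.dist_eq] using hu.dist_le_mul x y
    calc |u x * q x i - u y * q y i| = |(u x - u y) * q y i - u x * (q y i - q x i)| := by
          congr 1; ring
      _ ≤ |u x - u y| * |q y i| + |u x| * |q y i - q x i| := by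
          rw [← abs_mul, ← abs_mul]; exact abs_sub _ _
      _ ≤ (C * dist x y) * M + B * (M * dist x y) :=
          add_le_add (mul_le_mul h2 (hq y hy) (abs_nonneg _) (by positivity))
            (mul_le_mul (hB x) h1 (abs_nonneg _) hB0)
      _ = _ := by ring

/-- If `q · ∇w = 0` weakly, then `w` is orthogonal to the derivatives along the divergence-free
field `q` of all Lipschitz functions with compact support in `Ω`. -/
lemma integral_mul_fderiv_eq_zero (h : IsTangentField Ω q M)
    (hdiv : ∀ z ∈ Ω, divergence q z = 0) {w : Plane → ℝ} {G : Plane → Plane}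
    (hwG : HasWeakGradient Ω w G) (hw : ∀ K, IsCompact K → IntegrableOn w (Ω ∩ K))
    (hG : ∀ K, IsCompact K → IntegrableOn G (Ω ∩ K))
    (hqG : ∀ᵐ z ∂(volume.restrict Ω), ⟪q z, G z⟫_ℝ = 0) {u : Plane → ℝ} {C : ℝ≥0}
    (hu : LipschitzWith C u) (hc : HasCompactSupport u) (hs : tsupport u ⊆ Ω) :
    ∫ z in Ω, w z * fderiv ℝ u z (q z) = 0 := by
  choose C' hC' using h.exists_lipschitzWith_mul hu hc hs
  have hKm : MeasurableSet (tsupport u) := (isClosed_tsupport u).measurableSet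
  have hts : ∀ i : Fin 2, tsupport (fun z => u z * q z i) ⊆ tsupport u := fun i =>
    closure_mono (Function.support_mul_subset_left u fun z => q z i)
  have key : ∀ i : Fin 2, ∫ z in Ω, w z * lineDeriv ℝ (fun z => u z * q z i) z (stdVec i) =
      -∫ z in Ω, G z i * (u z * q z i) := fun i =>
    integral_lineDeriv_of_hasWeakGradient h.isOpen hwG hw hG (hC' i) (hc.mono' ((subset_tsupport _).trans (hts i)))
      ((hts i).trans hs) i
  have hint1 : ∀ i : Fin 2, Integrable
      (fun z => w z * lineDeriv ℝ (fun z => u z * q z i) z (stdVec i)) (volume.restrict Ω) := by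
    intro i
    have hwK : IntegrableOn w (tsupport u) (volume.restrict Ω) := by
      rw [IntegrableOn, Measure.restrict_restrict hKm, inter_comm]
      exact hw _ hc
    have : IntegrableOn (fun z => w z * lineDeriv ℝ (fun z => u z * q z i) z (stdVec i))
        (tsupport u) (volume.restrict Ω) :=
      hwK.mul_bdd (c := C' i * ‖stdVec i‖)
        (measurable_lineDeriv (hC' i).continuous).aestronglyMeasurable
        (Eventually.of_forall fun z => norm_lineDeriv_le (hC' i) z _)
    refine (integrableOn_iff_integrable_of_support_subset fun z hz => ?_).1 this
    by_contra hz'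
    exact hz (by simp only [lineDeriv_eq_zero fun h => hz' (hts i h), mul_zero])
  have hint2 : ∀ i : Fin 2, Integrable (fun z => G z i * (u z * q z i)) (volume.restrict Ω) := by
    intro i
    have hGK : IntegrableOn (fun z => G z i) (tsupport u) (volume.restrict Ω) := by
      rw [IntegrableOn, Measure.restrict_restrict hKm, inter_comm]
      exact (EuclideanSpace.proj (𝕜 := ℝ) i : Plane →L[ℝ] ℝ).integrable_comp (hG _ hc)
    obtain ⟨B, hB⟩ := (hc.mono' ((subset_tsupport _).trans (hts i))).exists_bound_of_continuous
      (hC' i).continuous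
    have : IntegrableOn (fun z => G z i * (u z * q z i)) (tsupport u) (volume.restrict Ω) :=
      hGK.mul_bdd (c := B) (hC' i).continuous.aestronglyMeasurable (Eventually.of_forall hB)
    refine (integrableOn_iff_integrable_of_support_subset fun z hz => ?_).1 this
    by_contra hz'
    exact hz (by simp only [image_eq_zero_of_notMem_tsupport hz', zero_mul, mul_zero])
  have hsum : ∑ i : Fin 2, ∫ z in Ω, w z * lineDeriv ℝ (fun z => u z * q z i) z (stdVec i) = 0 := by
    simp only [key]
    rw [Finset.sum_neg_distrib, ← integral_finsetSum _ fun i _ => hint2 i, neg_eq_zero]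
    refine integral_eq_zero_of_ae ?_
    filter_upwards [hqG] with z hz
    have : ⟪q z, G z⟫_ℝ = ∑ i, G z i * q z i := by
      simp [PiLp.inner_apply]
    rw [this] at hz
    calc ∑ i, G z i * (u z * q z i) = u z * ∑ i, G z i * q z i := by
          rw [Finset.mul_sum]; exact Finset.sum_congr rfl fun i _ => by ring
      _ = 0 := by rw [hz, mul_zero]
  rw [← integral_finsetSum _ fun i _ => hint1 i] at hsum
  rw [← hsum]
  refine integral_congr_ae ?_
  filter_upwards [ae_restrict_of_ae hu.ae_differentiableAt, ae_restrict_mem h.isOpen.measurableSet]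
    with z hz hzΩ
  have hqz : DifferentiableAt ℝ q z :=
    (h.contDiffOn.contDiffAt (h.isOpen.mem_nhds hzΩ)).differentiableAt one_ne_zero
  have hd := hdiv z hzΩ
  have hline : ∀ i : Fin 2, lineDeriv ℝ (fun z => u z * q z i) z (stdVec i) =
      u z * fderiv ℝ q z (stdVec i) i + q z i * fderiv ℝ u z (stdVec i) := by
    intro i
    have hqi : HasFDerivAt (fun z => q z i)
        ((EuclideanSpace.proj (𝕜 := ℝ) i : Plane →L[ℝ] ℝ).comp (fderiv ℝ q z)) z :=
      (EuclideanSpace.proj (𝕜 := ℝ) i : Plane →L[ℝ] ℝ).hasFDerivAt.comp z hqz.hasFDerivAt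
    have : HasFDerivAt (fun z => u z * q z i) _ z := hz.hasFDerivAt.mul hqi
    rw [(this.differentiableAt).lineDeriv_eq_fderiv, this.fderiv]
    simp
  simp only [hline]
  rw [← Finset.mul_sum, Finset.sum_add_distrib, ← Finset.mul_sum, clm_apply_eq_sum]
  rw [divergence] at hd
  rw [hd, mul_zero, zero_add]

end IsTangentField

end

/-! ### Invariance of the area and of first integrals under the flow -/

section

variable {Ω : Set Plane} {q : Plane → Plane} {M : ℝ≥0} {φ : ℝ → Plane → Plane}

namespace IsFlow

/-- For bounded times, a test function remains supported in one compact subset of `Ω` when it is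
transported by the flow. -/
lemma exists_compact_support (h : IsFlow Ω q M φ) {f : Plane → ℝ} (hc : HasCompactSupport f)
    (hs : tsupport f ⊆ Ω) (T : ℝ) :
    ∃ K ⊆ Ω, IsCompact K ∧ ∀ t, |t| ≤ T → ∀ z ∉ K, f (φ t z) = 0 := by
  obtain ⟨δ, hδ, hδb⟩ := exists_le_boundaryDist h.isOpen hc hs
  have hδ' : 0 < δ * Real.exp (-(M * T)) := mul_pos hδ (Real.exp_pos _)
  refine ⟨cthickening (M * T) (tsupport f) ∩ {z | δ * Real.exp (-(M * T)) ≤ boundaryDist Ω z},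
    fun z hz => mem_of_boundaryDist_pos (hδ'.trans_le hz.2), ?_, fun t ht z hz => ?_⟩
  · exact IsCompact.inter_right hc.cthickening
      (isClosed_le continuous_const (lipschitzWith_boundaryDist Ω).continuous)
  · by_contra hne
    have hmem : φ t z ∈ tsupport f := subset_tsupport _ hne
    refine hz ⟨mem_cthickening_of_dist_le _ _ _ _ hmem ?_, ?_⟩
    · rw [dist_comm, dist_eq_norm]
      exact (h.norm_sub_le t z).trans (by gcongr)
    · have h1 := h.boundaryDist_ge (hs hmem) (-t)
      rw [h.neg_apply, abs_neg] at h1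
      refine le_trans ?_ h1
      exact mul_le_mul (hδb _ hmem) (Real.exp_le_exp.2 (neg_le_neg (by gcongr)))
        (Real.exp_pos _).le (boundaryDist_nonneg _ _)

lemma exists_lipschitzWith_comp (h : IsFlow Ω q M φ) {f : Plane → ℝ} {C : ℝ≥0}
    (hf : LipschitzWith C f) (hc : HasCompactSupport f) (hs : tsupport f ⊆ Ω) (t : ℝ) :
    ∃ C' : ℝ≥0, LipschitzWith C' fun z => f (φ t z) := by
  obtain ⟨K, hKΩ, hK, hKf⟩ := h.exists_compact_support hc hs |t|
  obtain ⟨δ, hδ, hδb⟩ := exists_le_boundaryDist h.isOpen hK hKΩ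
  obtain ⟨B, hB⟩ := hc.exists_bound_of_continuous hf.continuous
  obtain ⟨L, hL⟩ := h.lipschitzOn (δ / 2) |t| (half_pos hδ)
  refine exists_lipschitzWith_of_local (S := K) (A := C * L) (B := B) (by positivity)
    (half_pos hδ) (fun x => hB _) (hKf t le_rfl) (fun x hx y hxy => ?_)
  have hbx := hδb x hx
  have hby : δ / 2 ≤ boundaryDist Ω y := by
    have := (abs_le.1 (abs_boundaryDist_sub_le Ω x y)).2
    linarith
  rw [← Real.dist_eq, mul_assoc]
  refine (hf.dist_le_mul _ _).trans ?_
  gcongr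
  exact (hL t le_rfl).dist_le_mul x (by rw [mem_ofPred_eq]; linarith) y hby

/-- The hypothesis `hw` says that `w` is constant along `q` in the sense of distributions. -/
lemma integral_mul_comp_eq (h : IsFlow Ω q M φ) {w : Plane → ℝ}
    (hwi : ∀ K, IsCompact K → IntegrableOn w (Ω ∩ K))
    (hw : ∀ (u : Plane → ℝ) (C : ℝ≥0), LipschitzWith C u → HasCompactSupport u → tsupport u ⊆ Ω →
      ∫ z in Ω, w z * fderiv ℝ u z (q z) = 0)
    {f : Plane → ℝ} (hf : ContDiff ℝ ∞ f) (hc : HasCompactSupport f) (hs : tsupport f ⊆ Ω) (t : ℝ) :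
    ∫ z in Ω, w z * f (φ t z) = ∫ z in Ω, w z * f z := by
  obtain ⟨C, hC⟩ := hf.lipschitzWith_of_hasCompactSupport hc (by simp)
  have hfd : ∀ z, DifferentiableAt ℝ f z := fun z => hf.differentiable (by simp) z
  have hfm : ∀ s, Measurable fun z => f (φ s z) := fun s =>
    hf.continuous.measurable.comp (h.measurable s)
  obtain ⟨B, hB⟩ := hc.exists_bound_of_continuous hf.continuous
  have hder : ∀ t, HasDerivAt (fun t => ∫ z in Ω, w z * f (φ t z)) 0 t := by
    intro t
    obtain ⟨K, hKΩ, hK, hKf⟩ := h.exists_compact_support hc hs (|t| + 1)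
    have hKm := hK.isClosed.measurableSet
    have hwK : Integrable (K.indicator w) (volume.restrict Ω) := by
      rw [integrable_indicator_iff hKm, IntegrableOn, Measure.restrict_restrict hKm, inter_comm]
      exact hwi K hK
    have hts : ∀ s ∈ ball t 1, |s| ≤ |t| + 1 := by
      intro s hs
      rw [mem_ball, Real.dist_eq] at hs
      linarith [abs_sub_abs_le_abs_sub s t]
    have hind : ∀ s ∈ ball t 1, ∀ z, w z * f (φ s z) = K.indicator w z * f (φ s z) := by
      intro s hs z
      by_cases hz : z ∈ K
      · rw [indicator_of_mem hz]
      · rw [hKf s (hts s hs) z hz, mul_zero, mul_zero]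
    have hflow : ∀ z ∈ Ω, ∀ s, HasDerivAt (fun s => f (φ s z))
        (fderiv ℝ f (φ s z) (q (φ s z))) s := fun z hz s =>
      (hfd _).hasFDerivAt.comp_hasDerivAt s (h.hasDerivAt hz s)
    obtain ⟨C', hC'⟩ := h.exists_lipschitzWith_comp hC hc hs t
    have hsupp : tsupport (fun z => f (φ t z)) ⊆ K :=
      closure_minimal (fun z hz => by
        by_contra hz'; exact hz (hKf t (hts t (mem_ball_self one_pos)) z hz')) hK.isClosed
    have hae : ∀ᵐ z ∂(volume.restrict Ω), fderiv ℝ (fun z => f (φ t z)) z (q z) =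
        fderiv ℝ f (φ t z) (q (φ t z)) := by
      filter_upwards [ae_restrict_of_ae hC'.ae_differentiableAt,
        ae_restrict_mem h.isOpen.measurableSet] with z hz hzΩ
      have e1 : HasDerivAt (fun s => f (φ t (φ s z)))
          (fderiv ℝ (fun z => f (φ t z)) z (q z)) 0 := by
        have := h.hasDerivAt hzΩ 0
        rw [h.zero] at this
        have hz' : HasFDerivAt (fun z => f (φ t z)) (fderiv ℝ (fun z => f (φ t z)) z)
          (φ 0 z) := by rw [h.zero]; exact hz.hasFDerivAt
        have e0 := hz'.comp_hasDerivAt 0 this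
        exact e0
      have e2 : HasDerivAt (fun s => f (φ t (φ s z))) (fderiv ℝ f (φ t z) (q (φ t z))) 0 := by
        have := (hflow z hzΩ (t + 0))
        have := this.comp_const_add t 0
        simp only [h.add] at this
        simpa only [h.zero] using this
      exact e1.unique e2
    have hmeas : AEStronglyMeasurable (fun z => fderiv ℝ f (φ t z) (q (φ t z)))
        (volume.restrict Ω) := by
      refine ContinuousOn.aestronglyMeasurable (fun z hz => ?_) h.isOpen.measurableSet
      have h1 := (h.continuousAt t hz)
      have h2 : ContinuousAt q (φ t z) :=
        h.contDiffOn.continuousOn.continuousAt (h.isOpen.mem_nhds (h.mem hz t))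
      exact (((hf.continuous_fderiv (by simp)).continuousAt.comp h1).clm_apply
        (h2.comp h1)).continuousWithinAt
    have hb : ∀ z ∈ Ω, ∀ s ∈ ball t 1,
        ‖w z * fderiv ℝ f (φ s z) (q (φ s z))‖ ≤ ‖K.indicator w z‖ * (C * M) := by
      intro z hz s hs
      have hle : ‖fderiv ℝ f (φ s z) (q (φ s z))‖ ≤ C * M :=
        (ContinuousLinearMap.le_opNorm _ _).trans (mul_le_mul
          (norm_fderiv_le_of_lipschitz ℝ hC) (h.norm_le _ (h.mem hz s)) (norm_nonneg _) C.2)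
      by_cases hzK : z ∈ K
      · rw [indicator_of_mem hzK, norm_mul]
        gcongr
      · have hd := hflow z hz s
        have hzero : (fun s => f (φ s z)) =ᶠ[𝓝 s] fun _ => 0 := by
          filter_upwards [isOpen_ball.mem_nhds hs] with r hr
          exact hKf r (hts r hr) z hzK
        rw [hd.unique ((hasDerivAt_const s (0 : ℝ)).congr_of_eventuallyEq hzero), mul_zero,
          norm_zero]
        positivity
    have key := hasDerivAt_integral_of_dominated_loc_of_deriv_le (𝕜 := ℝ)
      (μ := volume.restrict Ω) (x₀ := t) (s := ball t 1)
      (F := fun s z => w z * f (φ s z))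
      (F' := fun s z => w z * fderiv ℝ f (φ s z) (q (φ s z)))
      (bound := fun z => ‖K.indicator w z‖ * (C * M)) (ball_mem_nhds t one_pos)
      ?_ ?_ ?_ ?_ (hwK.norm.mul_const _) ?_
    · have h0 : ∫ z in Ω, w z * fderiv ℝ f (φ t z) (q (φ t z)) = 0 := by
        rw [← hw _ C' hC' (hK.of_isClosed_subset (isClosed_tsupport _) hsupp) (hsupp.trans hKΩ)]
        refine integral_congr_ae ?_
        filter_upwards [hae] with z hz
        rw [hz]
      have := key.2
      rwa [h0] at this
    · filter_upwards [ball_mem_nhds t one_pos] with s hs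
      rw [show (fun z => w z * f (φ s z)) = fun z => K.indicator w z * f (φ s z) from
        funext (hind s hs)]
      exact hwK.aestronglyMeasurable.mul (hfm s).aestronglyMeasurable
    · rw [show (fun z => w z * f (φ t z)) = fun z => K.indicator w z * f (φ t z) from
        funext (hind t (mem_ball_self one_pos))]
      exact hwK.mul_bdd (c := B) (hfm t).aestronglyMeasurable (Eventually.of_forall fun z => hB _)
    · have : (fun z => w z * fderiv ℝ f (φ t z) (q (φ t z))) =ᵐ[volume.restrict Ω]
          fun z => K.indicator w z * fderiv ℝ f (φ t z) (q (φ t z)) := by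
        filter_upwards [ae_restrict_mem h.isOpen.measurableSet] with z hz
        by_cases hzK : z ∈ K
        · rw [indicator_of_mem hzK]
        · have := hb z hz t (mem_ball_self one_pos)
          rw [indicator_of_notMem hzK, norm_zero, zero_mul] at this
          rw [norm_le_zero_iff.1 this, indicator_of_notMem hzK, zero_mul]
      exact (hwK.aestronglyMeasurable.mul hmeas).congr this.symm
    · filter_upwards [ae_restrict_mem h.isOpen.measurableSet] with z hz
      exact hb z hz
    · filter_upwards [ae_restrict_mem h.isOpen.measurableSet] with z hz
      exact fun s _ => (hflow z hz s).const_mul (w z)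
  have := is_const_of_deriv_eq_zero (fun t => (hder t).differentiableAt)
    (fun t => (hder t).deriv) t 0
  simpa only [h.zero] using this

end IsFlow

end

section

variable {Ω : Set Plane} {q : Plane → Plane} {M : ℝ≥0} {φ : ℝ → Plane → Plane}

open scoped Manifold in
/-- A smooth function with values in `[0, 1]` which equals `1` on a compact set and is supported
in a given neighbourhood of it. -/
lemma exists_smooth_cutoff {K U : Set Plane} (hK : IsCompact K) (hU : IsOpen U) (hKU : K ⊆ U) :
    ∃ f : Plane → ℝ, ContDiff ℝ ∞ f ∧ HasCompactSupport f ∧ tsupport f ⊆ U ∧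
      (∀ z, f z ∈ Icc (0 : ℝ) 1) ∧ ∀ z ∈ K, f z = 1 := by
  obtain ⟨δ, hδ, hδU⟩ := hK.exists_cthickening_subset_open hU hKU
  obtain ⟨f, hf0, hf1, hf⟩ := exists_contMDiffMap_zero_one_of_isClosed 𝓘(ℝ, Plane) (n := ⊤)
    (isOpen_thickening (δ := δ) (E := K)).isClosed_compl hK.isClosed
    (disjoint_compl_left_iff_subset.2 (self_subset_thickening hδ K))
  have hts : tsupport f ⊆ cthickening δ K := by
    refine closure_minimal (fun z hz => ?_) isClosed_cthickening
    by_contra hz'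
    exact hz (hf0 (fun h => hz' (thickening_subset_cthickening _ _ h)))
  exact ⟨f, f.contMDiff.contDiff, hK.cthickening.of_isClosed_subset (isClosed_tsupport _) hts,
    hts.trans hδU, hf, fun z hz => hf1 hz⟩

lemma integral_fderiv_eq_zero {ψ : Plane → ℝ} (hψ : ContDiff ℝ 1 ψ) (hc : HasCompactSupport ψ)
    (v : Plane) : ∫ z, fderiv ℝ ψ z v = 0 := by
  have hd : Continuous fun z => fderiv ℝ ψ z v :=
    (hψ.continuous_fderiv one_ne_zero).clm_apply continuous_const
  have hdc : HasCompactSupport fun z => fderiv ℝ ψ z v := hc.fderiv_apply ℝ v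
  have := integral_mul_fderiv_eq_neg_fderiv_mul_of_integrable (𝕜 := ℝ)
    (μ := (volume : Measure Plane)) (f := fun _ => 1) (g := ψ) (v := v) (by simp)
    (by simpa using hd.integrable_of_hasCompactSupport hdc)
    (by simpa using hψ.continuous.integrable_of_hasCompactSupport hc) (by simp)
    (fun z _ => hψ.differentiable one_ne_zero z)
  simpa using this

lemma hasWeakGradient_one (Ω : Set Plane) : HasWeakGradient Ω (fun _ => 1) (fun _ => 0) := by
  intro ψ hψ hc hs i
  have h1 := integral_fderiv_eq_zero (hψ.of_le (by norm_num)) hc (stdVec i)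
  rw [← setIntegral_eq_integral_of_forall_compl_eq_zero (s := Ω)] at h1
  · simpa using h1
  · intro z hz
    rw [fderiv_of_notMem_tsupport ℝ (fun h => hz (hs h))]; rfl

namespace IsFlow

/-- The time `t` map of the flow. -/
noncomputable def timeEquiv (h : IsFlow Ω q M φ) (t : ℝ) : Plane ≃ᵐ Plane where
  toFun := φ t
  invFun := φ (-t)
  left_inv := h.neg_apply t
  right_inv := h.apply_neg t
  measurable_toFun := h.measurable t
  measurable_invFun := h.measurable (-t)

lemma measurableEmbedding (h : IsFlow Ω q M φ) (t : ℝ) : MeasurableEmbedding (φ t) :=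
  (h.timeEquiv t).measurableEmbedding

lemma measure_preimage_compact_le (h : IsFlow Ω q M φ)
    (hw : ∀ (u : Plane → ℝ) (C : ℝ≥0), LipschitzWith C u → HasCompactSupport u → tsupport u ⊆ Ω →
      ∫ z in Ω, 1 * fderiv ℝ u z (q z) = 0) {K U : Set Plane} (hK : IsCompact K) (hU : IsOpen U)
    (hKU : K ⊆ U) (hUΩ : U ⊆ Ω) (t : ℝ) : volume.restrict Ω (φ t ⁻¹' K) ≤ volume U := by
  obtain ⟨f, hf, hc, hs, hf01, hf1⟩ := exists_smooth_cutoff hK hU hKU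
  have key := h.integral_mul_comp_eq (w := fun _ => 1) (fun K hK => by
    have : volume (Ω ∩ K) < ⊤ := (measure_mono inter_subset_right).trans_lt hK.measure_lt_top
    exact integrableOn_const this.ne) hw hf hc (hs.trans hUΩ) t
  simp only [one_mul] at key
  have hfi : Integrable f (volume.restrict Ω) :=
    (hf.continuous.integrable_of_hasCompactSupport hc).restrict
  obtain ⟨K', -, hK', hK'f⟩ := h.exists_compact_support hc (hs.trans hUΩ) |t|
  have hfφm : Measurable fun z => f (φ t z) := hf.continuous.measurable.comp (h.measurable t)
  have hfφ : Integrable (fun z => f (φ t z)) (volume.restrict Ω) := by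
    have h1 : IntegrableOn (fun z => f (φ t z)) K' := by
      refine Measure.integrableOn_of_bounded (M := 1) hK'.measure_lt_top.ne
        hfφm.aestronglyMeasurable (Eventually.of_forall fun z => ?_)
      rw [Real.norm_eq_abs, abs_of_nonneg (hf01 _).1]
      exact (hf01 _).2
    refine Integrable.restrict ((integrableOn_iff_integrable_of_support_subset fun z hz => ?_).1 h1)
    by_contra hz'
    exact hz (hK'f t le_rfl z hz')
  calc volume.restrict Ω (φ t ⁻¹' K)
      = ∫⁻ z in Ω, (φ t ⁻¹' K).indicator 1 z := by
        rw [lintegral_indicator_one (h.measurable t hK.isClosed.measurableSet)]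
    _ ≤ ∫⁻ z in Ω, ENNReal.ofReal (f (φ t z)) := by
        refine lintegral_mono fun z => ?_
        by_cases hz : z ∈ φ t ⁻¹' K
        · rw [indicator_of_mem hz, hf1 _ hz]; simp
        · rw [indicator_of_notMem hz]; exact zero_le
    _ = ENNReal.ofReal (∫ z in Ω, f z) := by
        rw [← key, ofReal_integral_eq_lintegral_ofReal hfφ (Eventually.of_forall fun z => (hf01 _).1)]
    _ = ∫⁻ z in Ω, ENNReal.ofReal (f z) := by
        rw [ofReal_integral_eq_lintegral_ofReal hfi (Eventually.of_forall fun z => (hf01 _).1)]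
    _ ≤ ∫⁻ z in Ω, U.indicator 1 z := by
        refine lintegral_mono fun z => ?_
        by_cases hz : z ∈ U
        · rw [indicator_of_mem hz]
          exact ENNReal.ofReal_le_one.2 (hf01 z).2
        · rw [image_eq_zero_of_notMem_tsupport fun h => hz (hs h)]; simp
    _ ≤ volume U := by
        rw [lintegral_indicator_one hU.measurableSet]
        exact Measure.restrict_apply_le _ _

lemma map_restrict_le (h : IsFlow Ω q M φ)
    (hw : ∀ (u : Plane → ℝ) (C : ℝ≥0), LipschitzWith C u → HasCompactSupport u → tsupport u ⊆ Ω →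
      ∫ z in Ω, 1 * fderiv ℝ u z (q z) = 0) (t : ℝ) :
    (volume.restrict Ω).map (φ t) ≤ volume.restrict Ω := by
  have hopen : ∀ U, IsOpen U → U ⊆ Ω → volume.restrict Ω (φ t ⁻¹' U) ≤ volume U := by
    intro U hU hUΩ
    obtain ⟨F, hFc, hFU, hFun, hFm⟩ := hU.exists_iUnion_isClosed
    have hmono : Monotone fun n : ℕ => φ t ⁻¹' (F n ∩ closedBall 0 n) := fun m n hmn =>
      preimage_mono (inter_subset_inter (hFm hmn)
        (closedBall_subset_closedBall (by exact_mod_cast hmn)))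
    have hun : φ t ⁻¹' U = ⋃ n : ℕ, φ t ⁻¹' (F n ∩ closedBall 0 n) := by
      rw [← preimage_iUnion]
      congr 1
      refine Subset.antisymm (fun z hz => ?_) (iUnion_subset fun n => inter_subset_left.trans (hFU n))
      rw [← hFun] at hz
      obtain ⟨m, hm⟩ := mem_iUnion.1 hz
      refine mem_iUnion.2 ⟨max m ⌈‖z‖⌉₊, hFm (le_max_left _ _) hm, ?_⟩
      rw [mem_closedBall_zero_iff]
      exact (Nat.le_ceil _).trans (by exact_mod_cast le_max_right _ _)
    rw [hun, hmono.measure_iUnion]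
    exact iSup_le fun n => h.measure_preimage_compact_le hw
      ((isCompact_closedBall 0 (n : ℝ)).inter_left (hFc n)) hU
      (inter_subset_left.trans (hFU n)) hUΩ t
  refine Measure.le_iff.2 fun A hA => ?_
  rw [Measure.map_apply (h.measurable t) hA, Measure.restrict_apply hA,
    (A ∩ Ω).measure_eq_iInf_isOpen]
  refine le_iInf₂ fun U hAU => le_iInf fun hU => ?_
  calc volume.restrict Ω (φ t ⁻¹' A) = volume (φ t ⁻¹' A ∩ Ω) :=
        Measure.restrict_apply (h.measurable t hA)
    _ ≤ volume (φ t ⁻¹' (U ∩ Ω) ∩ Ω) := by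
        refine measure_mono fun z hz => ⟨⟨hAU ⟨hz.1, h.mem hz.2 t⟩, h.mem hz.2 t⟩, hz.2⟩
    _ = volume.restrict Ω (φ t ⁻¹' (U ∩ Ω)) :=
        (Measure.restrict_apply (h.measurable t (hU.inter h.isOpen).measurableSet)).symm
    _ ≤ volume (U ∩ Ω) := hopen _ (hU.inter h.isOpen) inter_subset_right
    _ ≤ volume U := measure_mono inter_subset_left

/-- **Liouville's theorem**: the flow of a divergence-free field preserves the area. -/
theorem measurePreserving (h : IsFlow Ω q M φ) (hT : IsTangentField Ω q M)
    (hdiv : ∀ z ∈ Ω, divergence q z = 0) (t : ℝ) :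
    MeasurePreserving (φ t) (volume.restrict Ω) (volume.restrict Ω) := by
  have hw : ∀ (u : Plane → ℝ) (C : ℝ≥0), LipschitzWith C u → HasCompactSupport u →
      tsupport u ⊆ Ω → ∫ z in Ω, 1 * fderiv ℝ u z (q z) = 0 := fun u C hu hc hs =>
    hT.integral_mul_fderiv_eq_zero hdiv (hasWeakGradient_one Ω) (fun K hK => by
      have : volume (Ω ∩ K) < ⊤ := (measure_mono inter_subset_right).trans_lt hK.measure_lt_top
      exact integrableOn_const this.ne) (fun K _ => integrableOn_zero)
      (Eventually.of_forall fun z => inner_zero_right _) hu hc hs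
  refine ⟨h.measurable t, le_antisymm (h.map_restrict_le hw t) ?_⟩
  refine Measure.le_iff.2 fun A hA => ?_
  rw [Measure.map_apply (h.measurable t) hA]
  have := Measure.le_iff.1 (h.map_restrict_le hw (-t)) _ (h.measurable t hA)
  rw [Measure.map_apply (h.measurable _) (h.measurable t hA)] at this
  convert this using 2
  ext z
  simp [h.apply_neg]

/-- A function with weak gradient orthogonal to `q` is invariant under the flow. -/
theorem ae_comp_eq (h : IsFlow Ω q M φ) (hT : IsTangentField Ω q M)
    (hdiv : ∀ z ∈ Ω, divergence q z = 0) {w : Plane → ℝ} {G : Plane → Plane}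
    (hwG : HasWeakGradient Ω w G) (hw : ∀ K, IsCompact K → IntegrableOn w (Ω ∩ K))
    (hG : ∀ K, IsCompact K → IntegrableOn G (Ω ∩ K))
    (hqG : ∀ᵐ z ∂(volume.restrict Ω), ⟪q z, G z⟫_ℝ = 0) (t : ℝ) :
    ∀ᵐ z ∂(volume.restrict Ω), w (φ t z) = w z := by
  have hmp := h.measurePreserving hT hdiv t
  have hwΩ : LocallyIntegrableOn w Ω := by
    rw [locallyIntegrableOn_iff h.isOpen.isLocallyClosed]
    intro K hKΩ hK
    have := hw K hK
    rwa [inter_eq_self_of_subset_right hKΩ] at this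
  have hwφ : LocallyIntegrableOn (fun z => w (φ t z)) Ω := by
    rw [locallyIntegrableOn_iff h.isOpen.isLocallyClosed]
    intro K hKΩ hK
    have hK' : IsCompact (φ t '' K) :=
      hK.image_of_continuousOn fun z hz => (h.continuousAt t (hKΩ hz)).continuousWithinAt
    have h1 := hw _ hK'
    have h2 : φ t ⁻¹' (Ω ∩ φ t '' K) = K := by
      ext z
      simp only [mem_preimage, mem_inter_iff, h.mem_iff,
        (h.measurableEmbedding t).injective.mem_set_image]
      exact ⟨fun hz => hz.2, fun hz => ⟨hKΩ hz, hz⟩⟩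
    have h3 := hmp.integrableOn_comp_preimage (f := w) (s := Ω ∩ φ t '' K) (h.measurableEmbedding t)
    rw [h2] at h3
    have h4 : IntegrableOn w (Ω ∩ φ t '' K) (volume.restrict Ω) :=
      IntegrableOn.restrict h1
    have h5 := h3.2 h4
    rwa [IntegrableOn, Measure.restrict_restrict hK.isClosed.measurableSet,
      inter_eq_self_of_subset_left hKΩ] at h5
  have hz := h.isOpen.ae_eq_zero_of_integral_contDiff_smul_eq_zero (hwφ.sub hwΩ) ?_
  · rw [ae_restrict_iff' h.isOpen.measurableSet]
    filter_upwards [hz] with z hz hzΩ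
    exact sub_eq_zero.1 (hz hzΩ)
  · intro g hg hc hs
    have hgi : ∀ v : Plane → ℝ, LocallyIntegrableOn v Ω →
        Integrable (fun z => g z * v z) (volume.restrict Ω) := by
      intro v hv
      obtain ⟨B, hB⟩ := hc.exists_bound_of_continuous hg.continuous
      have h1 : IntegrableOn v (tsupport g) :=
        (locallyIntegrableOn_iff h.isOpen.isLocallyClosed).1 hv _ hs hc
      have h2 : IntegrableOn (fun z => g z * v z) (tsupport g) :=
        Integrable.bdd_mul h1 hg.continuous.aestronglyMeasurable (Eventually.of_forall hB)
      refine Integrable.restrict ((integrableOn_iff_integrable_of_support_subset fun z hz => ?_).1 h2)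
      by_contra hz'
      exact hz (by simp only [image_eq_zero_of_notMem_tsupport hz', zero_mul])
    rw [← setIntegral_eq_integral_of_forall_compl_eq_zero (s := Ω)]
    · simp only [Pi.sub_apply, smul_eq_mul, mul_sub]
      rw [integral_sub (hgi _ hwφ) (hgi _ hwΩ), sub_eq_zero]
      have e1 : ∫ z in Ω, g z * w (φ t z) = ∫ z in Ω, w z * g (φ (-t) z) := by
        rw [← hmp.integral_comp (h.measurableEmbedding t) (fun z => w z * g (φ (-t) z))]
        refine integral_congr_ae (Eventually.of_forall fun z => ?_)
        simp only [h.neg_apply]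
        ring
      rw [e1, h.integral_mul_comp_eq hw (fun u C hu hc hs =>
        hT.integral_mul_fderiv_eq_zero hdiv hwG hw hG hqG hu hc hs) hg hc hs]
      exact integral_congr_ae (Eventually.of_forall fun z => mul_comm _ _)
    · intro z hz
      rw [image_eq_zero_of_notMem_tsupport fun h => hz (hs h), zero_smul]

end IsFlow

end

/-! ### The lattice of periods and the periodicity cell -/

section

variable {d : ℕ} {L : Fin 2 → ℝ} {Ω : Set Plane} {q : Plane → Plane} {M : ℝ≥0}
  {φ : ℝ → Plane → Plane}

/-- The periods as an additive group acting on the plane by translations. -/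
def latticeSubgroup (d : ℕ) (L : Fin 2 → ℝ) : AddSubgroup Plane where
  carrier := periodLattice d L
  add_mem' {a b} ha hb i := by
    refine ⟨fun hi => ?_, fun hi => ?_⟩
    · obtain ⟨m, hm⟩ := (ha i).1 hi
      obtain ⟨n, hn⟩ := (hb i).1 hi
      exact ⟨m + n, by rw [PiLp.add_apply, hm, hn]; push_cast; ring⟩
    · rw [PiLp.add_apply, (ha i).2 hi, (hb i).2 hi, add_zero]
  zero_mem' i := ⟨fun _ => ⟨0, by simp⟩, fun _ => rfl⟩
  neg_mem' {a} ha i := by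
    refine ⟨fun hi => ?_, fun hi => ?_⟩
    · obtain ⟨m, hm⟩ := (ha i).1 hi
      exact ⟨-m, by rw [PiLp.neg_apply, hm]; push_cast; ring⟩
    · rw [PiLp.neg_apply, (ha i).2 hi, neg_zero]

instance : Countable (latticeSubgroup d L) := by
  have : (periodLattice d L).Countable := by
    refine (countable_range fun m : Fin 2 → ℤ => (WithLp.toLp 2 fun i : Fin 2 =>
      if i.val < d then (m i : ℝ) * L i else 0 : Plane)).mono fun k hk => ?_
    choose! m hm using fun i => (hk i).1
    refine ⟨m, ?_⟩
    ext i
    by_cases hi : i.val < d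
    · simp [hi, hm i hi]
    · simp [hi, (hk i).2 (not_lt.1 hi)]
  exact this.to_subtype

/-- An open set that is invariant under the translations by the lattice of periods. -/
structure IsPeriodicOpen (d : ℕ) (L : Fin 2 → ℝ) (Ω : Set Plane) : Prop where
  pos : ∀ i : Fin 2, i.val < d → 0 < L i
  isOpen : IsOpen Ω
  add_mem_iff : ∀ k ∈ periodLattice d L, ∀ z, z + k ∈ Ω ↔ z ∈ Ω

lemma ae_coord_ne (i : Fin 2) (c : ℝ) : ∀ᵐ z : Plane, z i ≠ c :=
  (PiLp.volume_preserving_ofLp (Fin 2)).quasiMeasurePreserving.ae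
    (Measure.ae_eval_ne (μ := fun _ : Fin 2 => (volume : Measure ℝ)) i c)

lemma periodCell_subset : periodCell d L Ω ⊆ Ω := fun _ hz => hz.1

lemma restrict_periodCell :
    (volume.restrict Ω).restrict (periodCell d L Ω) = volume.restrict (periodCell d L Ω) :=
  Measure.restrict_restrict_of_subset periodCell_subset

namespace IsPeriodicOpen

lemma isOpen_periodCell (h : IsPeriodicOpen d L Ω) : IsOpen (periodCell d L Ω) := by
  have : periodCell d L Ω = Ω ∩ ⋂ i : Fin 2, {z : Plane | i.val < d → 0 < z i ∧ z i < L i} :=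
    ext fun z => and_congr_right fun _ => by rw [mem_iInter]; rfl
  rw [this]
  refine h.isOpen.inter (isOpen_iInter_of_finite fun i => ?_)
  by_cases hi : i.val < d
  · have hc : Continuous fun z : Plane => z i := by fun_prop
    simp only [hi, true_imp_iff]
    exact (isOpen_lt continuous_const hc).inter (isOpen_lt hc continuous_const)
  · simp [hi]

lemma vadd_mem_iff (h : IsPeriodicOpen d L Ω) (k : latticeSubgroup d L) (z : Plane) :
    k +ᵥ z ∈ Ω ↔ z ∈ Ω := by
  rw [AddSubgroup.vadd_def, vadd_eq_add, add_comm]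
  exact h.add_mem_iff k k.2 z

lemma vaddInvariantMeasure (h : IsPeriodicOpen d L Ω) :
    VAddInvariantMeasure (latticeSubgroup d L) Plane (volume.restrict Ω) := by
  refine ⟨fun k s hs => ?_⟩
  have hm : Measurable fun z : Plane => k +ᵥ z := measurable_const_vadd k
  rw [Measure.restrict_apply (hm hs), Measure.restrict_apply hs]
  have : (fun z : Plane => k +ᵥ z) ⁻¹' s ∩ Ω = (fun z : Plane => (k : Plane) + z) ⁻¹' (s ∩ Ω) := by
    ext z
    simp only [mem_inter_iff, mem_preimage]
    rw [← vadd_eq_add, ← AddSubgroup.vadd_def, h.vadd_mem_iff]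
  rw [this, measure_preimage_add]

/-- The periodicity cell is a fundamental domain for the action of the periods on `Ω`. -/
lemma isAddFundamentalDomain (h : IsPeriodicOpen d L Ω) :
    IsAddFundamentalDomain (latticeSubgroup d L) (periodCell d L Ω) (volume.restrict Ω) := by
  refine ⟨h.isOpen_periodCell.measurableSet.nullMeasurableSet, ?_, ?_⟩
  · have hne : ∀ᵐ z ∂(volume.restrict Ω), ∀ i : Fin 2, ∀ m : ℤ, z i ≠ m * L i :=
      ae_all_iff.2 fun i => ae_all_iff.2 fun m => ae_restrict_of_ae (ae_coord_ne i _)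
    filter_upwards [hne, ae_restrict_mem h.isOpen.measurableSet] with z hz hzΩ
    let k : Plane := WithLp.toLp 2 fun i : Fin 2 =>
      if i.val < d then ((-⌊z i / L i⌋ : ℤ) : ℝ) * L i else 0
    have hk : k ∈ latticeSubgroup d L := fun i =>
      ⟨fun hi => ⟨-⌊z i / L i⌋, by simp [k, hi]⟩, fun hi => by simp [k, not_lt.2 hi]⟩
    refine ⟨⟨k, hk⟩, (h.vadd_mem_iff ⟨k, hk⟩ z).2 hzΩ, fun i hi => ?_⟩
    have hL := h.pos i hi
    have e : ((⟨k, hk⟩ : latticeSubgroup d L) +ᵥ z) i = z i - ⌊z i / L i⌋ * L i := by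
      rw [AddSubgroup.vadd_def, vadd_eq_add, PiLp.add_apply]
      simp only [k, hi, if_true]
      push_cast
      ring
    rw [e]
    have h1 : (⌊z i / L i⌋ : ℝ) * L i ≤ z i := (le_div_iff₀ hL).1 (Int.floor_le _)
    have h2 : z i < (⌊z i / L i⌋ + 1) * L i := (div_lt_iff₀ hL).1 (Int.lt_floor_add_one _)
    exact ⟨sub_pos.2 (lt_of_le_of_ne h1 (hz i _).symm), by linarith⟩
  · intro a b hab
    refine Disjoint.aedisjoint (disjoint_left.2 fun z hza hzb => hab ?_)
    obtain ⟨x, hx, rfl⟩ := hza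
    obtain ⟨y, hy, hxy⟩ := hzb
    apply Subtype.ext
    ext i
    by_cases hi : i.val < d
    · have hL := h.pos i hi
      obtain ⟨m, hm⟩ := (a.2 i).1 hi
      obtain ⟨n, hn⟩ := (b.2 i).1 hi
      have e : (b : Plane) i + y i = (a : Plane) i + x i := by
        have := congrArg (fun v : Plane => v i) hxy
        simpa [AddSubgroup.vadd_def] using this
      have hx' := hx.2 i hi
      have hy' := hy.2 i hi
      rw [hm, hn] at e
      rw [hm, hn]
      have h1 : ((n : ℝ) - m) * L i < 1 * L i := by nlinarith
      have h2 : (-1 : ℝ) * L i < ((n : ℝ) - m) * L i := by nlinarith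
      have h3 := lt_of_mul_lt_mul_right h1 hL.le
      have h4 := lt_of_mul_lt_mul_right h2 hL.le
      have h5 : n - m < 1 := by exact_mod_cast h3
      have h6 : -1 < n - m := by exact_mod_cast h4
      have : n = m := by omega
      rw [this]
    · rw [(a.2 i).2 (not_lt.1 hi), (b.2 i).2 (not_lt.1 hi)]

lemma isAddFundamentalDomain_preimage (h : IsPeriodicOpen d L Ω) {f : Plane → Plane}
    (hf : MeasurePreserving f (volume.restrict Ω) (volume.restrict Ω))
    (hfk : ∀ k ∈ periodLattice d L, ∀ z, f (z + k) = f z + k) :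
    IsAddFundamentalDomain (latticeSubgroup d L) (f ⁻¹' periodCell d L Ω) (volume.restrict Ω) :=
  h.isAddFundamentalDomain.preimage_of_equiv hf.quasiMeasurePreserving (e := id)
    Function.bijective_id fun k z => by
      simp only [id, AddSubgroup.vadd_def, vadd_eq_add]
      rw [add_comm, hfk k k.2, add_comm]

/-- A periodic function has the same integral over the cell before and after composition with an
area-preserving bijection of `Ω` that commutes with the periods. -/
lemma setIntegral_comp (h : IsPeriodicOpen d L Ω) {E : Type*} [NormedAddCommGroup E]
    [NormedSpace ℝ E] {f g : Plane → Plane} (hfg : Function.LeftInverse g f)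
    (hfe : MeasurableEmbedding f)
    (hf : MeasurePreserving f (volume.restrict Ω) (volume.restrict Ω))
    (hg : MeasurePreserving g (volume.restrict Ω) (volume.restrict Ω))
    (hgk : ∀ k ∈ periodLattice d L, ∀ z, g (z + k) = g z + k)
    {F : Plane → E} (hF : ∀ k ∈ periodLattice d L, ∀ z, F (z + k) = F z) :
    ∫ z in periodCell d L Ω, F (f z) = ∫ z in periodCell d L Ω, F z := by
  have := h.vaddInvariantMeasure
  have h1 : f ⁻¹' (g ⁻¹' periodCell d L Ω) = periodCell d L Ω := by
    ext z; simp [hfg z]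
  rw [← restrict_periodCell]
  conv_lhs => rw [← h1]
  rw [hf.setIntegral_preimage_emb hfe]
  refine (h.isAddFundamentalDomain_preimage hg hgk).setIntegral_eq h.isAddFundamentalDomain
    fun k z => ?_
  rw [AddSubgroup.vadd_def, vadd_eq_add, add_comm]
  exact hF k k.2 z

lemma measure_preimage_inter (h : IsPeriodicOpen d L Ω) {f g : Plane → Plane}
    (hfg : Function.LeftInverse g f)
    (hf : MeasurePreserving f (volume.restrict Ω) (volume.restrict Ω))
    (hg : MeasurePreserving g (volume.restrict Ω) (volume.restrict Ω))
    (hgk : ∀ k ∈ periodLattice d L, ∀ z, g (z + k) = g z + k)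
    {A : Set Plane} (hA : MeasurableSet A) (hAk : ∀ k ∈ periodLattice d L, ∀ z, z + k ∈ A ↔ z ∈ A) :
    volume.restrict Ω (f ⁻¹' A ∩ periodCell d L Ω) = volume.restrict Ω (A ∩ periodCell d L Ω) := by
  have := h.vaddInvariantMeasure
  have h1 : f ⁻¹' A ∩ periodCell d L Ω = f ⁻¹' (A ∩ g ⁻¹' periodCell d L Ω) := by
    ext z; simp [hfg z]
  rw [h1, hf.measure_preimage ((hA.nullMeasurableSet).inter
    (h.isAddFundamentalDomain_preimage hg hgk).nullMeasurableSet)]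
  refine (h.isAddFundamentalDomain_preimage hg hgk).measure_set_eq h.isAddFundamentalDomain hA
    fun k => ?_
  ext z
  rw [mem_preimage, AddSubgroup.vadd_def, vadd_eq_add, add_comm]
  exact hAk k k.2 z

end IsPeriodicOpen

end

/-! ### Rotation vectors -/

section

variable {d : ℕ} {L : Fin 2 → ℝ} {Ω : Set Plane} {q : Plane → Plane} {M : ℝ≥0}
  {φ : ℝ → Plane → Plane}

/-- An area-preserving flow that commutes with the translations by the periods, in a domain which
is bounded in the directions that are not periodic. -/
structure IsPeriodicFlow (d : ℕ) (L : Fin 2 → ℝ) (Ω : Set Plane) (q : Plane → Plane) (M : ℝ≥0)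
    (φ : ℝ → Plane → Plane) : Prop where
  isFlow : IsFlow Ω q M φ
  isPeriodicOpen : IsPeriodicOpen d L Ω
  bounded : ∃ R : ℝ, ∀ z ∈ Ω, ∀ i : Fin 2, d ≤ i.val → |z i| ≤ R
  field_add : ∀ k ∈ periodLattice d L, ∀ z ∈ Ω, q (z + k) = q z
  apply_add : ∀ k ∈ periodLattice d L, ∀ t z, φ t (z + k) = φ t z + k
  measurePreserving : ∀ t, MeasurePreserving (φ t) (volume.restrict Ω) (volume.restrict Ω)

lemma isBounded_of_coord {S : Set Plane} {R : ℝ} (h : ∀ z ∈ S, ∀ i, |z i| ≤ R) :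
    Bornology.IsBounded S := by
  refine (isBounded_iff_forall_norm_le).2 ⟨R + R, fun z hz => ?_⟩
  have h0 := h z hz 0
  have h1 := h z hz 1
  rw [EuclideanSpace.norm_eq, Fin.sum_univ_two]
  refine Real.sqrt_le_iff.2 ⟨by linarith [abs_nonneg (z 0), abs_nonneg (z 1)], ?_⟩
  rw [Real.norm_eq_abs, Real.norm_eq_abs]
  nlinarith [abs_nonneg (z 0), abs_nonneg (z 1)]

lemma isBounded_periodCell {R : ℝ} (hR : ∀ z ∈ Ω, ∀ i : Fin 2, d ≤ i.val → |z i| ≤ R) :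
    Bornology.IsBounded (periodCell d L Ω) := by
  refine isBounded_of_coord (R := max R (max |L 0| |L 1|)) fun z hz i => ?_
  by_cases hi : i.val < d
  · have h1 := hz.2 i hi
    have : |L i| ≤ max |L 0| |L 1| := by
      fin_cases i
      · exact le_max_left _ _
      · exact le_max_right _ _
    rw [abs_of_pos h1.1]
    exact (h1.2.le.trans (le_abs_self _)).trans (this.trans (le_max_right _ _))
  · exact (hR z hz.1 i (not_lt.1 hi)).trans (le_max_left _ _)

lemma IsFlow.apply_int_mul (h : IsFlow Ω q M φ) {z k : Plane} {τ : ℝ}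
    (hk : ∀ t z, φ t (z + k) = φ t z + k) (hz : φ τ z = z + k) (m : ℤ) :
    φ (m * τ) z = z + (m : ℝ) • k := by
  have hk' : ∀ (m : ℕ) (t : ℝ) (z : Plane), φ t (z + (m : ℝ) • k) = φ t z + (m : ℝ) • k := by
    intro m t z
    induction m with
    | zero => simp
    | succ m ih =>
      push_cast
      rw [add_smul, one_smul, ← add_assoc, hk, ih, add_assoc]
  have hm : ∀ m : ℕ, φ (m * τ) z = z + (m : ℝ) • k := by
    intro m
    induction m with
    | zero => simp [h.zero]
    | succ m ih =>
      push_cast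
      rw [add_mul, one_mul, add_comm ((m : ℝ) * τ), h.add, ih, hk', hz, add_smul, one_smul]
      abel
  obtain ⟨n, rfl | rfl⟩ := m.eq_nat_or_neg
  · exact_mod_cast hm n
  · push_cast
    have := h.neg_apply (n * τ) z
    rw [hm, hk', ← eq_sub_iff_add_eq] at this
    rw [neg_mul, this, neg_smul, sub_eq_add_neg]

/-- An orbit that is closed up to the translation `k` has the rotation vector `τ⁻¹ • k`. -/
lemma IsFlow.tendsto_of_apply_eq_add (h : IsFlow Ω q M φ) {z k : Plane} {τ : ℝ} (hτ : 0 < τ)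
    (hk : ∀ t z, φ t (z + k) = φ t z + k) (hz : φ τ z = z + k) :
    Tendsto (fun n : ℕ => (n : ℝ)⁻¹ • (φ n z - z)) atTop (𝓝 (τ⁻¹ • k)) := by
  have hm : ∀ m : ℕ, φ (m * τ) z = z + (m : ℝ) • k := fun m => by
    exact_mod_cast h.apply_int_mul hk hz m
  have hb : ∀ n : ℕ, 0 < n →
      ‖(n : ℝ)⁻¹ • (φ n z - z) - τ⁻¹ • k‖ ≤ (M * τ + ‖k‖) * (n : ℝ)⁻¹ := by
    intro n hn
    have hn' : (0 : ℝ) < n := by exact_mod_cast hn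
    set m := ⌊(n : ℝ) / τ⌋₊
    have h1 : (m : ℝ) ≤ n / τ := Nat.floor_le (by positivity)
    have h2 : (n : ℝ) / τ < m + 1 := Nat.lt_floor_add_one _
    have e : (n : ℝ)⁻¹ • (φ n z - z) - τ⁻¹ • k =
        (n : ℝ)⁻¹ • ((φ n z - φ (m * τ) z) + ((m : ℝ) - n / τ) • k) := by
      rw [hm]
      have : τ⁻¹ • k = (n : ℝ)⁻¹ • ((n / τ) • k) := by
        rw [smul_smul]; congr 1; field_simp
      rw [this, ← smul_sub]
      congr 1
      rw [sub_smul]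
      abel
    have h3 : |(m : ℝ) - n / τ| ≤ 1 := abs_le.2 ⟨by linarith, by linarith⟩
    have h4 : |(n : ℝ) - m * τ| ≤ τ := by
      rw [le_div_iff₀ hτ] at h1
      rw [div_lt_iff₀ hτ] at h2
      exact abs_le.2 ⟨by linarith, by linarith⟩
    rw [e, norm_smul, norm_inv, Real.norm_eq_abs, abs_of_pos hn', mul_comm]
    refine mul_le_mul_of_nonneg_right ((norm_add_le _ _).trans (add_le_add ?_ ?_)) (by positivity)
    · rw [← dist_eq_norm]
      exact (h.dist_le _ _ z).trans (by gcongr)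
    · rw [norm_smul, Real.norm_eq_abs]
      nlinarith [norm_nonneg k]
  rw [tendsto_iff_norm_sub_tendsto_zero]
  refine squeeze_zero' (Eventually.of_forall fun _ => norm_nonneg _)
    ((eventually_gt_atTop 0).mono hb) ?_
  simpa using (tendsto_inv_atTop_nhds_zero_nat (𝕜 := ℝ)).const_mul (M * τ + ‖k‖)

namespace IsPeriodicFlow

lemma volume_periodCell_lt_top (h : IsPeriodicFlow d L Ω q M φ) :
    volume (periodCell d L Ω) < ⊤ := by
  obtain ⟨R, hR⟩ := h.bounded
  exact (isBounded_periodCell hR).measure_lt_top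

/-- The integral of a periodic function over the cell is invariant under the flow. -/
lemma setIntegral_comp (h : IsPeriodicFlow d L Ω q M φ) {E : Type*} [NormedAddCommGroup E]
    [NormedSpace ℝ E] (t : ℝ) {F : Plane → E} (hF : ∀ k ∈ periodLattice d L, ∀ z, F (z + k) = F z) :
    ∫ z in periodCell d L Ω, F (φ t z) = ∫ z in periodCell d L Ω, F z :=
  h.isPeriodicOpen.setIntegral_comp (g := φ (-t)) (h.isFlow.neg_apply t)
    (h.isFlow.measurableEmbedding t) (h.measurePreserving t) (h.measurePreserving (-t))
    (fun k hk z => h.apply_add k hk _ z) hF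

variable {g : Plane → ℝ}

lemma integrableOn_smul_sub (h : IsPeriodicFlow d L Ω q M φ)
    (hg : IntegrableOn g (periodCell d L Ω)) (t : ℝ) :
    IntegrableOn (fun z => g z • (φ t z - z)) (periodCell d L Ω) := by
  refine Integrable.mono' (hg.norm.mul_const (M * |t|))
    (hg.aestronglyMeasurable.smul (((h.isFlow.measurable t).sub measurable_id).aestronglyMeasurable))
    (Eventually.of_forall fun z => ?_)
  rw [norm_smul]
  exact mul_le_mul_of_nonneg_left (h.isFlow.norm_sub_le t z) (norm_nonneg _)

/-- The mean displacement of the flow, for an invariant density, is additive in time. -/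
lemma setIntegral_smul_sub_add (h : IsPeriodicFlow d L Ω q M φ)
    (hgk : ∀ k ∈ periodLattice d L, ∀ z, g (z + k) = g z)
    (hg : IntegrableOn g (periodCell d L Ω))
    (hgφ : ∀ t, ∀ᵐ z ∂(volume.restrict Ω), g (φ t z) = g z) (s t : ℝ) :
    ∫ z in periodCell d L Ω, g z • (φ (s + t) z - z) =
      (∫ z in periodCell d L Ω, g z • (φ s z - z)) + ∫ z in periodCell d L Ω, g z • (φ t z - z) := by
  have hF : ∀ k ∈ periodLattice d L, ∀ z,
      (fun z => g z • (φ s z - z)) (z + k) = (fun z => g z • (φ s z - z)) z := by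
    intro k hk z
    simp only [hgk k hk z, h.apply_add k hk, add_sub_add_right_eq_sub]
  have hae : ∀ᵐ z ∂(volume.restrict (periodCell d L Ω)), g (φ t z) = g z :=
    ae_restrict_of_ae_restrict_of_subset periodCell_subset (hgφ t)
  have e : ∀ᵐ z ∂(volume.restrict (periodCell d L Ω)), g z • (φ (s + t) z - z) -
      g z • (φ t z - z) = g (φ t z) • (φ s (φ t z) - φ t z) := by
    filter_upwards [hae] with z hz
    rw [hz, h.isFlow.add, ← smul_sub, sub_sub_sub_cancel_right]
  rw [← h.setIntegral_comp t (F := fun z => g z • (φ s z - z)) hF, ← integral_congr_ae e,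
    integral_sub (h.integrableOn_smul_sub hg _) (h.integrableOn_smul_sub hg _), sub_add_cancel]

/-- The mean velocity for an invariant density `g` is the mean of the rotation vectors `v`: the mean
displacement `A` is additive in time, so that the limits of `A t / t` as `t → 0` and as `t → ∞`
coincide. The field `v` is only prescribed where `g` does not vanish. -/
theorem setIntegral_smul_field_eq (h : IsPeriodicFlow d L Ω q M φ)
    (hgk : ∀ k ∈ periodLattice d L, ∀ z, g (z + k) = g z)
    (hg : IntegrableOn g (periodCell d L Ω))
    (hgφ : ∀ t, ∀ᵐ z ∂(volume.restrict Ω), g (φ t z) = g z) {v : Plane → Plane}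
    (hv : ∀ᵐ z ∂(volume.restrict (periodCell d L Ω)), g z ≠ 0 →
      Tendsto (fun n : ℕ => (n : ℝ)⁻¹ • (φ n z - z)) atTop (𝓝 (v z))) :
    ∫ z in periodCell d L Ω, g z • q z = ∫ z in periodCell d L Ω, g z • v z := by
  let A : ℝ →+ Plane :=
    { toFun := fun t => ∫ z in periodCell d L Ω, g z • (φ t z - z)
      map_zero' := by simp [h.isFlow.zero]
      map_add' := h.setIntegral_smul_sub_add hgk hg hgφ }
  have hA : ∀ t, A t = ∫ z in periodCell d L Ω, g z • (φ t z - z) := fun _ => rfl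
  have hmeas : ∀ c t : ℝ, AEStronglyMeasurable (fun z => g z • c • (φ t z - z))
      (volume.restrict (periodCell d L Ω)) := fun c t =>
    hg.aestronglyMeasurable.smul
      ((((h.isFlow.measurable t).sub measurable_id).const_smul c).aestronglyMeasurable)
  have hdom : ∀ t : ℝ, ∀ z, ‖g z • t⁻¹ • (φ t z - z)‖ ≤ ‖g z‖ * M := by
    intro t z
    rw [norm_smul, norm_smul, norm_inv, Real.norm_eq_abs t]
    refine mul_le_mul_of_nonneg_left ?_ (norm_nonneg _)
    rcases eq_or_ne t 0 with rfl | ht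
    · simp
    · rw [inv_mul_le_iff₀ (abs_pos.2 ht), mul_comm]
      exact h.isFlow.norm_sub_le t z
  have hlim : ∀ (t : ℕ → ℝ) (u : Plane → Plane),
      (∀ᵐ z ∂(volume.restrict (periodCell d L Ω)), g z ≠ 0 →
        Tendsto (fun n => (t n)⁻¹ • (φ (t n) z - z)) atTop (𝓝 (u z))) →
      Tendsto (fun n => (t n)⁻¹ • A (t n)) atTop (𝓝 (∫ z in periodCell d L Ω, g z • u z)) := by
    intro t u hu
    have e : ∀ n, (t n)⁻¹ • A (t n) =
        ∫ z in periodCell d L Ω, g z • (t n)⁻¹ • (φ (t n) z - z) := by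
      intro n
      rw [hA, ← integral_smul]
      simp only [smul_comm (g _)]
    simp only [e]
    refine tendsto_integral_of_dominated_convergence (fun z => ‖g z‖ * M)
      (fun n => hmeas _ _) (hg.norm.mul_const _)
      (fun n => Eventually.of_forall (hdom (t n))) ?_
    filter_upwards [hu] with z hz
    by_cases h0 : g z = 0
    · simp [h0]
    · exact (hz h0).const_smul (g z)
  have h1 : ∀ n : ℕ, ((n + 1 : ℝ)) • A (1 / (n + 1 : ℝ)) = A 1 := by
    intro n
    have : (n + 1) • A (1 / (n + 1 : ℝ)) = A 1 := by
      rw [← map_nsmul, nsmul_eq_mul]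
      congr 1
      push_cast
      field_simp
    rw [← this, ← Nat.cast_smul_eq_nsmul ℝ]
    push_cast
    rfl
  have h2 : ∀ n : ℕ, 0 < n → (n : ℝ)⁻¹ • A n = A 1 := by
    intro n hn
    have : A (n : ℝ) = n • A 1 := by rw [← map_nsmul, nsmul_eq_mul, mul_one]
    rw [this, ← Nat.cast_smul_eq_nsmul ℝ, smul_smul, inv_mul_cancel₀ (by positivity), one_smul]
  have h3 : A 1 = ∫ z in periodCell d L Ω, g z • q z := by
    refine tendsto_nhds_unique (f := fun n : ℕ => (1 / (n + 1 : ℝ))⁻¹ • A (1 / (n + 1 : ℝ))) ?_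
      (hlim _ q ?_)
    · simp only [one_div, inv_inv] at h1 ⊢
      simp only [h1, tendsto_const_nhds_iff]
    · filter_upwards [ae_restrict_mem h.isPeriodicOpen.isOpen_periodCell.measurableSet]
        with z hz _
      have hd := h.isFlow.hasDerivAt (periodCell_subset hz) 0
      rw [h.isFlow.zero] at hd
      have := hd.tendsto_slope_zero.comp (g := _) (f := fun n : ℕ => 1 / ((n : ℝ) + 1))
        (tendsto_nhdsWithin_iff.2 ⟨tendsto_one_div_add_atTop_nhds_zero_nat,
          Eventually.of_forall fun n => by
            simp only [mem_compl_iff, mem_singleton_iff]; positivity⟩)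
      simpa [Function.comp_def, h.isFlow.zero] using this
  rw [← h3]
  refine tendsto_nhds_unique (f := fun n : ℕ => (n : ℝ)⁻¹ • A n) ?_ (hlim _ v hv)
  exact tendsto_const_nhds.congr' ((eventually_gt_atTop 0).mono fun n hn => (h2 n hn).symm)

end IsPeriodicFlow

end

/-! ### Stream functions -/

section

variable {d : ℕ} {L : Fin 2 → ℝ} {Ω : Set Plane} {q : Plane → Plane} {M : ℝ≥0}
  {φ : ℝ → Plane → Plane}

/-- A field `g q` with a bounded invariant density `g` is divergence free in the whole plane, when
it is extended by zero: the means of `ψ` transported by the flow do not depend on the time. -/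
lemma IsPeriodicFlow.integral_mul_fderiv_field_eq_zero (h : IsPeriodicFlow d L Ω q M φ)
    {g : Plane → ℝ} {B : ℝ}
    (hg : AEStronglyMeasurable g (volume.restrict Ω)) (hB : ∀ z ∈ Ω, |g z| ≤ B)
    (hgφ : ∀ t, ∀ z ∈ Ω, g (φ t z) = g z) {ψ : Plane → ℝ} (hψ : ContDiff ℝ 1 ψ)
    (hc : HasCompactSupport ψ) : ∫ z in Ω, g z * fderiv ℝ ψ z (q z) = 0 := by
  have hf := h.isFlow
  have hΩm := hf.isOpen.measurableSet
  obtain ⟨C, hC⟩ := hψ.lipschitzWith_of_hasCompactSupport hc one_ne_zero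
  have hB0 : ∀ z ∈ Ω, 0 ≤ B := fun z hz => (abs_nonneg _).trans (hB z hz)
  set S : Set Plane := cthickening M (tsupport ψ) with hS
  have hSc : IsCompact S := hc.isCompact.cthickening
  let t : ℕ → ℝ := fun n => 1 / ((n : ℝ) + 1)
  have ht : ∀ n, 0 < t n := fun n => by positivity
  have ht1 : ∀ n, t n ≤ 1 := fun n => by
    refine div_le_one_of_le₀ ?_ (by positivity); linarith [n.cast_nonneg (α := ℝ)]
  have hψint : ∀ s : ℝ, IntegrableOn (fun z => g z * ψ (φ s z)) Ω := by
    have h0 : IntegrableOn (fun z => g z * ψ z) Ω :=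
      (hψ.continuous.integrable_of_hasCompactSupport hc).integrableOn.bdd_mul hg
        ((ae_restrict_iff' hΩm).2 (Eventually.of_forall hB))
    intro s
    have := (h.measurePreserving s).integrable_comp_of_integrable h0
    refine this.congr ?_
    filter_upwards [ae_restrict_mem hΩm] with z hz
    simp only [Function.comp_apply, hgφ s z hz]
  have hI : ∀ s : ℝ, ∫ z in Ω, g z * ψ (φ s z) = ∫ z in Ω, g z * ψ z := by
    intro s
    rw [← (h.measurePreserving s).integral_comp (hf.measurableEmbedding s) fun z => g z * ψ z]
    refine setIntegral_congr_fun hΩm fun z hz => ?_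
    simp only [hgφ s z hz]
  have hlim : Tendsto (fun n => ∫ z in Ω, g z * ((t n)⁻¹ * (ψ (φ (t n) z) - ψ z))) atTop
      (𝓝 (∫ z in Ω, g z * fderiv ℝ ψ z (q z))) := by
    refine tendsto_integral_of_dominated_convergence (S.indicator fun _ => B * (C * M)) ?_ ?_ ?_ ?_
    · intro n
      refine hg.mul (Measurable.aestronglyMeasurable ?_)
      exact ((hψ.continuous.measurable.comp (hf.measurable _)).sub
        hψ.continuous.measurable).const_mul _
    · exact ((integrableOn_const (hs := hSc.measure_lt_top.ne)).integrable_indicator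
        hSc.isClosed.measurableSet).integrableOn
    · intro n
      filter_upwards [ae_restrict_mem hΩm] with z hz
      have hd := hf.norm_sub_le (t n) z
      rw [abs_of_pos (ht n)] at hd
      by_cases hzS : z ∈ S
      · rw [indicator_of_mem hzS, norm_mul, norm_mul, norm_inv, Real.norm_eq_abs (t n),
          abs_of_pos (ht n)]
        refine mul_le_mul (hB z hz) ?_ (by positivity) (hB0 z hz)
        rw [inv_mul_le_iff₀ (ht n), ← dist_eq_norm]
        refine (hC.dist_le_mul _ _).trans ?_
        rw [dist_eq_norm]
        calc C * ‖φ (t n) z - z‖ ≤ C * (M * t n) := by gcongr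
          _ = t n * (C * M) := by ring
      · have h0 : ∀ y, dist z y ≤ M → ψ y = 0 := by
          intro y hy
          by_contra hne
          exact hzS (mem_cthickening_of_dist_le z y _ _ (subset_tsupport ψ hne) hy)
        have e1 : ψ z = 0 := h0 z (by rw [dist_self]; exact M.2)
        have e2 : ψ (φ (t n) z) = 0 := h0 _ (by
          rw [dist_comm, dist_eq_norm]
          exact hd.trans (mul_le_of_le_one_right M.2 (ht1 n)))
        rw [indicator_of_notMem hzS, e1, e2]
        simp
    · filter_upwards [ae_restrict_mem hΩm] with z hz
      have hd := hf.hasDerivAt hz 0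
      have h2 : HasDerivAt (fun s => ψ (φ s z)) (fderiv ℝ ψ z (q z)) 0 := by
        have h3 : HasFDerivAt ψ (fderiv ℝ ψ z) (φ 0 z) := by
          rw [hf.zero]; exact (hψ.differentiable one_ne_zero z).hasFDerivAt
        have := h3.comp_hasDerivAt (0 : ℝ) hd
        rwa [hf.zero] at this
      have := h2.tendsto_slope_zero.comp (f := t)
        (tendsto_nhdsWithin_iff.2 ⟨tendsto_one_div_add_atTop_nhds_zero_nat,
          Eventually.of_forall fun n => (ht n).ne'⟩)
      simp only [Function.comp_def, zero_add, hf.zero, smul_eq_mul] at this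
      exact this.const_mul _
  refine tendsto_nhds_unique hlim ?_
  have e : ∀ n, ∫ z in Ω, g z * ((t n)⁻¹ * (ψ (φ (t n) z) - ψ z)) = 0 := by
    intro n
    have e1 : ∀ z, g z * ((t n)⁻¹ * (ψ (φ (t n) z) - ψ z)) =
        (t n)⁻¹ * (g z * ψ (φ (t n) z) - g z * ψ z) := fun z => by ring
    have h0 := hψint 0
    simp only [hf.zero] at h0
    simp only [e1]
    rw [integral_const_mul, integral_sub (hψint _) h0, hI, sub_self, mul_zero]
  simp only [e]
  exact tendsto_const_nhds

/-- The linear form `v ↦ p₀ v₁ - p₁ v₀`, whose kernel is spanned by `p` if `p ≠ 0`. -/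
noncomputable def crossForm (p : Plane) : Plane →L[ℝ] ℝ :=
  p 0 • EuclideanSpace.proj (𝕜 := ℝ) (1 : Fin 2) - p 1 • EuclideanSpace.proj (𝕜 := ℝ) (0 : Fin 2)

lemma crossForm_apply (p v : Plane) : crossForm p v = p 0 * v 1 - p 1 * v 0 := by
  simp [crossForm]

lemma crossForm_sub (p p' : Plane) : crossForm p - crossForm p' = crossForm (p - p') := by
  ext v; simp [crossForm_apply]; ring

lemma norm_crossForm_le (p : Plane) : ‖crossForm p‖ ≤ ‖p‖ := by
  refine ContinuousLinearMap.opNorm_le_bound _ (norm_nonneg _) fun v => ?_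
  rw [crossForm_apply, Real.norm_eq_abs]
  refine abs_le_of_sq_le_sq ?_ (by positivity)
  rw [mul_pow, EuclideanSpace.norm_sq_eq, EuclideanSpace.norm_sq_eq]
  simp only [Fin.sum_univ_two, Real.norm_eq_abs, sq_abs]
  nlinarith [sq_nonneg (p 0 * v 0 + p 1 * v 1)]

/-- The mollification of a field that is divergence free in the sense of distributions is
divergence free. -/
lemma divergence_mollify {p : Plane → Plane} (hp : LocallyIntegrable p)
    (hdiv : ∀ ψ : Plane → ℝ, ContDiff ℝ 1 ψ → HasCompactSupport ψ → ∫ z, fderiv ℝ ψ z (p z) = 0)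
    (n : ℕ) (x : Plane) : divergence (mollify n p) x = 0 := by
  set ρ : Plane → ℝ := (mollifier n).normed volume with hρ
  have hρc : HasCompactSupport ρ := (mollifier n).hasCompactSupport_normed
  have hρs : ContDiff ℝ 1 ρ := (mollifier n).contDiff_normed
  have hd := hρc.hasFDerivAt_convolution_left (ContinuousLinearMap.lsmul ℝ ℝ) hρs hp x
  have hex : ConvolutionExistsAt (fderiv ℝ ρ) p x
      ((ContinuousLinearMap.lsmul ℝ ℝ).precompL Plane) volume :=
    (hρc.fderiv ℝ).convolutionExists_left _ (hρs.continuous_fderiv one_ne_zero) hp x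
  have hint : Integrable fun t => ((ContinuousLinearMap.lsmul ℝ ℝ).precompL Plane
    (fderiv ℝ ρ t)) (p (x - t)) := hex
  have e : ∀ t, ∑ i, (((ContinuousLinearMap.lsmul ℝ ℝ).precompL Plane
      (fderiv ℝ ρ t)) (p (x - t))) (stdVec i) i = fderiv ℝ ρ t (p (x - t)) := by
    intro t
    rw [clm_apply_eq_sum]
    simp [ContinuousLinearMap.precompL_apply, mul_comm]
  have h1 : divergence (mollify n p) x = ∫ t, fderiv ℝ ρ t (p (x - t)) := by
    have e2 : ∀ i : Fin 2, (fderiv ℝ (mollify n p) x) (stdVec i) i =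
        ∫ t, (((ContinuousLinearMap.lsmul ℝ ℝ).precompL Plane
          (fderiv ℝ ρ t)) (p (x - t))) (stdVec i) i := by
      intro i
      rw [mollify, hd.fderiv, convolution_def, ContinuousLinearMap.integral_apply hint]
      exact ((EuclideanSpace.proj (𝕜 := ℝ) i).integral_comp_comm
        (hint.apply_continuousLinearMap _)).symm
    rw [divergence, Finset.sum_congr rfl fun i _ => e2 i, ← integral_finsetSum]
    · simp only [e]
    · intro i _
      exact (EuclideanSpace.proj (𝕜 := ℝ) i).integrable_comp (hint.apply_continuousLinearMap _)
  rw [h1, ← integral_sub_left_eq_self _ volume x]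
  simp only [sub_sub_cancel]
  have h2 := hdiv (fun t => ρ (x - t)) (hρs.comp (contDiff_const.sub contDiff_id))
    (hρc.comp_homeomorph (Homeomorph.subLeft x))
  have e3 : ∀ t, fderiv ℝ (fun t => ρ (x - t)) t (p t) = -fderiv ℝ ρ (x - t) (p t) := by
    intro t
    have := ((hρs.differentiable one_ne_zero (x - t)).hasFDerivAt.comp t
      ((hasFDerivAt_id t).const_sub x)).fderiv
    rw [Function.comp_def] at this
    rw [this]
    simp
  simp only [e3, integral_neg, neg_eq_zero] at h2
  exact h2

end

section

variable {d : ℕ} {L : Fin 2 → ℝ} {Ω : Set Plane} {q : Plane → Plane} {M : ℝ≥0}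
  {φ : ℝ → Plane → Plane}

/-- A smooth divergence free field is the rotated gradient of a function. -/
lemma exists_hasFDerivAt_crossForm {p : Plane → Plane} (hp : Differentiable ℝ p)
    (hdiv : ∀ z, divergence p z = 0) :
    ∃ H : Plane → ℝ, H 0 = 0 ∧ ∀ z, HasFDerivAt H (crossForm (p z)) z := by
  have hω : ∀ z, HasFDerivAt (fun z => crossForm (p z))
      ((((EuclideanSpace.proj (𝕜 := ℝ) (0 : Fin 2)).comp (fderiv ℝ p z)).smulRight
        (EuclideanSpace.proj (𝕜 := ℝ) (1 : Fin 2))) -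
       (((EuclideanSpace.proj (𝕜 := ℝ) (1 : Fin 2)).comp (fderiv ℝ p z)).smulRight
        (EuclideanSpace.proj (𝕜 := ℝ) (0 : Fin 2)))) z := by
    intro z
    have h0 := ((EuclideanSpace.proj (𝕜 := ℝ) (0 : Fin 2)).hasFDerivAt.comp z (hp z).hasFDerivAt)
    have h1 := ((EuclideanSpace.proj (𝕜 := ℝ) (1 : Fin 2)).hasFDerivAt.comp z (hp z).hasFDerivAt)
    exact (h0.smul_const (EuclideanSpace.proj (𝕜 := ℝ) (1 : Fin 2))).sub
      (h1.smul_const (EuclideanSpace.proj (𝕜 := ℝ) (0 : Fin 2)))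
  obtain ⟨H, hH⟩ := (convex_univ (𝕜 := ℝ) (E := Plane)).exists_forall_hasFDerivAt_of_fderiv_symmetric
    isOpen_univ (show DifferentiableOn ℝ (fun z => crossForm (p z)) univ from
      fun z _ => (hω z).differentiableAt.differentiableWithinAt) (fun a _ x y => by
      have hd := hdiv a
      have hx : ∀ v : Plane, fderiv ℝ p a v =
          v 0 • fderiv ℝ p a (stdVec 0) + v 1 • fderiv ℝ p a (stdVec 1) := by
        intro v
        rw [← map_smul, ← map_smul, ← map_add]
        congr 1
        ext i
        fin_cases i <;> simp [stdVec]
      rw [(hω a).fderiv]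
      simp only [divergence, Fin.sum_univ_two] at hd
      have hy : ∀ x y : Plane, (((EuclideanSpace.proj (𝕜 := ℝ) (0 : Fin 2)).comp
          (fderiv ℝ p a)).smulRight (EuclideanSpace.proj (𝕜 := ℝ) (1 : Fin 2)) -
          ((EuclideanSpace.proj (𝕜 := ℝ) (1 : Fin 2)).comp (fderiv ℝ p a)).smulRight
          (EuclideanSpace.proj (𝕜 := ℝ) (0 : Fin 2))) x y =
          fderiv ℝ p a x 0 * y 1 - fderiv ℝ p a x 1 * y 0 := fun _ _ => rfl
      rw [hy, hy, hx x, hx y]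
      simp only [PiLp.add_apply, PiLp.smul_apply, smul_eq_mul]
      linear_combination (x 0 * y 1 - x 1 * y 0) * hd)
  exact ⟨fun z => H z - H 0, sub_self _, fun z => (hH z trivial).sub_const _⟩

/-- A bounded field `p` that is divergence free in the sense of distributions has a Lipschitz
stream function, which is a limit of stream functions of the mollifications of `p`. The limit is
taken along an ultrafilter, so that no subsequence has to be extracted. -/
theorem exists_streamFunction {p : Plane → Plane} {A : ℝ≥0}
    (hpm : AEStronglyMeasurable p volume) (hpA : ∀ z, ‖p z‖ ≤ A)
    (hdiv : ∀ ψ : Plane → ℝ, ContDiff ℝ 1 ψ → HasCompactSupport ψ → ∫ z, fderiv ℝ ψ z (p z) = 0) :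
    ∃ (H : Plane → ℝ) (Hn : ℕ → Plane → ℝ),
      (∀ n z, HasFDerivAt (Hn n) (crossForm (mollify n p z)) z) ∧
      (∀ z, Tendsto (fun n => Hn n z) (hyperfilter ℕ) (𝓝 (H z))) ∧ LipschitzWith A H ∧
      ∀ z, ContinuousAt p z → HasFDerivAt H (crossForm (p z)) z := by
  have hloc : LocallyIntegrable p :=
    (memLp_top_of_bound hpm A (Eventually.of_forall hpA)).locallyIntegrable le_top
  choose Hn hHn0 hHn using fun n => exists_hasFDerivAt_crossForm
    ((contDiff_mollify hloc n).differentiable (by simp)) (divergence_mollify hloc hdiv n)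
  have hLip : ∀ n, LipschitzWith A (Hn n) := fun n =>
    lipschitzWith_of_nnnorm_fderiv_le (fun z => (hHn n z).differentiableAt) fun z => by
      rw [(hHn n z).fderiv]
      exact (norm_crossForm_le _).trans (norm_mollify_le hpA n z)
  have hex : ∀ z, ∃ x, Tendsto (fun n => Hn n z) (hyperfilter ℕ) (𝓝 x) := by
    intro z
    obtain ⟨x, -, hx⟩ := (isCompact_closedBall (0 : ℝ) (A * dist z 0)).ultrafilter_le_nhds
      ((hyperfilter ℕ).map fun n => Hn n z) (by
        refine tendsto_principal.2 (Eventually.of_forall fun n => ?_)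
        have := (hLip n).dist_le_mul z 0
        rwa [hHn0] at this)
    exact ⟨x, hx⟩
  choose H hH using hex
  refine ⟨H, Hn, hHn, hH, LipschitzWith.of_dist_le_mul fun x y =>
    le_of_tendsto ((hH x).dist (hH y)) (Eventually.of_forall fun n => (hLip n).dist_le_mul x y),
    fun z hz => ?_⟩
  refine HasFDerivAt.of_isLittleO (Asymptotics.isLittleO_iff.2 fun ε hε => ?_)
  have hε3 : 0 < ε / 3 := by positivity
  obtain ⟨δ, hδ, hδp⟩ := Metric.continuousAt_iff.1 hz (ε / 3) hε3
  have hn : ∀ᶠ n in (hyperfilter ℕ : Filter ℕ), (mollifier n).rOut < δ / 2 :=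
    Nat.hyperfilter_le_atTop (tendsto_mollifier_rOut.eventually (gt_mem_nhds (half_pos hδ)))
  filter_upwards [ball_mem_nhds z (half_pos hδ)] with y hy
  refine le_of_tendsto (((hH y).sub (hH z)).sub_const _).norm (hn.mono fun n hn => ?_)
  have hbound : ∀ x ∈ ball z (δ / 2), ‖crossForm (mollify n p x) - crossForm (p z)‖ ≤ ε := by
    intro x hx
    rw [mem_ball] at hx
    rw [crossForm_sub]
    refine (norm_crossForm_le _).trans ?_
    have h1 : dist (p x) (p z) < ε / 3 := hδp (hx.trans (half_lt_self hδ))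
    have h2 : dist (mollify n p x) (p x) ≤ ε / 3 + ε / 3 :=
      (mollifier n).dist_normed_convolution_le hpm fun w hw => by
        have h3 : dist (p w) (p z) < ε / 3 := hδp (by
          calc dist w z ≤ dist w x + dist x z := dist_triangle _ _ _
            _ < δ / 2 + δ / 2 := add_lt_add ((mem_ball.1 hw).trans hn) hx
            _ = δ := add_halves δ)
        exact (dist_triangle_right _ _ (p z)).trans (add_le_add h3.le h1.le)
    rw [← dist_eq_norm]
    linarith [dist_triangle (mollify n p x) (p x) (p z)]
  exact (convex_ball z (δ / 2)).norm_image_sub_le_of_norm_hasFDerivWithin_le'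
    (fun x _ => (hHn n x).hasFDerivWithinAt) hbound (mem_ball_self (half_pos hδ)) hy

lemma mollify_add {p : Plane → Plane} {k : Plane} (hp : ∀ z, p (z + k) = p z) (n : ℕ) (z : Plane) :
    mollify n p (z + k) = mollify n p z := by
  rw [mollify_apply, mollify_apply]
  congr 1
  ext1 t
  rw [add_sub_right_comm, hp]

/-- The increment over a period of the stream function of a periodic field does not depend on the
base point. -/
lemma sub_eq_of_hasFDerivAt_periodic {p : Plane → Plane} {H : Plane → ℝ} {k : Plane}
    (hH : ∀ z, HasFDerivAt H (crossForm (p z)) z) (hp : ∀ z, p (z + k) = p z) (z : Plane) :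
    H (z + k) - H z = H k - H 0 := by
  have hd : ∀ z, HasFDerivAt (fun z => H (z + k) - H z) (0 : Plane →L[ℝ] ℝ) z := by
    intro z
    have h1 : HasFDerivAt (fun z => H (z + k)) (crossForm (p (z + k))) z :=
      hasFDerivAt_comp_add_right k |>.2 (hH (z + k))
    have := h1.sub (hH z)
    rwa [hp, sub_self] at this
  have := is_const_of_fderiv_eq_zero (𝕜 := ℝ) (fun z => (hd z).differentiableAt)
    (fun z => (hd z).fderiv) z 0
  simpa using this

/-- The increment of the stream function of a doubly periodic field over a period is given by the
mean of the field. -/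
lemma sub_mul_volume_eq {p : Plane → Plane} {H : Plane → ℝ} (hL : ∀ i : Fin 2, i.val < d → 0 < L i)
    (hH : ∀ z, HasFDerivAt H (crossForm (p z)) z) (hpc : Continuous p) {A : ℝ}
    (hpA : ∀ z, ‖p z‖ ≤ A) (hp : ∀ k ∈ periodLattice d L, ∀ z, p (z + k) = p z)
    (hD : volume (periodCell d L univ) < ⊤) {k : Plane} (hk : k ∈ periodLattice d L) :
    volume.real (periodCell d L univ) * (H k - H 0) =
      crossForm (∫ z in periodCell d L univ, p z) k := by
  have hper : IsPeriodicOpen d L (univ : Set Plane) := ⟨hL, isOpen_univ, fun _ _ _ => by simp⟩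
  have : IsFiniteMeasure (volume.restrict (periodCell d L univ)) := ⟨by simpa using hD⟩
  have hint : ∀ v : Plane, IntegrableOn (fun z => p (z + v)) (periodCell d L univ) := fun v =>
    Integrable.of_bound (by fun_prop) A (Eventually.of_forall fun z => hpA _)
  have htr : ∀ v : Plane, ∫ z in periodCell d L univ, p (z + v) =
      ∫ z in periodCell d L univ, p z := by
    intro v
    have hmp : ∀ v : Plane, MeasurePreserving (fun z : Plane => z + v)
        (volume.restrict univ) (volume.restrict univ) := fun v => by
      simpa only [Measure.restrict_univ] using measurePreserving_add_right volume v
    exact hper.setIntegral_comp (f := fun z => z + v) (g := fun z => z + -v) (F := p)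
      (fun z => by simp) (Homeomorph.addRight v).measurableEmbedding (hmp v) (hmp (-v))
      (fun k _ z => by abel) hp
  let Λk : Plane →L[ℝ] ℝ :=
    k 1 • EuclideanSpace.proj (𝕜 := ℝ) (0 : Fin 2) - k 0 • EuclideanSpace.proj (𝕜 := ℝ) (1 : Fin 2)
  have hΛ : ∀ x, crossForm x k = Λk x := fun x => by
    rw [crossForm_apply]; simp [Λk]; ring
  have h1 : ∀ z, H k - H 0 = ∫ t in (0 : ℝ)..1, crossForm (p (z + t • k)) k := by
    intro z
    rw [← sub_eq_of_hasFDerivAt_periodic hH (hp k hk) z]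
    have hd : ∀ t : ℝ, HasDerivAt (fun t : ℝ => H (z + t • k)) (crossForm (p (z + t • k)) k) t := by
      intro t
      have := ((hasDerivAt_id t).smul_const k).const_add z
      rw [one_smul] at this
      exact (hH (z + t • k)).comp_hasDerivAt t this
    rw [intervalIntegral.integral_eq_sub_of_hasDerivAt (fun t _ => hd t)]
    · simp
    · simp only [hΛ]
      exact Continuous.intervalIntegrable (by fun_prop) _ _
  have h2 : ∫ z in periodCell d L univ, (H k - H 0) =
      ∫ z in periodCell d L univ, ∫ t in (0 : ℝ)..1, crossForm (p (z + t • k)) k :=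
    integral_congr_ae (Eventually.of_forall fun z => h1 z)
  rw [setIntegral_const, smul_eq_mul] at h2
  rw [h2]
  simp only [intervalIntegral.integral_of_le zero_le_one, hΛ]
  rw [integral_integral_swap]
  · have : ∀ t : ℝ, ∫ z in periodCell d L univ, Λk (p (z + t • k)) =
        Λk (∫ z in periodCell d L univ, p z) := by
      intro t
      rw [Λk.integral_comp_comm (hint _), htr]
    simp [this]
  · refine Integrable.of_bound (C := ‖Λk‖ * A) ?_ (Eventually.of_forall fun x => ?_)
    · exact Continuous.aestronglyMeasurable (by simp only [Function.uncurry_def]; fun_prop)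
    · exact (Λk.le_opNorm _).trans (by gcongr; exact hpA _)

lemma periodCell_univ_inter : periodCell d L univ ∩ Ω = periodCell d L Ω := by
  ext z
  simp only [periodCell, mem_inter_iff, mem_ofPred_eq, mem_univ, true_and]
  exact and_comm

/-- The stream function of `g q`, for a bounded invariant periodic density `g`. Its increment over a
period `k` does not depend on the base point; it vanishes in a horizontal strip, and in the doubly
periodic case it is proportional to the cross product of `∫_C g q` and `k`. -/
theorem IsPeriodicFlow.exists_streamFunction (h : IsPeriodicFlow d L Ω q M φ)
    {g : Plane → ℝ} {B : ℝ≥0} (hg : ContinuousOn g Ω) (hB : ∀ z ∈ Ω, |g z| ≤ B)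
    (hgφ : ∀ t, ∀ z ∈ Ω, g (φ t z) = g z) (hgk : ∀ k ∈ periodLattice d L, ∀ z, g (z + k) = g z) :
    ∃ (H : Plane → ℝ), LipschitzWith (B * M) H ∧
      (∀ z ∈ Ω, HasFDerivAt H (crossForm (g z • q z)) z) ∧
      (∀ k ∈ periodLattice d L, ∀ z, H (z + k) - H z = H k - H 0) ∧
      (d = 1 → ∀ k ∈ periodLattice d L, H k = H 0) ∧
      (d = 2 → ∃ c > 0, ∀ k ∈ periodLattice d L,
        c * (H k - H 0) = crossForm (∫ z in periodCell d L Ω, g z • q z) k) := by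
  have hΩ := h.isFlow.isOpen
  have hΩm := hΩ.measurableSet
  set p : Plane → Plane := Ω.indicator fun z => g z • q z with hp
  have hgq : ContinuousOn (fun z => g z • q z) Ω := hg.smul h.isFlow.contDiffOn.continuousOn
  have hpm : AEStronglyMeasurable p volume :=
    (aestronglyMeasurable_indicator_iff hΩm).2 (hgq.aestronglyMeasurable hΩm)
  have hpA : ∀ z, ‖p z‖ ≤ (B * M : ℝ≥0) := by
    intro z
    by_cases hz : z ∈ Ω
    · rw [hp, indicator_of_mem hz, norm_smul]
      push_cast
      exact mul_le_mul (hB z hz) (h.isFlow.norm_le z hz) (norm_nonneg _) B.2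
    · rw [hp, indicator_of_notMem hz, norm_zero]
      exact NNReal.coe_nonneg _
  have hpk : ∀ k ∈ periodLattice d L, ∀ z, p (z + k) = p z := by
    intro k hk z
    have := h.isPeriodicOpen.add_mem_iff k hk z
    by_cases hz : z ∈ Ω
    · rw [hp, indicator_of_mem hz, indicator_of_mem (this.2 hz), hgk k hk, h.field_add k hk z hz]
    · rw [hp, indicator_of_notMem hz, indicator_of_notMem (by rwa [this])]
  obtain ⟨H, Hn, hHn, hlim, hLip, hH⟩ := PlanarFlow.exists_streamFunction hpm hpA fun ψ hψ hc => by
    rw [← h.integral_mul_fderiv_field_eq_zero (hg.aestronglyMeasurable hΩm) hB hgφ hψ hc,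
      ← integral_indicator hΩm]
    congr 1
    ext1 z
    by_cases hz : z ∈ Ω
    · simp [hp, hz]
    · simp [hp, hz]
  have hconst : ∀ n, ∀ k ∈ periodLattice d L, ∀ z, Hn n (z + k) - Hn n z = Hn n k - Hn n 0 :=
    fun n k hk z => sub_eq_of_hasFDerivAt_periodic (hHn n) (mollify_add (hpk k hk) n) z
  have hHk : ∀ k ∈ periodLattice d L, ∀ z, H (z + k) - H z = H k - H 0 := fun k hk z =>
    tendsto_nhds_unique ((hlim _).sub (hlim _))
      (((hlim k).sub (hlim 0)).congr fun n => (hconst n k hk z).symm)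
  refine ⟨H, hLip, fun z hz => ?_, hHk, ?_, ?_⟩
  · have e : p =ᶠ[𝓝 z] fun z => g z • q z :=
      (hΩ.mem_nhds hz |> fun h => mem_of_superset h fun y hy => indicator_of_mem hy _)
    have := hH z ((hgq.continuousAt (hΩ.mem_nhds hz)).congr e.symm)
    rwa [hp, indicator_of_mem hz] at this
  · rintro rfl k hk
    obtain ⟨R, hR⟩ := h.bounded
    have hk1 : k 1 = 0 := (hk 1).2 le_rfl
    -- far from `Ω` the mollified fields vanish
    let Y : Plane := (R + 2) • stdVec 1
    have hfar : ∀ x : Plane, R + 1 < x 1 → p x = 0 := fun x hx =>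
      indicator_of_notMem (fun hxΩ => by
        have := hR x hxΩ 1 le_rfl
        linarith [le_abs_self (x 1)]) _
    have hYt : ∀ t : ℝ, (Y + t • k) 1 = R + 2 := fun t => by simp [Y, stdVec, hk1]
    have hn : ∀ᶠ n in (hyperfilter ℕ : Filter ℕ), Hn n k - Hn n 0 = 0 := by
      have : ∀ᶠ n in (hyperfilter ℕ : Filter ℕ), (mollifier n).rOut < 1 :=
        Nat.hyperfilter_le_atTop (tendsto_mollifier_rOut.eventually (gt_mem_nhds zero_lt_one))
      filter_upwards [this] with n hn
      have hz : ∀ t : ℝ, mollify n p (Y + t • k) = 0 := by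
        intro t
        have h0 : p (Y + t • k) = 0 := hfar _ (by rw [hYt]; linarith)
        have := (mollifier n).dist_normed_convolution_le hpm (x₀ := Y + t • k) (ε := 0)
          fun w hw => by
            have h1 : |(w - (Y + t • k)) 1| < 1 :=
              (abs_apply_le_norm _ _).trans_lt (by rw [← dist_eq_norm]; exact hw.trans hn)
            rw [PiLp.sub_apply, hYt] at h1
            rw [h0, hfar w (by linarith [(abs_lt.1 h1).1]), dist_self]
        rw [h0] at this
        exact dist_le_zero.1 this
      have hd : ∀ t : ℝ, HasDerivAt (fun t : ℝ => Hn n (Y + t • k)) 0 t := by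
        intro t
        have h1 := ((hasDerivAt_id t).smul_const k).const_add Y
        have h2 := (hHn n (Y + t • k)).comp_hasDerivAt t h1
        rw [hz] at h2
        simpa [crossForm_apply, Function.comp_def] using h2
      have := is_const_of_deriv_eq_zero (fun t => (hd t).differentiableAt) (fun t => (hd t).deriv) 1 0
      rw [one_smul, zero_smul, add_zero] at this
      rw [← hconst n k hk Y, this, sub_self]
    have := tendsto_nhds_unique ((hlim k).sub (hlim 0))
      (tendsto_const_nhds.congr' (hn.mono fun n hn => hn.symm))
    exact sub_eq_zero.1 this
  · rintro rfl
    have hper : IsPeriodicOpen 2 L (univ : Set Plane) :=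
      ⟨h.isPeriodicOpen.pos, isOpen_univ, fun _ _ _ => by simp⟩
    have hD : volume (periodCell 2 L univ) < ⊤ :=
      (isBounded_periodCell (R := 0) fun z _ i hi => absurd hi (by omega)).measure_lt_top
    have hD0 : 0 < volume.real (periodCell 2 L univ) := by
      refine ENNReal.toReal_pos (hper.isOpen_periodCell.measure_pos volume
        ⟨WithLp.toLp 2 fun i => L i / 2, trivial, fun i hi => ?_⟩).ne' hD.ne
      have := hper.pos i hi
      exact ⟨half_pos this, half_lt_self this⟩
    refine ⟨_, hD0, fun k hk => ?_⟩
    have hloc : LocallyIntegrable p :=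
      (memLp_top_of_bound hpm _ (Eventually.of_forall hpA)).locallyIntegrable le_top
    have hn : ∀ n, volume.real (periodCell 2 L univ) * (Hn n k - Hn n 0) =
        crossForm (∫ z in periodCell 2 L univ, mollify n p z) k := fun n =>
      sub_mul_volume_eq hper.pos (hHn n) (contDiff_mollify hloc n).continuous
        (norm_mollify_le hpA n) (fun k hk => mollify_add (hpk k hk) n) hD hk
    have e : ∫ z in periodCell 2 L univ, p z = ∫ z in periodCell 2 L Ω, g z • q z := by
      rw [hp, setIntegral_indicator hΩm, periodCell_univ_inter]
    have hlim2 : Tendsto (fun n => ∫ z in periodCell 2 L univ, mollify n p z) atTop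
        (𝓝 (∫ z in periodCell 2 L univ, p z)) := by
      refine tendsto_integral_of_dominated_convergence (fun _ => (B * M : ℝ≥0))
        (fun n => (contDiff_mollify hloc n).continuous.aestronglyMeasurable)
        (integrableOn_const (hs := hD.ne))
        (fun n => Eventually.of_forall fun z => norm_mollify_le hpA n z)
        (ae_restrict_of_ae (ae_tendsto_mollify hloc))
    have hcont : Continuous fun x : Plane => crossForm x k := by
      simp only [crossForm_apply]
      fun_prop
    rw [← e]
    refine tendsto_nhds_unique (((hlim k).sub (hlim 0)).const_mul _) ?_
    simp only [hn]
    exact (hcont.tendsto _).comp (hlim2.mono_left Nat.hyperfilter_le_atTop)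

end

/-! ### Recurrence -/

section

variable {d : ℕ} {L : Fin 2 → ℝ} {Ω : Set Plane} {q : Plane → Plane} {M : ℝ≥0}
  {φ : ℝ → Plane → Plane}

/-- A stream function of `g q` is constant along the trajectories of `q`. -/
lemma IsFlow.streamFunction_apply (h : IsFlow Ω q M φ) {H g : Plane → ℝ}
    (hH : ∀ z ∈ Ω, HasFDerivAt H (crossForm (g z • q z)) z) {z : Plane} (hz : z ∈ Ω) (t : ℝ) :
    H (φ t z) = H z := by
  have hd : ∀ t, HasDerivAt (fun t => H (φ t z)) 0 t := fun t => by
    have := (hH _ (h.mem hz t)).comp_hasDerivAt t (h.hasDerivAt hz t)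
    refine this.congr_deriv ?_
    rw [crossForm_apply]
    simp only [PiLp.smul_apply, smul_eq_mul]
    ring
  have := is_const_of_deriv_eq_zero (fun t => (hd t).differentiableAt) (fun t => (hd t).deriv) t 0
  simpa [h.zero] using this

lemma crossForm_sq_add_inner_sq (p v : Plane) :
    crossForm p v ^ 2 + ⟪v, p⟫_ℝ ^ 2 = (‖p‖ * ‖v‖) ^ 2 := by
  rw [mul_pow, EuclideanSpace.norm_sq_eq, EuclideanSpace.norm_sq_eq, crossForm_apply,
    PiLp.inner_apply]
  simp only [Fin.sum_univ_two, Real.norm_eq_abs, sq_abs, RCLike.inner_apply, conj_trivial]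
  ring

lemma IsFlow.streamFunction_apply_one (h : IsFlow Ω q M φ) {H : Plane → ℝ}
    (hH : ∀ z ∈ Ω, HasFDerivAt H (crossForm (q z)) z) {z : Plane} (hz : z ∈ Ω) (t : ℝ) :
    H (φ t z) = H z :=
  h.streamFunction_apply (g := fun _ => 1) (by simpa only [one_smul] using hH) hz t

/-- Near a point where the field does not vanish, two points of the same level of the stream
function lie on the same short piece of a trajectory. -/
lemma IsFlow.exists_flowBox (h : IsFlow Ω q M φ) {H : Plane → ℝ}
    (hH : ∀ z ∈ Ω, HasFDerivAt H (crossForm (q z)) z) {z₀ : Plane} (hz₀ : z₀ ∈ Ω) (hq : q z₀ ≠ 0)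
    {ε : ℝ} (hε : 0 < ε) :
    ∃ N ∈ 𝓝 z₀, ∀ z ∈ N, ∀ z' ∈ N, H z = H z' → ∃ s, |s| ≤ ε ∧ φ s z = z' := by
  set p := q z₀ with hp
  have hp0 : 0 < ‖p‖ := norm_pos_iff.2 hq
  have hM : 0 < (M : ℝ) := hp0.trans_le (h.norm_le z₀ hz₀)
  have hqc : ContinuousAt q z₀ := h.contDiffOn.continuousOn.continuousAt (h.isOpen.mem_nhds hz₀)
  obtain ⟨r, hr, hrq⟩ : ∃ r > 0, ∀ y ∈ ball z₀ r, y ∈ Ω ∧ ‖q y - p‖ ≤ ‖p‖ / 4 := by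
    have h1 : ∀ᶠ y in 𝓝 z₀, y ∈ Ω ∧ dist (q y) p < ‖p‖ / 4 :=
      Filter.Eventually.and (h.isOpen.mem_nhds hz₀) (Metric.tendsto_nhds.1 hqc _ (by positivity))
    obtain ⟨r, hr, hr'⟩ := Metric.eventually_nhds_iff_ball.1 h1
    exact ⟨r, hr, fun y hy => ⟨(hr' y hy).1, by rw [← dist_eq_norm]; exact (hr' y hy).2.le⟩⟩
  set T := min ε (r / (4 * M)) with hT
  have hT0 : 0 < T := lt_min hε (by positivity)
  have hMT : M * T ≤ r / 4 := by
    calc M * T ≤ M * (r / (4 * M)) := by gcongr; exact min_le_right _ _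
      _ = r / 4 := by field_simp
  set δ := min (r / 4) (‖p‖ * T / 4) with hδ
  have hδ0 : 0 < δ := lt_min (by positivity) (by positivity)
  have hstay : ∀ z ∈ ball z₀ δ, ∀ s, |s| ≤ T → φ s z ∈ ball z₀ (r / 2) := by
    intro z hz s hs
    have h1 : dist (φ s z) z ≤ r / 4 := by
      rw [dist_eq_norm]
      exact (h.norm_sub_le s z).trans ((by gcongr : M * |s| ≤ M * T).trans hMT)
    have h2 : dist z z₀ < r / 4 := (mem_ball.1 hz).trans_le (min_le_left _ _)
    rw [mem_ball]
    linarith [dist_triangle (φ s z) z z₀]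
  have hsub : ball z₀ (r / 2) ⊆ ball z₀ r := ball_subset_ball (by linarith)
  have hδr : ball z₀ δ ⊆ ball z₀ (r / 2) :=
    ball_subset_ball ((min_le_left _ _).trans (by linarith))
  have hinner : ∀ y ∈ ball z₀ r, ‖p‖ ^ 2 * (3 / 4) ≤ ⟪q y, p⟫_ℝ := by
    intro y hy
    have h1 : |⟪q y - p, p⟫_ℝ| ≤ ‖p‖ / 4 * ‖p‖ :=
      (abs_real_inner_le_norm _ _).trans (by gcongr; exact (hrq y hy).2)
    rw [inner_sub_left, real_inner_self_eq_norm_sq] at h1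
    nlinarith [(abs_le.1 h1).1]
  refine ⟨ball z₀ δ, ball_mem_nhds _ hδ0, fun z hz z' hz' hHz => ?_⟩
  have hzΩ : z ∈ Ω := (hrq z (hsub (hδr hz))).1
  -- the trajectory of `z` crosses the line through `z'` that is orthogonal to the field at `z₀`
  let ℓ : ℝ → ℝ := fun s => ⟪φ s z - z', p⟫_ℝ
  have hℓ : ∀ s, HasDerivAt ℓ ⟪q (φ s z), p⟫_ℝ s := by
    intro s
    have := ((h.hasDerivAt hzΩ s).sub_const z').inner ℝ (hasDerivAt_const s p)
    simpa using this
  have hℓc : Continuous ℓ := continuous_iff_continuousAt.2 fun s => (hℓ s).continuousAt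
  have hℓ0 : |ℓ 0| < ‖p‖ ^ 2 * (3 / 4) * T := by
    have h1 : ‖φ 0 z - z'‖ ≤ δ + δ := by
      rw [h.zero, ← dist_eq_norm]
      exact (dist_triangle_right z z' z₀).trans (add_le_add (mem_ball.1 hz).le (mem_ball.1 hz').le)
    have h2 : δ ≤ ‖p‖ * T / 4 := min_le_right _ _
    refine ((abs_real_inner_le_norm _ _).trans (mul_le_mul_of_nonneg_right h1 hp0.le)).trans_lt ?_
    have : 0 < ‖p‖ ^ 2 * T := by positivity
    nlinarith
  have hmono : ∀ a b, -T ≤ a → a ≤ b → b ≤ T → ‖p‖ ^ 2 * (3 / 4) * (b - a) ≤ ℓ b - ℓ a := by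
    intro a b ha hab hb
    refine (convex_Icc a b).mul_sub_le_image_sub_of_le_deriv hℓc.continuousOn
      (fun s _ => (hℓ s).differentiableAt.differentiableWithinAt) (fun s hs => ?_) a
      (left_mem_Icc.2 hab) b (right_mem_Icc.2 hab) hab
    rw [interior_Icc] at hs
    rw [(hℓ s).deriv]
    exact hinner _ (hsub (hstay z hz s (abs_le.2 ⟨by linarith [hs.1], by linarith [hs.2]⟩)))
  have h1 := hmono 0 T (by linarith) hT0.le le_rfl
  have h2 := hmono (-T) 0 le_rfl (by linarith) hT0.le
  obtain ⟨s, hs, hs0⟩ := intermediate_value_Icc (by linarith : -T ≤ T) hℓc.continuousOn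
    (show (0 : ℝ) ∈ Icc (ℓ (-T)) (ℓ T) from
      ⟨by linarith [(abs_lt.1 hℓ0).2], by linarith [(abs_lt.1 hℓ0).1]⟩)
  have hsT : |s| ≤ T := abs_le.2 hs
  refine ⟨s, hsT.trans (min_le_left _ _), ?_⟩
  -- along this line the stream function is strictly monotone
  by_contra hne
  set v := φ s z - z' with hv
  have hv0 : 0 < ‖v‖ := norm_pos_iff.2 (sub_ne_zero.2 hne)
  have hseg : ∀ t ∈ Icc (0 : ℝ) 1, z' + t • v ∈ ball z₀ (r / 2) := by
    intro t ht
    have := (convex_ball z₀ (r / 2)).add_smul_sub_mem (hδr hz') (hstay z hz s hsT) ht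
    exact this
  have hd : ∀ t ∈ Icc (0 : ℝ) 1,
      HasDerivAt (fun t : ℝ => H (z' + t • v)) (crossForm (q (z' + t • v)) v) t := by
    intro t ht
    have := ((hasDerivAt_id t).smul_const v).const_add z'
    rw [one_smul] at this
    exact (hH _ (hrq _ (hsub (hseg t ht))).1).comp_hasDerivAt t this
  obtain ⟨t, ht, ht0⟩ := exists_hasDerivAt_eq_zero (f := fun t : ℝ => H (z' + t • v)) zero_lt_one
    (fun t ht => (hd t ht).continuousAt.continuousWithinAt)
    (by
      have : H (φ s z) = H z := h.streamFunction_apply_one hH hzΩ s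
      simp only [zero_smul, add_zero, one_smul, hv, add_sub_cancel, this, hHz])
    (fun t ht => hd t (Ioo_subset_Icc_self ht))
  have hq' := (hrq _ (hsub (hseg t (Ioo_subset_Icc_self ht)))).2
  have h3 := crossForm_sq_add_inner_sq p v
  have h4 : ⟪v, p⟫_ℝ = 0 := hs0
  rw [h4, zero_pow two_ne_zero, add_zero, sq_eq_sq_iff_abs_eq_abs, abs_of_pos (mul_pos hp0 hv0)] at h3
  have h5 : |crossForm (q (z' + t • v) - p) v| ≤ ‖p‖ / 4 * ‖v‖ := by
    refine ((crossForm _).le_opNorm v).trans ?_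
    gcongr
    exact (norm_crossForm_le _).trans hq'
  rw [← crossForm_sub, sub_apply, ht0, zero_sub, abs_neg, h3] at h5
  nlinarith [mul_pos hp0 hv0]

namespace IsPeriodicFlow

/-- Poincaré's recurrence theorem in the quotient of `Ω` by the periods, for the times `n ∈ ℕ`. -/
lemma ae_exists_mem_of_isOpen (h : IsPeriodicFlow d L Ω q M φ) {B : Set Plane} (hB : IsOpen B) :
    ∀ᵐ z ∂(volume.restrict Ω), z ∈ B →
      ∃ n : ℕ, 1 ≤ n ∧ ∃ k ∈ periodLattice d L, φ n z + k ∈ B := by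
  have hinv := h.isPeriodicOpen.vaddInvariantMeasure
  have hf := h.isFlow
  set B' : Set Plane := ⋃ k : latticeSubgroup d L, {z | z + k ∈ B} with hB'
  have hB'o : IsOpen B' := isOpen_iUnion fun k =>
    hB.preimage (continuous_id.add continuous_const)
  have hB'k : ∀ k ∈ periodLattice d L, ∀ z, z + k ∈ B' ↔ z ∈ B' := by
    intro k hk z
    let k' : latticeSubgroup d L := ⟨k, hk⟩
    simp only [hB', mem_iUnion, mem_ofPred_eq]
    constructor
    · rintro ⟨j, hj⟩
      exact ⟨k' + j, by simpa [k', add_assoc] using hj⟩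
    · rintro ⟨j, hj⟩
      exact ⟨-k' + j, by simpa [k', add_assoc] using hj⟩
  set A : Set Plane := B' ∩ ⋂ n : ℕ, (φ (n + 1 : ℝ)) ⁻¹' B'ᶜ with hA
  have hAm : MeasurableSet A := hB'o.measurableSet.inter
    (MeasurableSet.iInter fun n => hf.measurable _ hB'o.measurableSet.compl)
  have hAk : ∀ k ∈ periodLattice d L, ∀ z, z + k ∈ A ↔ z ∈ A := by
    intro k hk z
    simp only [hA, mem_inter_iff, mem_iInter, mem_preimage, mem_compl_iff, h.apply_add k hk,
      hB'k k hk]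
  have hE : ∀ n : ℕ, volume.restrict Ω (φ n ⁻¹' A ∩ periodCell d L Ω) =
      volume.restrict Ω (A ∩ periodCell d L Ω) := fun n =>
    h.isPeriodicOpen.measure_preimage_inter (g := φ (-n)) (hf.neg_apply n)
      (h.measurePreserving n) (h.measurePreserving (-n)) (fun k hk z => h.apply_add k hk _ z)
      hAm hAk
  have hdisj : Pairwise (Function.onFun Disjoint fun n : ℕ => φ n ⁻¹' A ∩ periodCell d L Ω) := by
    have key : ∀ m n : ℕ, m < n → ∀ z, φ m z ∈ A → φ n z ∈ A → False := by
      intro m n hmn z hm hn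
      obtain ⟨j, rfl⟩ := Nat.exists_eq_add_of_lt hmn
      have h1 := mem_iInter.1 hm.2 j
      rw [mem_preimage, ← hf.add] at h1
      apply h1
      have : ((j : ℝ) + 1 + m) = ((m + j + 1 : ℕ) : ℝ) := by push_cast; ring
      rw [this]
      exact hn.1
    intro m n hmn
    refine disjoint_left.2 fun z hz hz' => ?_
    rcases lt_or_gt_of_ne hmn with hlt | hlt
    · exact key m n hlt z hz.1 hz'.1
    · exact key n m hlt z hz'.1 hz.1
  have hzero : volume.restrict Ω (A ∩ periodCell d L Ω) = 0 := by
    by_contra hne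
    have h1 : volume.restrict Ω (⋃ n : ℕ, φ n ⁻¹' A ∩ periodCell d L Ω) = ⊤ := by
      rw [measure_iUnion hdisj fun n => (hf.measurable _ hAm).inter
        h.isPeriodicOpen.isOpen_periodCell.measurableSet]
      simp only [hE]
      exact ENNReal.tsum_const_eq_top_of_ne_zero hne
    have h2 : volume.restrict Ω (⋃ n : ℕ, φ n ⁻¹' A ∩ periodCell d L Ω) ≤
        volume (periodCell d L Ω) :=
      (measure_mono (iUnion_subset fun n => inter_subset_right)).trans (Measure.restrict_apply_le _ _)
    rw [h1] at h2
    exact absurd h.volume_periodCell_lt_top (not_lt.2 h2)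
  have hA0 : volume.restrict Ω A = 0 := by
    refine h.isPeriodicOpen.isAddFundamentalDomain.measure_zero_of_invariant A (fun k => ?_) hzero
    ext z
    rw [mem_vadd_set_iff_neg_vadd_mem, AddSubgroup.vadd_def, vadd_eq_add, add_comm]
    exact hAk _ (-k).2 z
  have : ∀ᵐ z ∂(volume.restrict Ω), z ∉ A := measure_eq_zero_iff_ae_notMem.1 hA0
  filter_upwards [this] with z hz hzB
  have hzB' : z ∈ B' := mem_iUnion.2 ⟨0, by simpa using hzB⟩
  have : ∃ n : ℕ, φ (n + 1 : ℝ) z ∈ B' := by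
    by_contra! hcon
    exact hz ⟨hzB', mem_iInter.2 hcon⟩
  obtain ⟨n, hn⟩ := this
  obtain ⟨k, hk⟩ := mem_iUnion.1 hn
  exact ⟨n + 1, by omega, k, k.2, by push_cast; exact hk⟩

/-- If the field has a periodic stream function, then almost every trajectory is closed up to a
period: it returns close to its initial point modulo the periods, on the same level of the stream
function. -/
theorem ae_exists_apply_eq_add (h : IsPeriodicFlow d L Ω q M φ) {H : Plane → ℝ}
    (hH : ∀ z ∈ Ω, HasFDerivAt H (crossForm (q z)) z)
    (hHk : ∀ k ∈ periodLattice d L, ∀ z, H (z + k) = H z) :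
    ∀ᵐ z ∂(volume.restrict Ω), q z ≠ 0 → ∃ τ > 0, ∃ k ∈ periodLattice d L, φ τ z = z + k := by
  have hf := h.isFlow
  have hb := TopologicalSpace.isBasis_countableBasis Plane
  have hrec : ∀ᵐ z ∂(volume.restrict Ω), ∀ B ∈ TopologicalSpace.countableBasis Plane, z ∈ B →
      ∃ n : ℕ, 1 ≤ n ∧ ∃ k ∈ periodLattice d L, φ n z + k ∈ B :=
    (ae_ball_iff (TopologicalSpace.countable_countableBasis Plane)).2
      fun B hB => h.ae_exists_mem_of_isOpen (hb.isOpen hB)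
  filter_upwards [hrec, ae_restrict_mem hf.isOpen.measurableSet] with z hz hzΩ hqz
  obtain ⟨N, hN, hNbox⟩ := hf.exists_flowBox hH hzΩ hqz (ε := 1 / 2) (by norm_num)
  obtain ⟨B, hB, hzB, hBN⟩ := hb.mem_nhds_iff.1 hN
  obtain ⟨n, hn, k, hk, hnk⟩ := hz B hB hzB
  have hHn : H (φ n z + k) = H z := by
    rw [hHk k hk]
    exact hf.streamFunction_apply_one hH hzΩ n
  obtain ⟨s, hs, hsz⟩ := hNbox _ (hBN hnk) _ (hBN hzB) hHn
  have hn' : (1 : ℝ) ≤ n := by exact_mod_cast hn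
  refine ⟨s + n, by linarith [(abs_le.1 hs).1], -k, (latticeSubgroup d L).neg_mem hk, ?_⟩
  rw [hf.add, eq_add_neg_iff_add_eq, ← h.apply_add k hk, hsz]

end IsPeriodicFlow

end

/-! ### The flux of a first integral -/

section

variable {d : ℕ} {L : Fin 2 → ℝ} {Ω : Set Plane} {q : Plane → Plane} {M : ℝ≥0}
  {φ : ℝ → Plane → Plane}

lemma exists_isPeriodicFlow (hL : ∀ i : Fin 2, i.val < d → 0 < L i)
    (hΩ : IsPeriodicDomain d L Ω) (hq : IsAdmissibleAdvection d L Ω q) :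
    ∃ M φ, IsTangentField Ω q M ∧ IsPeriodicFlow d L Ω q M φ := by
  obtain ⟨δ, -, hreg⟩ := hq.regular
  obtain ⟨M, hM⟩ := hreg.bounded
  have hT : IsTangentField Ω q M.toNNReal :=
    ⟨hΩ.isOpen, hΩ.hasC3Boundary, hreg.contDiffOn, hreg.continuousOn,
      fun z hz => (hM z hz).1.trans (Real.le_coe_toNNReal M),
      fun z hz => (hM z hz).2.trans (Real.le_coe_toNNReal M), hq.tangent⟩
  obtain ⟨φ, hφ⟩ := hT.exists_isFlow
  have hper : IsPeriodicOpen d L Ω := by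
    refine ⟨hL, hΩ.isOpen, fun k hk z => ?_⟩
    have h1 : z + k ∈ (fun z => z + k) '' Ω ↔ z ∈ Ω := (add_left_injective k).mem_set_image
    rwa [hΩ.periodic k hk] at h1
  have hqk : ∀ k ∈ periodLattice d L, ∀ z ∈ Ω, q (z + k) = q z := fun k hk z hz =>
    hq.periodic k hk z (subset_closure hz)
  obtain ⟨R, -, hR⟩ := hΩ.bounded
  exact ⟨_, φ, hT, hφ, hper, ⟨R, hR⟩, hqk, fun k hk t z =>
    hφ.apply_add (hper.add_mem_iff k hk) (hqk k hk) t z,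
    hφ.measurePreserving hT hq.divergence_eq_zero⟩

/-- A field with zero mean has a stream function which is periodic. -/
lemma IsPeriodicFlow.exists_periodic_streamFunction (h : IsPeriodicFlow d L Ω q M φ)
    (hd₁ : 1 ≤ d) (hd₂ : d ≤ 2) (hmean : ∀ i : Fin 2, i.val < d → ∫ z in periodCell d L Ω, q z i = 0) :
    ∃ H : Plane → ℝ, Continuous H ∧ (∀ z ∈ Ω, HasFDerivAt H (crossForm (q z)) z) ∧
      ∀ k ∈ periodLattice d L, ∀ z, H (z + k) = H z := by
  obtain ⟨H, hLip, hH, hHk, h1, h2⟩ := h.exists_streamFunction (g := fun _ => 1) (B := 1)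
    continuousOn_const (by simp) (by simp) (by simp)
  simp only [one_smul] at hH h2
  refine ⟨H, hLip.continuous, hH, fun k hk z => ?_⟩
  rw [← sub_eq_zero, hHk k hk, sub_eq_zero]
  rcases (by omega : d = 1 ∨ d = 2) with rfl | rfl
  · exact h1 rfl k hk
  · obtain ⟨c, hc, hck⟩ := h2 rfl
    have : IsFiniteMeasure (volume.restrict (periodCell 2 L Ω)) :=
      ⟨by simpa using h.volume_periodCell_lt_top⟩
    have hm := h.isPeriodicOpen.isOpen_periodCell.measurableSet
    have hint : IntegrableOn q (periodCell 2 L Ω) :=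
      Integrable.of_bound ((h.isFlow.contDiffOn.continuousOn.mono
        periodCell_subset).aestronglyMeasurable hm) M
        ((ae_restrict_iff' hm).2 (Eventually.of_forall fun z hz => h.isFlow.norm_le z hz.1))
    have h0 : ∫ z in periodCell 2 L Ω, q z = 0 := by
      ext i
      exact ((EuclideanSpace.proj (𝕜 := ℝ) i).integral_comp_comm hint).symm.trans (hmean i i.2)
    have := hck k hk
    rw [h0] at this
    simpa [crossForm_apply, hc.ne', sub_eq_zero] using this

/-- A trajectory closed up to a nonzero period is periodic and unbounded. -/
lemma IsPeriodicFlow.isUnboundedPeriodicTrajectory (h : IsPeriodicFlow d L Ω q M φ) {z k : Plane}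
    {τ : ℝ} (hz : z ∈ Ω) (hk : k ∈ periodLattice d L) (hk0 : k ≠ 0) (hzk : φ τ z = z + k) :
    IsUnboundedPeriodicTrajectory d L Ω q (range fun t => φ t z) k := by
  have hf := h.isFlow
  refine ⟨⟨_, hf.mem hz, hf.hasDerivAt hz, rfl⟩, fun hb => ?_, hk, hk0, ?_⟩
  · obtain ⟨R, hR⟩ := isBounded_iff_forall_norm_le.1 hb
    obtain ⟨n, hn⟩ := exists_nat_gt ((R + ‖z‖) / ‖k‖)
    have hkn := norm_pos_iff.2 hk0
    rw [div_lt_iff₀ hkn] at hn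
    have h1 := hf.apply_int_mul (h.apply_add k hk) hzk n
    have h2 := hR _ ⟨(n : ℤ) * τ, rfl⟩
    simp only [h1] at h2
    have h3 : ‖((n : ℤ) : ℝ) • k‖ ≤ ‖z + ((n : ℤ) : ℝ) • k‖ + ‖z‖ := by
      simpa using norm_sub_le (z + ((n : ℤ) : ℝ) • k) z
    rw [norm_smul] at h3
    simp only [Int.cast_natCast, Real.norm_natCast] at h3 h2
    linarith
  · ext y
    constructor
    · rintro ⟨_, ⟨t, rfl⟩, rfl⟩
      exact ⟨t + τ, by simp only [hf.add, hzk, h.apply_add k hk]⟩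
    · rintro ⟨t, rfl⟩
      refine ⟨_, ⟨t - τ, rfl⟩, ?_⟩
      simp only
      rw [← h.apply_add k hk, ← hzk, ← hf.add, sub_add_cancel]

/-- A point of an `a`-periodic unbounded trajectory is carried to its translate by `a`. -/
lemma IsPeriodicFlow.exists_apply_eq_add (h : IsPeriodicFlow d L Ω q M φ) {T : Set Plane}
    {a : Plane} (hT : IsUnboundedPeriodicTrajectory d L Ω q T a) :
    ∃ z ∈ Ω, ∃ τ ≠ 0, φ τ z = z + a := by
  obtain ⟨X, hXΩ, hX, rfl⟩ := hT.isTrajectory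
  have h1 : X 0 + a ∈ range X := by
    rw [← hT.add_period]
    exact mem_image_of_mem _ (mem_range_self 0)
  obtain ⟨τ, hτ⟩ := h1
  have h2 : φ τ (X 0) = X 0 + a := by rw [← h.isFlow.unique X hX hXΩ, hτ]
  refine ⟨X 0, hXΩ 0, τ, ?_, h2⟩
  rintro rfl
  rw [h.isFlow.zero, left_eq_add] at h2
  exact hT.period_ne_zero h2

/-- Almost every point has a rotation vector; the nonzero rotation vectors come from trajectories
that are closed up to a nonzero period. -/
lemma IsPeriodicFlow.ae_exists_rotation (h : IsPeriodicFlow d L Ω q M φ) {H : Plane → ℝ}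
    (hH : ∀ z ∈ Ω, HasFDerivAt H (crossForm (q z)) z)
    (hHk : ∀ k ∈ periodLattice d L, ∀ z, H (z + k) = H z) :
    ∃ v : Plane → Plane, ∀ᵐ z ∂(volume.restrict Ω),
      Tendsto (fun n : ℕ => (n : ℝ)⁻¹ • (φ n z - z)) atTop (𝓝 (v z)) ∧
      (v z ≠ 0 → ∃ τ, ∃ k ∈ periodLattice d L, k ≠ 0 ∧ φ τ z = z + k ∧ v z = τ⁻¹ • k) := by
  have hex : ∀ᵐ z ∂(volume.restrict Ω), ∃ v : Plane,
      Tendsto (fun n : ℕ => (n : ℝ)⁻¹ • (φ n z - z)) atTop (𝓝 v) ∧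
      (v ≠ 0 → ∃ τ, ∃ k ∈ periodLattice d L, k ≠ 0 ∧ φ τ z = z + k ∧ v = τ⁻¹ • k) := by
    filter_upwards [h.ae_exists_apply_eq_add hH hHk,
      ae_restrict_mem h.isFlow.isOpen.measurableSet] with z hz hzΩ
    by_cases hq : q z = 0
    · exact ⟨0, by simp [h.isFlow.apply_of_eq_zero hzΩ hq], fun h0 => absurd rfl h0⟩
    · obtain ⟨τ, hτ, k, hk, hzk⟩ := hz hq
      refine ⟨τ⁻¹ • k, h.isFlow.tendsto_of_apply_eq_add hτ (h.apply_add k hk) hzk,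
        fun h0 => ⟨τ, k, hk, ?_, hzk, rfl⟩⟩
      rintro rfl
      exact h0 (smul_zero _)
  classical
  refine ⟨fun z => if hz : ∃ v : Plane,
      Tendsto (fun n : ℕ => (n : ℝ)⁻¹ • (φ n z - z)) atTop (𝓝 v) ∧
      (v ≠ 0 → ∃ τ, ∃ k ∈ periodLattice d L, k ≠ 0 ∧ φ τ z = z + k ∧ v = τ⁻¹ • k)
    then hz.choose else 0, hex.mono fun z hz => ?_⟩
  simp only [dif_pos hz]
  exact hz.choose_spec

/-- The square of a first integral agrees almost everywhere with an invariant density which is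
periodic everywhere. -/
lemma IsPeriodicFlow.exists_density (h : IsPeriodicFlow d L Ω q M φ) (hT : IsTangentField Ω q M)
    (hdiv : ∀ z ∈ Ω, divergence q z = 0) {w : Plane → ℝ} (hw : IsFirstIntegral d L Ω q w) :
    ∃ g : Plane → ℝ, (∀ k ∈ periodLattice d L, ∀ z, g (z + k) = g z) ∧
      IntegrableOn g (periodCell d L Ω) ∧
      (∀ t, ∀ᵐ z ∂(volume.restrict Ω), g (φ t z) = g z) ∧
      ∀ᵐ z ∂(volume.restrict Ω), g z = w z ^ 2 := by
  classical
  obtain ⟨G, hG, hqG⟩ := hw.exists_gradient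
  have hfin : ∀ K, IsCompact K → IsFiniteMeasure (volume.restrict (Ω ∩ K)) := fun K hK =>
    ⟨by simpa using (measure_mono inter_subset_right).trans_lt hK.measure_lt_top⟩
  have hwint : ∀ K, IsCompact K → IntegrableOn w (Ω ∩ K) := fun K hK => by
    have := hfin K hK
    exact (hG.memLp K hK).integrable one_le_two
  have hGint : ∀ K, IsCompact K → IntegrableOn G (Ω ∩ K) := fun K hK => by
    have := hfin K hK
    exact (hG.memLp_gradient K hK).integrable one_le_two
  have hinv := h.isFlow.ae_comp_eq hT hdiv hG.hasWeakGradient hwint hGint hqG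
  have hper : ∀ᵐ z ∂(volume.restrict Ω), ∀ k ∈ periodLattice d L, w (z + k) = w z := by
    have := ae_all_iff.2 fun k : latticeSubgroup d L => hw.periodic k k.2
    filter_upwards [this] with z hz k hk using hz ⟨k, hk⟩
  let g : Plane → ℝ := fun z => if ∀ k ∈ periodLattice d L, w (z + k) = w z then w z ^ 2 else 0
  have hgw : ∀ᵐ z ∂(volume.restrict Ω), g z = w z ^ 2 := hper.mono fun z hz => if_pos hz
  refine ⟨g, fun k hk z => ?_, ?_, fun t => ?_, hgw⟩
  · have hiff : (∀ j ∈ periodLattice d L, w (z + k + j) = w (z + k)) ↔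
        ∀ j ∈ periodLattice d L, w (z + j) = w z := by
      constructor
      · intro hj j hj'
        have h1 := hj _ ((latticeSubgroup d L).neg_mem hk)
        rw [add_neg_cancel_right] at h1
        have h2 := hj _ ((latticeSubgroup d L).add_mem ((latticeSubgroup d L).neg_mem hk) hj')
        rw [← add_assoc, add_neg_cancel_right] at h2
        rw [h2, h1]
      · intro hj j hj'
        rw [hj k hk, add_assoc]
        exact hj _ ((latticeSubgroup d L).add_mem hk hj')
    simp only [g]
    by_cases hc : ∀ j ∈ periodLattice d L, w (z + j) = w z
    · rw [if_pos hc, if_pos (hiff.2 hc), hc k hk]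
    · rw [if_neg hc, if_neg (mt hiff.1 hc)]
  · obtain ⟨R, hR⟩ := h.bounded
    obtain ⟨R', hR'⟩ := (isBounded_periodCell (L := L) hR).subset_closedBall 0
    have h1 : IntegrableOn (fun z => w z ^ 2) (Ω ∩ closedBall 0 R') :=
      (hG.memLp _ (isCompact_closedBall 0 R')).integrable_sq
    refine (h1.mono_set (subset_inter periodCell_subset hR')).congr ?_
    exact ae_restrict_of_ae_restrict_of_subset periodCell_subset (hgw.mono fun z hz => hz.symm)
  · filter_upwards [hgw, (h.measurePreserving t).quasiMeasurePreserving.ae hgw, hinv t]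
      with z h1 h2 h3
    rw [h1, h2, h3]

/-- The flux of a first integral is a mean of rotation vectors. -/
theorem IsPeriodicFlow.exists_weightedFlux_eq (h : IsPeriodicFlow d L Ω q M φ)
    (hT : IsTangentField Ω q M) (hdiv : ∀ z ∈ Ω, divergence q z = 0) {H : Plane → ℝ}
    (hH : ∀ z ∈ Ω, HasFDerivAt H (crossForm (q z)) z)
    (hHk : ∀ k ∈ periodLattice d L, ∀ z, H (z + k) = H z) {w : Plane → ℝ}
    (hw : IsFirstIntegral d L Ω q w) :
    ∃ (g : Plane → ℝ) (v : Plane → Plane),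
      weightedFlux d L Ω q w = ∫ z in periodCell d L Ω, g z • v z ∧
      ∀ᵐ z ∂(volume.restrict (periodCell d L Ω)), v z ≠ 0 →
        z ∈ Ω ∧ ∃ τ, ∃ k ∈ periodLattice d L, k ≠ 0 ∧ φ τ z = z + k ∧ v z = τ⁻¹ • k := by
  obtain ⟨g, hgk, hg, hgφ, hgw⟩ := h.exists_density hT hdiv hw
  obtain ⟨v, hv⟩ := h.ae_exists_rotation hH hHk
  have hv' := ae_restrict_of_ae_restrict_of_subset (periodCell_subset (d := d) (L := L)) hv
  refine ⟨g, v, ?_, ?_⟩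
  · rw [← h.setIntegral_smul_field_eq hgk hg hgφ (hv'.mono fun z hz _ => hz.1), weightedFlux]
    refine integral_congr_ae ?_
    filter_upwards [ae_restrict_of_ae_restrict_of_subset periodCell_subset hgw] with z hz
    rw [hz]
  · filter_upwards [hv', ae_restrict_mem h.isPeriodicOpen.isOpen_periodCell.measurableSet]
      with z hz hzC h0
    exact ⟨hzC.1, hz.2 h0⟩

lemma exists_smul_of_crossForm_eq_zero {a v : Plane} (ha : a ≠ 0) (h : crossForm a v = 0) :
    ∃ t : ℝ, v = t • a := by
  rw [crossForm_apply] at h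
  have hn : a 0 ^ 2 + a 1 ^ 2 ≠ 0 := by
    have := EuclideanSpace.norm_sq_eq a
    simp only [Fin.sum_univ_two, Real.norm_eq_abs, sq_abs] at this
    rw [← this]
    exact pow_ne_zero 2 (norm_ne_zero_iff.2 ha)
  refine ⟨(a 0 * v 0 + a 1 * v 1) / (a 0 ^ 2 + a 1 ^ 2), ?_⟩
  ext i
  fin_cases i
  · simp only [Fin.zero_eta, PiLp.smul_apply, smul_eq_mul]
    field_simp
    linear_combination (-a 1) * h
  · simp only [Fin.mk_one, PiLp.smul_apply, smul_eq_mul]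
    field_simp
    linear_combination (a 0) * h

/-- If some invariant density has a flux that is a nonzero multiple of `a`, then the trajectories
that are closed up to a period are closed up to a multiple of `a`, because they lie on the levels
of the stream function associated with this density. -/
lemma IsPeriodicFlow.crossForm_eq_zero (h : IsPeriodicFlow d L Ω q M φ) (hd₁ : 1 ≤ d) (hd₂ : d ≤ 2)
    {g : Plane → ℝ} {B : ℝ≥0} (hg : ContinuousOn g Ω) (hB : ∀ z ∈ Ω, |g z| ≤ B)
    (hgφ : ∀ t, ∀ z ∈ Ω, g (φ t z) = g z) (hgk : ∀ k ∈ periodLattice d L, ∀ z, g (z + k) = g z)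
    {a : Plane} (ha : a ∈ periodLattice d L) {c : ℝ} (hc : c ≠ 0)
    (hga : ∫ z in periodCell d L Ω, g z • q z = c • a) {z k : Plane} {τ : ℝ} (hz : z ∈ Ω)
    (hk : k ∈ periodLattice d L) (hzk : φ τ z = z + k) : crossForm a k = 0 := by
  rcases (by omega : d = 1 ∨ d = 2) with rfl | rfl
  · rw [crossForm_apply, (ha 1).2 le_rfl, (hk 1).2 le_rfl]
    ring
  · obtain ⟨K, -, hK, hKk, -, h2⟩ := h.exists_streamFunction hg hB hgφ hgk
    obtain ⟨b, -, hbk⟩ := h2 rfl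
    have h3 := hbk k hk
    rw [← hKk k hk z, ← hzk, h.isFlow.streamFunction_apply hK hz, sub_self, mul_zero, hga,
      crossForm_apply] at h3
    rw [crossForm_apply]
    simp only [PiLp.smul_apply, smul_eq_mul] at h3
    have : c * (a 0 * k 1 - a 1 * k 0) = 0 := by linear_combination -h3
    exact (mul_eq_zero.1 this).resolve_left hc

end

/-! ### First integrals supported in a tube of periodic trajectories -/

section

variable {d : ℕ} {L : Fin 2 → ℝ} {Ω : Set Plane} {q : Plane → Plane} {M : ℝ≥0}
  {φ : ℝ → Plane → Plane}

/-- Near a point of a trajectory closed up to the period `a`, all the trajectories are closed up to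
`a`: the flow box contains both `s` and `φ τ s - a`, which are on the same level of the stream
function. The last clause says that the points of the flow box on the levels close to that of `z₀`
lie on trajectories that meet the compact set `S`. -/
lemma IsPeriodicFlow.exists_local_tube (h : IsPeriodicFlow d L Ω q M φ) {H : Plane → ℝ}
    (hH : ∀ z ∈ Ω, HasFDerivAt H (crossForm (q z)) z)
    (hHk : ∀ k ∈ periodLattice d L, ∀ z, H (z + k) = H z) {z₀ a : Plane} {τ : ℝ} (hz₀ : z₀ ∈ Ω)
    (ha : a ∈ periodLattice d L) (ha0 : a ≠ 0) (hτ : 0 < τ) (hza : φ τ z₀ = z₀ + a) :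
    ∃ (S N : Set Plane) (η : ℝ), IsCompact S ∧ S ⊆ N ∧ S ⊆ Ω ∧ IsOpen N ∧ z₀ ∈ S ∧ 0 < η ∧
      (∀ s ∈ S, ∃ σ ∈ Icc (τ / 2) (2 * τ), φ σ s = s + a) ∧
      ∀ z ∈ N, |H z - H z₀| < η → ∃ s ∈ S, ∃ u, φ u s = z := by
  have hf := h.isFlow
  have hq : q z₀ ≠ 0 := by
    intro h0
    rw [hf.apply_of_eq_zero hz₀ h0, left_eq_add] at hza
    exact ha0 hza
  obtain ⟨N', hN', hbox⟩ := hf.exists_flowBox hH hz₀ hq (half_pos hτ)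
  obtain ⟨N, hNN', hN, hz₀N⟩ := _root_.mem_nhds_iff.1 hN'
  have hret : ∀ᶠ s in 𝓝 z₀, φ τ s - a ∈ N := by
    have h1 : ContinuousAt (fun s => φ τ s - a) z₀ := (hf.continuousAt τ hz₀).sub_const a
    refine h1.eventually (hN.mem_nhds ?_)
    simpa only [hza, add_sub_cancel_right] using hz₀N
  obtain ⟨r, hr, hrS⟩ := Metric.nhds_basis_closedBall.eventually_iff.1
    (((hN.eventually_mem hz₀N).and (hf.isOpen.eventually_mem hz₀)).and hret)
  have hc : ContinuousOn H (closedBall z₀ r) := fun z hz =>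
    (hH z (hrS hz).1.2).continuousAt.continuousWithinAt
  have hder : crossForm (q z₀) ≠ 0 := by
    intro h0
    have := crossForm_sq_add_inner_sq (q z₀) (WithLp.toLp 2 ![-q z₀ 1, q z₀ 0])
    rw [h0] at this
    have h1 : q z₀ 0 ^ 2 + q z₀ 1 ^ 2 = ‖q z₀‖ ^ 2 := by
      rw [EuclideanSpace.norm_sq_eq]; simp [Fin.sum_univ_two]
    have h2 : crossForm (q z₀) (WithLp.toLp 2 ![-q z₀ 1, q z₀ 0]) = ‖q z₀‖ ^ 2 := by
      rw [crossForm_apply, ← h1]; simp; ring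
    rw [h0, zero_apply] at h2
    exact hq (norm_eq_zero.1 (pow_eq_zero_iff two_ne_zero |>.1 h2.symm))
  have hball : closedBall z₀ r ∈ 𝓝 z₀ := closedBall_mem_nhds z₀ hr
  obtain ⟨s₁, hs₁, hs₁H⟩ : ∃ s ∈ closedBall z₀ r, H z₀ < H s := by
    by_contra! hcon
    exact hder (IsLocalMax.hasFDerivAt_eq_zero (mem_of_superset hball hcon) (hH z₀ hz₀))
  obtain ⟨s₂, hs₂, hs₂H⟩ : ∃ s ∈ closedBall z₀ r, H s < H z₀ := by
    by_contra! hcon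
    exact hder (IsLocalMin.hasFDerivAt_eq_zero (mem_of_superset hball hcon) (hH z₀ hz₀))
  refine ⟨closedBall z₀ r, N, min (H s₁ - H z₀) (H z₀ - H s₂), isCompact_closedBall z₀ r,
    fun z hz => (hrS hz).1.1, fun z hz => (hrS hz).1.2, hN, mem_closedBall_self hr.le,
    lt_min (sub_pos.2 hs₁H) (sub_pos.2 hs₂H), fun s hs => ?_, fun z hz hHz => ?_⟩
  · obtain ⟨⟨hsN, hsΩ⟩, hsr⟩ := hrS hs
    have hHs : H (φ τ s - a) = H s := by
      rw [← hHk a ha, sub_add_cancel]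
      exact hf.streamFunction_apply_one hH hsΩ τ
    obtain ⟨u, hu, hus⟩ := hbox _ (hNN' hsr) _ (hNN' hsN) hHs
    refine ⟨u + τ, ⟨by linarith [(abs_le.1 hu).1], by linarith [(abs_le.1 hu).2]⟩, ?_⟩
    rw [hf.add, ← hus, ← h.apply_add a ha, sub_add_cancel, hus]
  · have hHz' : H z ∈ Icc (H s₂) (H s₁) := by
      have h1 := hHz.trans_le (min_le_left _ _)
      have h2 := hHz.trans_le (min_le_right _ _)
      exact ⟨by linarith [(abs_lt.1 h2).1], by linarith [(abs_lt.1 h1).2]⟩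
    obtain ⟨s, hs, hsH⟩ :=
      (convex_closedBall z₀ r).isPreconnected.intermediate_value hs₂ hs₁ hc hHz'
    obtain ⟨u, -, hu⟩ := hbox _ (hNN' (hrS hs).1.1) _ (hNN' hz) hsH
    exact ⟨s, hs, u, hu⟩

/-- The union of the translates by the periods of the trajectories that meet `S`. -/
def tube (d : ℕ) (L : Fin 2 → ℝ) (φ : ℝ → Plane → Plane) (S : Set Plane) : Set Plane :=
  {z | ∃ s ∈ S, ∃ t, ∃ k ∈ periodLattice d L, z = φ t s + k}

lemma isClosed_periodLattice : IsClosed (periodLattice d L) := by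
  have hcl : ∀ c : ℝ, IsClosed {x : ℝ | ∃ m : ℤ, x = m * c} := by
    intro c
    have := ((isClosedMap_smul₀ c).comp Int.isClosedEmbedding_coe_real.isClosedMap).isClosed_range
    convert this using 1
    ext x
    simp only [mem_ofPred_eq, mem_range, Function.comp_apply, smul_eq_mul]
    exact exists_congr fun m => by rw [mul_comm, eq_comm]
  have : periodLattice d L = ⋂ i : Fin 2, {k : Plane | (i.val < d → ∃ m : ℤ, k i = m * L i) ∧
      (d ≤ i.val → k i = 0)} := ext fun k => by rw [mem_iInter]; rfl
  rw [this]
  refine isClosed_iInter fun i => ?_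
  have hc : Continuous fun k : Plane => k i := by fun_prop
  by_cases hi : i.val < d
  · simp only [hi, true_imp_iff, not_le.2 hi, false_imp_iff, and_true]
    exact (hcl (L i)).preimage hc
  · simp only [hi, false_imp_iff, not_lt.1 hi, true_imp_iff, true_and]
    exact isClosed_eq hc continuous_const

lemma IsPeriodicFlow.tube_subset (h : IsPeriodicFlow d L Ω q M φ) {S : Set Plane} (hS : S ⊆ Ω) :
    tube d L φ S ⊆ Ω := by
  rintro _ ⟨s, hs, t, k, hk, rfl⟩
  exact (h.isPeriodicOpen.add_mem_iff k hk _).2 (h.isFlow.mem (hS hs) t)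

lemma add_mem_tube_iff {S : Set Plane} {k : Plane}
    (hk : k ∈ periodLattice d L) (z : Plane) : z + k ∈ tube d L φ S ↔ z ∈ tube d L φ S := by
  constructor
  · rintro ⟨s, hs, t, j, hj, e⟩
    refine ⟨s, hs, t, j - k, (latticeSubgroup d L).sub_mem hj hk, ?_⟩
    rw [← add_sub_assoc, ← e, add_sub_cancel_right]
  · rintro ⟨s, hs, t, j, hj, rfl⟩
    exact ⟨s, hs, t, j + k, (latticeSubgroup d L).add_mem hj hk, add_assoc _ _ _⟩

lemma IsPeriodicFlow.apply_mem_tube_iff (h : IsPeriodicFlow d L Ω q M φ) {S : Set Plane} (t : ℝ)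
    (z : Plane) : φ t z ∈ tube d L φ S ↔ z ∈ tube d L φ S := by
  have key : ∀ t z, z ∈ tube d L φ S → φ t z ∈ tube d L φ S := by
    rintro t _ ⟨s, hs, u, k, hk, rfl⟩
    exact ⟨s, hs, t + u, k, hk, by rw [h.apply_add k hk, h.isFlow.add]⟩
  refine ⟨fun hz => ?_, key t z⟩
  have := key (-t) _ hz
  rwa [h.isFlow.neg_apply] at this

lemma IsPeriodicFlow.exists_apply_eq_add_of_mem_tube (h : IsPeriodicFlow d L Ω q M φ)
    {S : Set Plane} {J : Set ℝ} {a : Plane} (ha : a ∈ periodLattice d L)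
    (hS : ∀ s ∈ S, ∃ σ ∈ J, φ σ s = s + a) {z : Plane} (hz : z ∈ tube d L φ S) :
    ∃ σ ∈ J, φ σ z = z + a := by
  obtain ⟨s, hs, t, k, hk, rfl⟩ := hz
  obtain ⟨σ, hσ, hσs⟩ := hS s hs
  refine ⟨σ, hσ, ?_⟩
  rw [h.apply_add k hk, ← h.isFlow.add, add_comm σ, h.isFlow.add, hσs, h.apply_add a ha]
  abel

open scoped Pointwise in
/-- A tube of trajectories that are all closed up to the same period is closed in the plane: modulo
the periods it is covered by bounded pieces of the trajectories of a compact set. -/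
lemma IsPeriodicFlow.isClosed_tube (h : IsPeriodicFlow d L Ω q M φ) {S : Set Plane}
    (hSc : IsCompact S) (hSΩ : S ⊆ Ω) {a : Plane} (ha : a ∈ periodLattice d L) {α β : ℝ}
    (hα : 0 < α) (hS : ∀ s ∈ S, ∃ σ ∈ Icc α β, φ σ s = s + a) : IsClosed (tube d L φ S) := by
  have hf := h.isFlow
  have hK : IsCompact ((fun p : ℝ × Plane => φ p.1 p.2) '' (Icc 0 β ×ˢ S)) :=
    (isCompact_Icc.prod hSc).image_of_continuousOn fun p hp =>
      (hf.continuousAt_uncurry p.1 (hSΩ hp.2)).continuousWithinAt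
  have : tube d L φ S = (fun p : ℝ × Plane => φ p.1 p.2) '' (Icc 0 β ×ˢ S) + periodLattice d L := by
    ext z
    constructor
    · rintro ⟨s, hs, t, k, hk, rfl⟩
      obtain ⟨σ, ⟨hσα, hσβ⟩, hσs⟩ := hS s hs
      have hσ : 0 < σ := hα.trans_le hσα
      have h1 : (⌊t / σ⌋ : ℝ) * σ ≤ t := (le_div_iff₀ hσ).1 (Int.floor_le _)
      have h2 : t < (⌊t / σ⌋ + 1) * σ := (div_lt_iff₀ hσ).1 (Int.lt_floor_add_one _)
      have hm := hf.apply_int_mul (h.apply_add a ha) hσs ⌊t / σ⌋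
      have hma : ((⌊t / σ⌋ : ℤ) : ℝ) • a ∈ periodLattice d L := by
        rw [Int.cast_smul_eq_zsmul]
        exact (latticeSubgroup d L).zsmul_mem ha _
      refine ⟨_, ⟨(t - ⌊t / σ⌋ * σ, s), ⟨⟨by simpa using h1, ?_⟩, hs⟩, rfl⟩,
        ((⌊t / σ⌋ : ℤ) : ℝ) • a + k, (latticeSubgroup d L).add_mem hma hk, ?_⟩
      · simp only
        linarith
      · simp only
        rw [← add_assoc, ← h.apply_add _ hma, ← hm, ← hf.add, sub_add_cancel]
    · rintro ⟨_, ⟨⟨t, s⟩, ⟨-, hs⟩, rfl⟩, k, hk, rfl⟩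
      exact ⟨s, hs, t, k, hk, rfl⟩
  rw [this]
  exact isClosed_periodLattice.add_left_of_isCompact hK

/-- The points of the tube on the levels of the stream function close to that of the central
trajectory are interior points of the tube. -/
lemma IsPeriodicFlow.tube_mem_nhds (h : IsPeriodicFlow d L Ω q M φ) {H : Plane → ℝ}
    (hHc : Continuous H) (hH : ∀ z ∈ Ω, HasFDerivAt H (crossForm (q z)) z)
    (hHk : ∀ k ∈ periodLattice d L, ∀ z, H (z + k) = H z) {S N : Set Plane} {c η : ℝ}
    (hSN : S ⊆ N) (hSΩ : S ⊆ Ω) (hN : IsOpen N)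
    (hNS : ∀ z ∈ N, |H z - c| < η → ∃ s ∈ S, ∃ u, φ u s = z) {z : Plane}
    (hz : z ∈ tube d L φ S) (hzc : |H z - c| < η) : tube d L φ S ∈ 𝓝 z := by
  have hf := h.isFlow
  have hzΩ := h.tube_subset hSΩ hz
  obtain ⟨s, hs, t, k, hk, rfl⟩ := hz
  have hback : φ (-t) (φ t s + k) + -k = s := by
    rw [h.apply_add k hk, hf.neg_apply, add_neg_cancel_right]
  have h1 : ∀ᶠ y in 𝓝 (φ t s + k), φ (-t) y + -k ∈ N := by
    have hc : ContinuousAt (fun y => φ (-t) y + -k) (φ t s + k) :=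
      (hf.continuousAt (-t) hzΩ).add_const (-k)
    exact hc.eventually (hN.mem_nhds (by simpa only [hback] using hSN hs))
  have h2 : ∀ᶠ y in 𝓝 (φ t s + k), |H y - c| < η :=
    ((hHc.sub continuous_const).abs.continuousAt).eventually (gt_mem_nhds hzc)
  filter_upwards [h1, h2, hf.isOpen.mem_nhds hzΩ] with y hy1 hy2 hyΩ
  have hnk := (latticeSubgroup d L).neg_mem hk
  have hHy : H (φ (-t) y + -k) = H y := by
    rw [hHk _ hnk]
    exact hf.streamFunction_apply_one hH hyΩ _
  obtain ⟨s', hs', u, hu⟩ := hNS _ hy1 (by rwa [hHy])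
  rw [← h.apply_mem_tube_iff (-t), ← add_mem_tube_iff hnk, ← hu]
  exact ⟨s', hs', u, 0, (latticeSubgroup d L).zero_mem, (add_zero _).symm⟩

end

section

variable {d : ℕ} {L : Fin 2 → ℝ} {Ω : Set Plane} {q : Plane → Plane} {M : ℝ≥0}
  {φ : ℝ → Plane → Plane}

lemma not_ae_eq_zero_of_continuous {w : Plane → ℝ} (hΩ : IsOpen Ω) (hw : Continuous w) {z : Plane}
    (hz : z ∈ Ω) (hwz : w z ≠ 0) : ¬ (w =ᵐ[volume.restrict Ω] 0) := by
  intro h0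
  have ho : IsOpen ({z | w z ≠ 0} ∩ Ω) := (isOpen_ne_fun hw continuous_const).inter hΩ
  have hpos := ho.measure_pos volume ⟨z, hwz, hz⟩
  have h1 : volume.restrict Ω {z | w z ≠ 0} = 0 := h0
  rw [Measure.restrict_apply (isOpen_ne_fun hw continuous_const).measurableSet] at h1
  exact hpos.ne' h1

/-- The flux of an invariant function supported by trajectories that are closed up to the period
`a`, with return times bounded from below, is a nonzero multiple of `a`. -/
lemma IsPeriodicFlow.exists_flux_eq_smul (h : IsPeriodicFlow d L Ω q M φ) {w : Plane → ℝ} {B : ℝ}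
    (hw : Continuous w) (hB : ∀ z, |w z| ≤ B) (hwφ : ∀ t z, w (φ t z) = w z)
    (hwk : ∀ k ∈ periodLattice d L, ∀ z, w (z + k) = w z) {a : Plane}
    (ha : a ∈ periodLattice d L) (ha0 : a ≠ 0) {α : ℝ} (hα : 0 < α)
    (hσ : ∀ z, w z ≠ 0 → ∃ σ, α ≤ σ ∧ φ σ z = z + a) {z₀ : Plane} (hz₀ : z₀ ∈ Ω)
    (hwz₀ : w z₀ ≠ 0) : ∃ c : ℝ, c ≠ 0 ∧ weightedFlux d L Ω q w = c • a := by
  have hf := h.isFlow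
  have := h.isPeriodicOpen.vaddInvariantMeasure
  have hfin : IsFiniteMeasure (volume.restrict (periodCell d L Ω)) :=
    ⟨by simpa using h.volume_periodCell_lt_top⟩
  choose! σ hσI hσa using hσ
  have hσ0 : ∀ z, w z ≠ 0 → 0 < σ z := fun z hz => hα.trans_le (hσI z hz)
  have hgint : IntegrableOn (fun z => w z ^ 2) (periodCell d L Ω) := by
    refine Integrable.of_bound (by fun_prop) (B ^ 2) (Eventually.of_forall fun z => ?_)
    rw [norm_pow]
    exact pow_le_pow_left₀ (norm_nonneg _) (hB z) 2
  have hlim : ∀ z, w z ^ 2 ≠ 0 →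
      Tendsto (fun n : ℕ => (n : ℝ)⁻¹ • (φ n z - z)) atTop (𝓝 ((σ z)⁻¹ • a)) := fun z hz =>
    hf.tendsto_of_apply_eq_add (hσ0 z (by simpa using hz)) (h.apply_add a ha)
      (hσa z (by simpa using hz))
  have hflux : weightedFlux d L Ω q w = ∫ z in periodCell d L Ω, w z ^ 2 • (σ z)⁻¹ • a :=
    h.setIntegral_smul_field_eq (g := fun z => w z ^ 2) (fun k hk z => by rw [hwk k hk]) hgint
      (fun t => Eventually.of_forall fun z => by simp only [hwφ]) (v := fun z => (σ z)⁻¹ • a)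
      (Eventually.of_forall hlim)
  let f : Plane → ℝ := fun z => w z ^ 2 * (σ z)⁻¹
  have hfa : ∀ z, w z ^ 2 • (σ z)⁻¹ • a = f z • a := fun z => smul_smul _ _ _
  simp only [hfa] at hflux
  rw [integral_smul_const] at hflux
  refine ⟨_, fun h0 => ?_, hflux⟩
  -- the return time is measurable because it is a limit of measurable functions
  have hfm : AEStronglyMeasurable f (volume.restrict (periodCell d L Ω)) := by
    have h1 : AEStronglyMeasurable (fun z => f z • a) (volume.restrict (periodCell d L Ω)) := by
      refine aestronglyMeasurable_of_tendsto_ae atTop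
        (f := fun (n : ℕ) z => w z ^ 2 • (n : ℝ)⁻¹ • (φ n z - z)) (fun n => ?_)
        (Eventually.of_forall fun z => ?_)
      · exact ((hw.measurable.pow_const 2).smul
          (((hf.measurable n).sub measurable_id).const_smul (n : ℝ)⁻¹)).aestronglyMeasurable
      · rw [← hfa]
        by_cases hz : w z ^ 2 = 0
        · simp [hz]
        · exact (hlim z hz).const_smul _
    have h2 := (h1.inner (𝕜 := ℝ) (aestronglyMeasurable_const (b := a))).const_mul (‖a‖ ^ 2)⁻¹
    refine h2.congr (Eventually.of_forall fun z => ?_)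
    have : ‖a‖ ^ 2 ≠ 0 := pow_ne_zero 2 (norm_ne_zero_iff.2 ha0)
    simp only [real_inner_smul_left, real_inner_self_eq_norm_sq]
    field_simp
  have hf0 : ∀ z, 0 ≤ f z := fun z => by
    by_cases hz : w z = 0
    · simp [f, hz]
    · exact mul_nonneg (sq_nonneg _) (inv_nonneg.2 (hσ0 z hz).le)
  have hfint : IntegrableOn f (periodCell d L Ω) := by
    refine Integrable.mono' (hgint.mul_const α⁻¹) hfm (Eventually.of_forall fun z => ?_)
    rw [Real.norm_eq_abs, abs_of_nonneg (hf0 z)]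
    by_cases hz : w z = 0
    · simp [f, hz]
    · exact mul_le_mul_of_nonneg_left (inv_anti₀ hα (hσI z hz)) (sq_nonneg _)
  have hfz := (integral_eq_zero_iff_of_nonneg hf0 hfint).1 h0
  have hA : volume.restrict Ω ({z | w z ≠ 0} ∩ periodCell d L Ω) = 0 := by
    have h1 : ∀ᵐ z ∂(volume.restrict (periodCell d L Ω)), ¬ w z ≠ 0 := by
      filter_upwards [hfz] with z hz hwz
      have hpos : 0 < w z ^ 2 * (σ z)⁻¹ := mul_pos (by positivity) (inv_pos.2 (hσ0 z hwz))
      exact hpos.ne' hz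
    rw [← restrict_periodCell, ae_iff] at h1
    simp only [not_not] at h1
    rwa [Measure.restrict_apply (isOpen_ne_fun hw continuous_const).measurableSet] at h1
  have hzero := h.isPeriodicOpen.isAddFundamentalDomain.measure_zero_of_invariant {z | w z ≠ 0}
    (fun k => by
      ext z
      rw [mem_vadd_set_iff_neg_vadd_mem, AddSubgroup.vadd_def, vadd_eq_add, add_comm, mem_ofPred_eq,
        hwk _ (-k).2, mem_ofPred_eq]) hA
  exact not_ae_eq_zero_of_continuous hf.isOpen hw hz₀ hwz₀ hzero

/-- A differentiable function with a bounded derivative has a weak gradient. -/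
lemma hasWeakGradient_of_hasFDerivAt {w : Plane → ℝ} {p : Plane → Plane} {C : ℝ}
    (hw : ∀ z, HasFDerivAt w (crossForm (p z)) z) (hp : AEStronglyMeasurable p volume)
    (hC : ∀ z, ‖p z‖ ≤ C) : HasWeakGradient Ω w fun z => WithLp.toLp 2 ![-p z 1, p z 0] := by
  intro ψ hψ hc hψΩ i
  have hwc : Continuous w := continuous_iff_continuousAt.2 fun z => (hw z).continuousAt
  have hdψ : Continuous fun z => fderiv ℝ ψ z (stdVec i) :=
    (hψ.continuous_fderiv (by simp)).clm_apply continuous_const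
  have hcψ : HasCompactSupport fun z => fderiv ℝ ψ z (stdVec i) :=
    hc.fderiv_apply (𝕜 := ℝ) (stdVec i)
  have hG : ∀ z, crossForm (p z) (stdVec i) = (![-p z 1, p z 0] : Fin 2 → ℝ) i := by
    intro z
    rw [crossForm_apply]
    fin_cases i <;> simp [stdVec]
  have hout : ∀ z, z ∉ Ω → ψ z = 0 := fun z hz => image_eq_zero_of_notMem_tsupport
    fun h0 => hz (hψΩ h0)
  have hout' : ∀ z, z ∉ Ω → fderiv ℝ ψ z (stdVec i) = 0 := fun z hz => by
    rw [image_eq_zero_of_notMem_tsupport (f := fderiv ℝ ψ)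
      fun h0 => hz (hψΩ (tsupport_fderiv_subset ℝ h0)), zero_apply]
  rw [setIntegral_eq_integral_of_forall_compl_eq_zero fun z hz => by rw [hout' z hz, mul_zero],
    setIntegral_eq_integral_of_forall_compl_eq_zero fun z hz => by rw [hout z hz, mul_zero]]
  have hfd : ∀ z, fderiv ℝ w z (stdVec i) = (![-p z 1, p z 0] : Fin 2 → ℝ) i := fun z => by
    rw [(hw z).fderiv, hG]
  simp only [← hfd]
  refine integral_mul_fderiv_eq_neg_fderiv_mul_of_integrable (μ := volume) ?_
    ((hwc.mul hdψ).integrable_of_hasCompactSupport hcψ.mul_left)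
    ((hwc.mul hψ.continuous).integrable_of_hasCompactSupport hc.mul_left)
    (fun z _ => (hw z).differentiableAt) (fun z _ => (hψ.differentiable (by simp)) z)
  simp only [hfd, ← hG]
  refine (hψ.continuous.integrable_of_hasCompactSupport hc).bdd_mul (c := C * ‖stdVec i‖) ?_
    (Eventually.of_forall fun z => ?_)
  · simp only [crossForm_apply]
    have hp' : ∀ j : Fin 2, AEStronglyMeasurable (fun z => p z j) volume := fun j =>
      (EuclideanSpace.proj (𝕜 := ℝ) j).continuous.comp_aestronglyMeasurable hp
    exact ((hp' 0).mul_const _).sub ((hp' 1).mul_const _)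
  · refine ((crossForm _).le_opNorm _).trans ?_
    gcongr
    exact (norm_crossForm_le _).trans (hC z)

/-- A function of the stream function, localized in a tube of periodic trajectories, is a first
integral whose flux is a nonzero multiple of the period. -/
theorem IsPeriodicFlow.exists_tube_firstIntegral (h : IsPeriodicFlow d L Ω q M φ) {H : Plane → ℝ}
    (hHc : Continuous H) (hH : ∀ z ∈ Ω, HasFDerivAt H (crossForm (q z)) z)
    (hHk : ∀ k ∈ periodLattice d L, ∀ z, H (z + k) = H z) {z₀ a : Plane} {τ : ℝ} (hz₀ : z₀ ∈ Ω)
    (ha : a ∈ periodLattice d L) (ha0 : a ≠ 0) (hτ : 0 < τ) (hza : φ τ z₀ = z₀ + a) :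
    ∃ w : Plane → ℝ, IsFirstIntegral d L Ω q w ∧ Continuous w ∧ (∀ z, |w z| ≤ 1) ∧
      (∀ t z, w (φ t z) = w z) ∧ (∀ k ∈ periodLattice d L, ∀ z, w (z + k) = w z) ∧
      ∃ c : ℝ, c ≠ 0 ∧ weightedFlux d L Ω q w = c • a := by
  have hf := h.isFlow
  obtain ⟨S, N, η, hSc, hSN, hSΩ, hN, hz₀S, hη, hSa, hNS⟩ :=
    h.exists_local_tube hH hHk hz₀ ha ha0 hτ hza
  set F := tube d L φ S with hF
  have hFc : IsClosed F := h.isClosed_tube hSc hSΩ ha (half_pos hτ) hSa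
  have hFΩ : F ⊆ Ω := h.tube_subset hSΩ
  have hz₀F : z₀ ∈ F := ⟨z₀, hz₀S, 0, 0, (latticeSubgroup d L).zero_mem, by rw [hf.zero, add_zero]⟩
  let χ : ContDiffBump (0 : ℝ) := ⟨η / 2, η, half_pos hη, half_lt_self hη⟩
  have hχ : ContDiff ℝ 1 χ := χ.contDiff
  have hχd : ∀ x, HasDerivAt χ (deriv χ x) x := fun x =>
    (hχ.differentiable one_ne_zero x).hasDerivAt
  have hχd0 : ∀ x, η ≤ |x| → χ x = 0 ∧ deriv χ x = 0 := by
    intro x hx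
    have h0 : χ x = 0 := χ.zero_of_le_dist (by simpa [Real.dist_eq] using hx)
    exact ⟨h0, IsLocalMin.deriv_eq_zero (Eventually.of_forall fun y => h0.trans_le χ.nonneg)⟩
  let w : Plane → ℝ := F.indicator fun z => χ (H z - H z₀)
  let p : Plane → Plane := F.indicator fun z => deriv χ (H z - H z₀) • q z
  have hwd : ∀ z, HasFDerivAt w (crossForm (p z)) z := by
    intro z
    by_cases hz : z ∈ F
    · have hd : HasFDerivAt (fun z => χ (H z - H z₀)) (crossForm (p z)) z := by
        have h1 := (hχd (H z - H z₀)).comp_hasFDerivAt z ((hH z (hFΩ hz)).sub_const (H z₀))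
        refine h1.congr_fderiv ?_
        ext v
        simp only [p, indicator_of_mem hz, smul_apply, crossForm_apply, PiLp.smul_apply, smul_eq_mul]
        ring
      rcases lt_or_ge |H z - H z₀| η with hlt | hge
      · refine hd.congr_of_eventuallyEq ?_
        filter_upwards [h.tube_mem_nhds hHc hH hHk hSN hSΩ hN hNS hz hlt] with y hy
        exact indicator_of_mem hy _
      · -- at the edge of the tube the profile vanishes with its derivative
        obtain ⟨h0, h0'⟩ := hχd0 _ hge
        have hp0 : crossForm (p z) = 0 := by
          simp only [p, indicator_of_mem hz, h0', zero_smul]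
          ext v
          simp [crossForm_apply]
        rw [hp0] at hd ⊢
        refine HasFDerivAt.of_isLittleO ((Asymptotics.IsBigO.of_bound 1
          (Eventually.of_forall fun y => ?_)).trans_isLittleO hd.isLittleO)
        have hwz : w z = 0 := by simp only [w, indicator_of_mem hz, h0]
        simp only [zero_apply, sub_zero, hwz, h0, one_mul]
        exact norm_indicator_le_norm_self _ y
    · have h1 : w =ᶠ[𝓝 z] fun _ => 0 := by
        filter_upwards [hFc.isOpen_compl.mem_nhds hz] with y hy
        exact indicator_of_notMem hy _
      have hp0 : crossForm (p z) = 0 := by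
        simp only [p, indicator_of_notMem hz]
        ext v
        simp [crossForm_apply]
      rw [hp0]
      exact (hasFDerivAt_const (0 : ℝ) z).congr_of_eventuallyEq h1
  have hwc : Continuous w := continuous_iff_continuousAt.2 fun z => (hwd z).continuousAt
  have hw1 : ∀ z, |w z| ≤ 1 := by
    intro z
    by_cases hz : z ∈ F
    · simp only [w, indicator_of_mem hz]
      rw [abs_of_nonneg χ.nonneg]
      exact χ.le_one
    · simp only [w, indicator_of_notMem hz, abs_zero, zero_le_one]
  have hwφ : ∀ t z, w (φ t z) = w z := by
    intro t z
    have hiff : φ t z ∈ F ↔ z ∈ F := h.apply_mem_tube_iff t z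
    by_cases hz : z ∈ F
    · simp only [w, indicator_of_mem hz, indicator_of_mem (hiff.2 hz)]
      rw [hf.streamFunction_apply_one hH (hFΩ hz)]
    · simp only [w, indicator_of_notMem hz, indicator_of_notMem (mt hiff.1 hz)]
  have hwk : ∀ k ∈ periodLattice d L, ∀ z, w (z + k) = w z := by
    intro k hk z
    have hiff : z + k ∈ F ↔ z ∈ F := add_mem_tube_iff hk z
    by_cases hz : z ∈ F
    · simp only [w, indicator_of_mem hz, indicator_of_mem (hiff.2 hz), hHk k hk]
    · simp only [w, indicator_of_notMem hz, indicator_of_notMem (mt hiff.1 hz)]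
  have hwz₀ : w z₀ ≠ 0 := by
    simp only [w, indicator_of_mem hz₀F, sub_self]
    rw [χ.one_of_mem_closedBall (mem_closedBall_self χ.rIn_pos.le)]
    exact one_ne_zero
  have hdc : Continuous (deriv χ) := hχ.continuous_deriv le_rfl
  obtain ⟨C, hC⟩ : ∃ C, ∀ x, ‖deriv χ x‖ ≤ C := by
    have : HasCompactSupport (deriv χ) := χ.hasCompactSupport.deriv
    exact this.exists_bound_of_continuous hdc
  have hC0 : 0 ≤ C := (norm_nonneg _).trans (hC 0)
  have hpB : ∀ z, ‖p z‖ ≤ C * M := by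
    intro z
    by_cases hz : z ∈ F
    · simp only [p, indicator_of_mem hz]
      rw [norm_smul]
      exact mul_le_mul (hC _) (hf.norm_le z (hFΩ hz)) (norm_nonneg _) hC0
    · simp only [p, indicator_of_notMem hz, norm_zero]
      positivity
  have hpm : AEStronglyMeasurable p volume := by
    refine (aestronglyMeasurable_indicator_iff hFc.measurableSet).2
      (ContinuousOn.aestronglyMeasurable ?_ hFc.measurableSet)
    exact (hdc.comp (hHc.sub continuous_const)).continuousOn.smul
      (hf.contDiffOn.continuousOn.mono hFΩ)
  have hGm : AEStronglyMeasurable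
      (fun z => (WithLp.toLp 2 ![-p z 1, p z 0] : Plane)) volume := by
    have : Continuous fun x : Plane => (WithLp.toLp 2 ![-x 1, x 0] : Plane) := by
      refine (PiLp.continuous_toLp 2 _).comp (continuous_pi fun i => ?_)
      fin_cases i
      · exact (show Continuous fun x : Plane => -x 1 by fun_prop)
      · exact (show Continuous fun x : Plane => x 0 by fun_prop)
    exact this.comp_aestronglyMeasurable hpm
  have hGB : ∀ z, ‖(WithLp.toLp 2 ![-p z 1, p z 0] : Plane)‖ ≤ C * M := by
    intro z
    refine le_trans (le_of_eq ?_) (hpB z)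
    rw [EuclideanSpace.norm_eq, EuclideanSpace.norm_eq]
    simp [Fin.sum_univ_two, add_comm]
  have hfin : ∀ K, IsCompact K → IsFiniteMeasure (volume.restrict (Ω ∩ K)) := fun K hK =>
    ⟨by simpa using (measure_mono inter_subset_right).trans_lt hK.measure_lt_top⟩
  refine ⟨w, ⟨not_ae_eq_zero_of_continuous hf.isOpen hwc hz₀ hwz₀, fun k hk =>
    Eventually.of_forall (hwk k hk), fun z => WithLp.toLp 2 ![-p z 1, p z 0],
    ⟨fun K hK => ?_, fun K hK => ?_, hasWeakGradient_of_hasFDerivAt hwd hpm hpB⟩,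
    Eventually.of_forall fun z => ?_⟩, hwc, hw1, hwφ, hwk, ?_⟩
  · have := hfin K hK
    exact MemLp.of_bound hwc.aestronglyMeasurable 1 (Eventually.of_forall hw1)
  · have := hfin K hK
    exact MemLp.of_bound hGm.restrict (C * M) (Eventually.of_forall hGB)
  · rw [PiLp.inner_apply]
    by_cases hz : z ∈ F
    · simp [Fin.sum_univ_two, p, hz]
      ring
    · simp [Fin.sum_univ_two, p, hz]
  · refine h.exists_flux_eq_smul hwc hw1 hwφ hwk ha ha0 (half_pos hτ) (fun z hz => ?_) hz₀ hwz₀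
    have hzF : z ∈ F := by
      by_contra hzF
      exact hz (indicator_of_notMem hzF _)
    obtain ⟨σ, hσ, hσz⟩ := h.exists_apply_eq_add_of_mem_tube ha hSa hzF
    exact ⟨σ, hσ.1, hσz⟩

end

section

variable {d : ℕ} {L : Fin 2 → ℝ} {Ω : Set Plane} {q : Plane → Plane} {M : ℝ≥0}
  {φ : ℝ → Plane → Plane}

/-- An `a`-periodic unbounded trajectory carries a bounded continuous first integral, invariant and
periodic everywhere, whose flux is a nonzero multiple of `a`. -/
lemma IsPeriodicFlow.exists_firstIntegral_of_trajectory (h : IsPeriodicFlow d L Ω q M φ)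
    {H : Plane → ℝ} (hHc : Continuous H) (hH : ∀ z ∈ Ω, HasFDerivAt H (crossForm (q z)) z)
    (hHk : ∀ k ∈ periodLattice d L, ∀ z, H (z + k) = H z) {T : Set Plane} {a : Plane}
    (hT : IsUnboundedPeriodicTrajectory d L Ω q T a) :
    ∃ w : Plane → ℝ, IsFirstIntegral d L Ω q w ∧ Continuous w ∧ (∀ z, |w z| ≤ 1) ∧
      (∀ t z, w (φ t z) = w z) ∧ (∀ k ∈ periodLattice d L, ∀ z, w (z + k) = w z) ∧
      ∃ c : ℝ, c ≠ 0 ∧ weightedFlux d L Ω q w = c • a := by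
  obtain ⟨z, hz, τ, hτ, hza⟩ := h.exists_apply_eq_add hT
  rcases hτ.lt_or_gt with hneg | hpos
  · -- running backwards in time, the trajectory is closed up to `-a`
    have ha := (latticeSubgroup d L).neg_mem hT.period_mem
    have hza' : φ (-τ) z = z + -a := by
      rw [← sub_eq_add_neg, eq_sub_iff_add_eq, ← h.apply_add a hT.period_mem, ← hza,
        h.isFlow.neg_apply]
    obtain ⟨w, h1, h2, h3, h4, h5, c, hc, hca⟩ := h.exists_tube_firstIntegral hHc hH hHk hz ha
      (neg_ne_zero.2 hT.period_ne_zero) (neg_pos.2 hneg) hza'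
    exact ⟨w, h1, h2, h3, h4, h5, -c, neg_ne_zero.2 hc, by rw [hca, smul_neg, neg_smul]⟩
  · exact h.exists_tube_firstIntegral hHc hH hHk hz hT.period_mem hT.period_ne_zero hpos hza

end

end PlanarFlow

theorem theorem2 (d : ℕ) (hd₁ : 1 ≤ d) (hd₂ : d ≤ 2)
    (L : Fin 2 → ℝ) (hL : ∀ i : Fin 2, i.val < d → 0 < L i)
    (Ω : Set Plane) (hΩ : IsPeriodicDomain d L Ω)
    (q : Plane → Plane) (hq : IsAdmissibleAdvection d L Ω q) :
    ((∃ w : Plane → ℝ, IsFirstIntegral d L Ω q w ∧ weightedFlux d L Ω q w ≠ 0) ↔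
      (∃ (T : Set Plane) (a : Plane), IsUnboundedPeriodicTrajectory d L Ω q T a)) ∧
    (∀ (T : Set Plane) (a : Plane), IsUnboundedPeriodicTrajectory d L Ω q T a →
      ∀ w : Plane → ℝ, IsFirstIntegral d L Ω q w → ∃ t : ℝ, weightedFlux d L Ω q w = t • a) := by
  obtain ⟨M, φ, hT, h⟩ := PlanarFlow.exists_isPeriodicFlow hL hΩ hq
  obtain ⟨H, hHc, hH, hHk⟩ := h.exists_periodic_streamFunction hd₁ hd₂ hq.mean_zero
  have hdiv := hq.divergence_eq_zero
  refine ⟨⟨?_, ?_⟩, ?_⟩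
  · rintro ⟨w, hw, hw0⟩
    obtain ⟨g, v, hgv, hv⟩ := h.exists_weightedFlux_eq hT hdiv hH hHk hw
    by_contra hcon
    apply hw0
    rw [hgv]
    refine integral_eq_zero_of_ae (hv.mono fun z hz => ?_)
    by_cases hvz : v z = 0
    · simp [hvz]
    · obtain ⟨hzΩ, τ, k, hk, hk0, hzk, -⟩ := hz hvz
      exact absurd ⟨_, k, h.isUnboundedPeriodicTrajectory hzΩ hk hk0 hzk⟩ hcon
  · rintro ⟨T, a, hTa⟩
    obtain ⟨w, hw, -, -, -, -, c, hc, hca⟩ := h.exists_firstIntegral_of_trajectory hHc hH hHk hTa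
    exact ⟨w, hw, by rw [hca]; exact smul_ne_zero hc hTa.period_ne_zero⟩
  · intro T a hTa w hw
    obtain ⟨u, hu, huc, hu1, huφ, huk, c, hc, hca⟩ :=
      h.exists_firstIntegral_of_trajectory hHc hH hHk hTa
    obtain ⟨g, v, hgv, hv⟩ := h.exists_weightedFlux_eq hT hdiv hH hHk hw
    refine PlanarFlow.exists_smul_of_crossForm_eq_zero hTa.period_ne_zero ?_
    have hcross : ∀ᵐ z ∂(volume.restrict (periodCell d L Ω)),
        PlanarFlow.crossForm a (g z • v z) = 0 := by
      filter_upwards [hv] with z hz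
      by_cases hvz : v z = 0
      · simp [hvz]
      · obtain ⟨hzΩ, τ, k, hk, -, hzk, hvk⟩ := hz hvz
        have := h.crossForm_eq_zero hd₁ hd₂ (g := fun z => u z ^ 2) (B := 1)
          (huc.pow 2).continuousOn (fun z _ => by
            rw [abs_pow]; exact pow_le_one₀ (abs_nonneg _) (hu1 z))
          (fun t z _ => by rw [huφ]) (fun k hk z => by rw [huk k hk]) hTa.period_mem hc hca
          hzΩ hk hzk
        rw [hvk, map_smul, map_smul, this, smul_zero, smul_zero]
    rw [hgv]
    by_cases hint : IntegrableOn (fun z => g z • v z) (periodCell d L Ω)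
    · rw [← (PlanarFlow.crossForm a).integral_comp_comm hint]
      exact integral_eq_zero_of_ae hcross
    · rw [integral_undef hint, map_zero]
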